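/- \textbf{Theorem.} The set of recursive presentations of $*$-universal groups is $d$-$\Sigma^0_3$-complete. Here the following terminology is used. A \emph{ceer} is a computably enumerable equivalence relation. A relation $E$ is \emph{computably reducible} to $R$ if there is a computable function $f$ with $x\mathrel{E}y\iff f(x)\mathrel{R}f(y)$ for all $x,y$. A ceer is \emph{universal} if every ceer on $\omega$ is computably reducible to it. A \emph{recursive presentation} is a presentation $\langle X\mid R\rangle$ with $X=\{x_i : i\in\omega\}$ or $X=\{x_0,\dots,x_{k-1}\}$ for some $k\in\omega$, and $R$ a c.e. set of words in $X\cup X^{-1}$; it is given by the size of $X$ (a number $k$ or $\omega$) together with an index of the c.e. set $R$. The \emph{word problem} $W_G$ of a group $G$ so presented is the equivalence relation on the words in $X\cup X^{-1}$ that relates two words exactly when they represent the same element of $G$; the word problem of a free product $G*H$ is taken with respect to the disjoint union of the generating sets of $G$ and $H$. A recursively presented group $G$ is \emph{$*$-universal} if $W_G$ is not a universal ceer, but $W_{G*H}$ is a universal ceer for every nontrivial recursively presented group $H$. A set is \emph{$d$-$\Sigma^0_3$} if it is the difference $S\setminus T$ of two $\Sigma^0_3$ sets, and it is \emph{$d$-$\Sigma^0_3$-complete}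 if moreover every $d$-$\Sigma^0_3$ set of natural numbers is many-one reducible to it. -/

import Mathlib

namespace CeerGroups

/-! ### Ceers -/

/-- `E` is computably reducible to `R`: some computable `f` satisfies `x E y ↔ f x R f y`. -/
def Reduces {α β : Type} [Primcodable α] [Primcodable β]
    (E : α → α → Prop) (R : β → β → Prop) : Prop :=
  ∃ f : α → β, Computable f ∧ ∀ x y, E x y ↔ R (f x) (f y)

/-- A ceer: a computably enumerable equivalence relation. -/
def IsCeer {α : Type} [Primcodable α] (E : α → α → Prop) : Prop :=
  Equivalence E ∧ REPred fun p : α × α => E p.1 p.2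

/-- A universal ceer: a ceer to which every ceer on `ℕ` is computably reducible. -/
def IsUniversalCeer {α : Type} [Primcodable α] (E : α → α → Prop) : Prop :=
  IsCeer E ∧ ∀ R : ℕ → ℕ → Prop, IsCeer R → Reduces R E

/-! ### Words and word problems -/

/-- Words over an alphabet `X`: finite sequences of letters `x` (tagged `true`) and `x⁻¹`
(tagged `false`). -/
abbrev Word (X : Type) : Type := List (X × Bool)

/-- The word problem of a group `G` with respect to a family `φ` of elements of `G`:
two words are related iff they represent the same element of `G`. -/
def WordProblem {X : Type} {G : Type} [Group G] (φ : X → G) (u v : Word X) : Prop :=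
  FreeGroup.lift φ (FreeGroup.mk u) = FreeGroup.lift φ (FreeGroup.mk v)

/-! ### Recursive presentations -/

/-- The generating sets: `none` stands for countably many generators `x₀, x₁, …`, and `some k`
for the `k` generators `x₀, …, x_{k-1}`. -/
def Gen : Option ℕ → Type
  | none => ℕ
  | some k => Fin k

instance instPrimcodableGen : (g : Option ℕ) → Primcodable (Gen g)
  | none => (inferInstance : Primcodable ℕ)
  | some k => (inferInstance : Primcodable (Fin k))

/-- (Indices of) recursive presentations: the number of generators (`none` for infinitely many),
together with a program whose domain is the set of (codes of) relators. -/
abbrev RecPres : Type := Option ℕ × Nat.Partrec.Code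

/-- The type of generators of a recursive presentation. -/
abbrev RecPres.X (P : RecPres) : Type := Gen P.1

/-- The computably enumerable set of relators: the words on whose code the program halts. -/
def RecPres.relators (P : RecPres) : Set (Word (RecPres.X P)) :=
  {r | (P.2.eval (Encodable.encode r)).Dom}

/-- The group `⟨X | relators⟩`. -/
abbrev RecPres.group (P : RecPres) : Type :=
  PresentedGroup (FreeGroup.mk '' RecPres.relators P)

/-- The generators, as elements of the presented group. -/
def RecPres.gen (P : RecPres) : RecPres.X P → RecPres.group P := fun x => PresentedGroup.of x

/-- The generators of `G * H`: the disjoint union of the generators of `G` and of `H`. -/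
def RecPres.coprodGen (P Q : RecPres) :
    RecPres.X P ⊕ RecPres.X Q → Monoid.Coprod (RecPres.group P) (RecPres.group Q) :=
  Sum.elim (fun x => Monoid.Coprod.inl (RecPres.gen P x))
    (fun y => Monoid.Coprod.inr (RecPres.gen Q y))

/-- `P` presents a `*`-universal group `G`: the word problem of `G` is not a universal ceer, but
the word problem of `G * H` is one for every nontrivial recursively presented group `H`. -/
def IsStarUniversal (P : RecPres) : Prop :=
  ¬ IsUniversalCeer (WordProblem (RecPres.gen P)) ∧
    ∀ Q : RecPres, Nontrivial (RecPres.group Q) →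
      IsUniversalCeer (WordProblem (RecPres.coprodGen P Q))

/-! ### The class `d-Σ⁰₃` -/

/-- `p` is `Σ⁰₃`: `p a ↔ ∃ x, ∀ y, ∃ z, R (a, x, y, z)` for a computable predicate `R`. -/
def IsSigma03 {α : Type} [Primcodable α] (p : α → Prop) : Prop :=
  ∃ R : α × ℕ × ℕ × ℕ → Prop, ComputablePred R ∧ ∀ a, p a ↔ ∃ x, ∀ y, ∃ z, R (a, x, y, z)

/-- `p` is `d-Σ⁰₃`: a difference of two `Σ⁰₃` predicates. -/
def IsDSigma03 {α : Type} [Primcodable α] (p : α → Prop) : Prop :=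
  ∃ s t : α → Prop, IsSigma03 s ∧ IsSigma03 t ∧ ∀ a, p a ↔ s a ∧ ¬ t a

/-- `p` is `d-Σ⁰₃`-complete: it is `d-Σ⁰₃` and every `d-Σ⁰₃` set of natural numbers is many-one
reducible to it. -/
def IsDSigma03Complete {α : Type} [Primcodable α] (p : α → Prop) : Prop :=
  IsDSigma03 p ∧ ∀ q : ℕ → Prop, IsDSigma03 q → ManyOneReducible q p

end CeerGroups

/-! ### Automation for primitive recursive and computable functions -/

attribute [fun_prop] Primrec Computable
attribute [fun_prop] Primrec.id Primrec.const Primrec.comp Primrec.pair Primrec.succ Primrec.pred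
  Primrec.unpair Primrec.encode Primrec.not Primrec.sumInl Primrec.sumInr Primrec.option_some
  Primrec.option_isSome Primrec.list_range Primrec.list_length Primrec.list_head?
  Primrec.list_tail Primrec.list_reverse Primrec.list_flatten
attribute [fun_prop] Computable.id Computable.const Computable.comp Computable.pair

attribute [local irreducible] Primrec Computable

namespace CeerGroups

open Encodable Denumerable Filter Monoid
open Nat.Partrec (Code)
open Nat.Partrec.Code (evaln eval evaln_mono evaln_complete)
open scoped commutatorElement

section Automation

variable {α β γ σ : Type} [Primcodable α] [Primcodable β] [Primcodable γ] [Primcodable σ]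

/-! Upper bound. If `h` is a nontrivial element of `H`, then `G` and `h G h⁻¹` generate a copy of `G
* G` inside `G * H` (`conjHom_injective`). Hence `G` is `*`-universal exactly when the word problem
of `G * G` is universal and that of `G` is not (`isStarUniversal_iff`). Word problems are uniformly
c.e., and reducibility of one fixed universal ceer to such a relation says that some program
satisfies a Π⁰₂ condition (`isSigma03_reduces`). This is a difference of two Σ⁰₃ conditions.

Hardness. The universal ceer `RInf` is "same root" in a c.e. forest on `ℕ` whose edges go down; `i`
converges to `j` when it receives an edge to `j`. The groups built are elementary abelian 2-groups
whose basis consists of the nonempty roots of a c.e. forest. It splits into rows `(k, c)`, each cut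
off at the first failure of the Π⁰₂ condition that makes `k` a witness for the first set (colours `c
< 2`) or for the second set (`c ≥ 2`). A row is full iff `k` is a witness. A full row of colour at
least 2 carries `RInf`, so it makes the word problem universal (`reduces_val`). Cut-off rows have
computable coordinates and are harmless.

It remains to find two forests, colours `0` and `1`, such that neither makes the group universal but
both together make its free square universal. Their nodes are finite lists. When `i` converges to
`j`, the list `i :: j :: l` is merged with `j :: l` in both colours, while every other list `i :: l`
is killed in one colour and kept in the other. In the free square take the commutator of the colour
`0` generator of a list in the left factor with the colour `1` generator in the right factor: it
dies as soon as one of the two dies. The product of these commutators over the lists `i :: l` with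
`l` strictly decreasing below `i` therefore becomes the product for `j` when `i` converges to `j`,
and different roots give different products (`commProd_par`, `commProd_ne`). So `RInf` reduces to
the free square (`reduces_square`).

Within the abelian group itself a nontrivial element is detected by a single coordinate, which sees
only one colour. A functional that identifies `i :: l` with `l` ahead of time survives every future
merging of `i`; only kills can spoil it. A finite injury construction lets each requirement protect
its colour on an interval of numbers. It builds a disjoint c.e. pair `Diag` such that no computable
sequence of words equals one of two distinct elements according to the half of the pair
(`not_separated`). Thus the ceer `DiagCeer` made from this pair does not reduce to the word problem
unless a row of colour at least 2 is full (`not_reduces_val`).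

If no row at all is full, then even in the free square a nontrivial element is detected by a
computable permutation action on `ℕ` (`exists_action`). A reduction of `DiagCeer` would then
separate the pair, which is recursively inseparable (`not_reduces_square`). -/

@[fun_prop]
theorem primrec_fst {f : α → β × γ} (hf : Primrec f) : Primrec fun a => (f a).1 :=
  Primrec.fst.comp hf

@[fun_prop]
theorem primrec_snd {f : α → β × γ} (hf : Primrec f) : Primrec fun a => (f a).2 :=
  Primrec.snd.comp hf

@[fun_prop]
theorem primrec_natPair {f g : α → ℕ} (hf : Primrec f) (hg : Primrec g) :
    Primrec fun a => Nat.pair (f a) (g a) :=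
  Primrec₂.natPair.comp hf hg

@[fun_prop]
theorem primrec_add {f g : α → ℕ} (hf : Primrec f) (hg : Primrec g) :
    Primrec fun a => f a + g a :=
  Primrec.nat_add.comp hf hg

@[fun_prop]
theorem primrec_sub {f g : α → ℕ} (hf : Primrec f) (hg : Primrec g) :
    Primrec fun a => f a - g a :=
  Primrec.nat_sub.comp hf hg

@[fun_prop]
theorem primrec_mod {f g : α → ℕ} (hf : Primrec f) (hg : Primrec g) :
    Primrec fun a => f a % g a :=
  Primrec.nat_mod.comp hf hg

@[fun_prop]
theorem primrec_div {f g : α → ℕ} (hf : Primrec f) (hg : Primrec g) :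
    Primrec fun a => f a / g a :=
  Primrec.nat_div.comp hf hg

@[fun_prop]
theorem primrec_decide_eq {f g : α → β} [∀ a, Decidable (f a = g a)]
    (hf : Primrec f) (hg : Primrec g) : Primrec fun a => decide (f a = g a) := by
  classical
  exact (Primrec.eq.decide.comp hf hg).of_eq fun a => by congr

@[fun_prop]
theorem primrec_decide_le {f g : α → ℕ} [∀ a, Decidable (f a ≤ g a)]
    (hf : Primrec f) (hg : Primrec g) : Primrec fun a => decide (f a ≤ g a) := by
  classical
  exact (Primrec.nat_le.decide.comp hf hg).of_eq fun a => by congr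

@[fun_prop]
theorem primrec_decide_lt {f g : α → ℕ} [∀ a, Decidable (f a < g a)]
    (hf : Primrec f) (hg : Primrec g) : Primrec fun a => decide (f a < g a) := by
  classical
  exact (Primrec.nat_lt.decide.comp hf hg).of_eq fun a => by congr

@[fun_prop]
theorem primrec_and {f g : α → Bool} (hf : Primrec f) (hg : Primrec g) :
    Primrec fun a => (f a && g a) :=
  Primrec.and.comp hf hg

@[fun_prop]
theorem primrec_or {f g : α → Bool} (hf : Primrec f) (hg : Primrec g) :
    Primrec fun a => (f a || g a) :=
  Primrec.or.comp hf hg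

@[fun_prop]
theorem primrec_cond {c : α → Bool} {f g : α → β} (hc : Primrec c) (hf : Primrec f)
    (hg : Primrec g) : Primrec fun a => bif c a then f a else g a :=
  Primrec.cond hc hf hg

@[fun_prop]
theorem primrec_ite {c : α → Prop} [DecidablePred c] {f g : α → β}
    (hc : Primrec fun a => decide (c a)) (hf : Primrec f) (hg : Primrec g) :
    Primrec fun a => if c a then f a else g a :=
  Primrec.ite (Primrec.primrecPred hc) hf hg

@[fun_prop]
theorem primrec_cons {f : α → β} {g : α → List β} (hf : Primrec f) (hg : Primrec g) :
    Primrec fun a => f a :: g a :=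
  Primrec.list_cons.comp hf hg

@[fun_prop]
theorem primrec_append {f g : α → List β} (hf : Primrec f) (hg : Primrec g) :
    Primrec fun a => f a ++ g a :=
  Primrec.list_append.comp hf hg

@[fun_prop]
theorem primrec_map {f : α → List β} {g : α → β → γ} (hf : Primrec f)
    (hg : Primrec fun p : α × β => g p.1 p.2) : Primrec fun a => (f a).map (g a) :=
  Primrec.list_map hf hg

@[fun_prop]
theorem primrec_flatMap {f : α → List β} {g : α → β → List γ} (hf : Primrec f)
    (hg : Primrec fun p : α × β => g p.1 p.2) : Primrec fun a => (f a).flatMap (g a) :=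
  Primrec.list_flatMap hf hg

@[fun_prop]
theorem primrec_filterMap {f : α → List β} {g : α → β → Option γ} (hf : Primrec f)
    (hg : Primrec fun p : α × β => g p.1 p.2) : Primrec fun a => (f a).filterMap (g a) :=
  Primrec.listFilterMap hf hg

@[fun_prop]
theorem primrec_foldr {f : α → List β} {g : α → σ} {h : α → β → σ → σ} (hf : Primrec f)
    (hg : Primrec g) (hh : Primrec fun p : α × β × σ => h p.1 p.2.1 p.2.2) :
    Primrec fun a => (f a).foldr (h a) (g a) :=
  Primrec.list_foldr (h := fun a p => h a p.1 p.2) hf hg hh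

@[fun_prop]
theorem primrec_sum {f : α → List ℕ} (hf : Primrec f) : Primrec fun a => (f a).sum := by
  have : Primrec fun a => (f a).foldr (fun x y => x + y) 0 := by fun_prop
  exact this

@[fun_prop]
theorem primrec_all {f : α → List β} {g : α → β → Bool} (hf : Primrec f)
    (hg : Primrec fun p : α × β => g p.1 p.2) : Primrec fun a => (f a).all (g a) := by
  have : Primrec fun a => (f a).foldr (fun x y => g a x && y) true := by fun_prop
  exact this.of_eq fun a => by induction f a <;> simp_all

@[fun_prop]
theorem primrec_filter {f : α → List β} {g : α → β → Bool} (hf : Primrec f)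
    (hg : Primrec fun p : α × β => g p.1 p.2) : Primrec fun a => (f a).filter (g a) := by
  have : Primrec fun a => (f a).foldr (fun x y => bif g a x then x :: y else y) [] := by fun_prop
  refine this.of_eq fun a => ?_
  induction f a with
  | nil => rfl
  | cons x l ih => cases h : g a x <;> simp [h, ih]

@[fun_prop]
theorem primrec_countP {f : α → List β} {g : α → β → Bool} (hf : Primrec f)
    (hg : Primrec fun p : α × β => g p.1 p.2) : Primrec fun a => (f a).countP (g a) := by
  have : Primrec fun a => ((f a).filter (g a)).length := by fun_prop
  exact this.of_eq fun a => List.countP_eq_length_filter.symm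

@[fun_prop]
theorem primrec_bind {f : α → Option β} {g : α → β → Option γ} (hf : Primrec f)
    (hg : Primrec fun p : α × β => g p.1 p.2) : Primrec fun a => (f a).bind (g a) :=
  Primrec.option_bind hf hg

@[fun_prop]
theorem primrec_option_map {f : α → Option β} {g : α → β → γ} (hf : Primrec f)
    (hg : Primrec fun p : α × β => g p.1 p.2) : Primrec fun a => (f a).map (g a) :=
  Primrec.option_map hf hg

@[fun_prop]
theorem primrec_elim {f : α → Option β} {g : α → γ} {h : α → β → γ} (hf : Primrec f)
    (hg : Primrec g) (hh : Primrec fun p : α × β => h p.1 p.2) :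
    Primrec fun a => (f a).elim (g a) (h a) :=
  (Primrec.option_casesOn hf hg hh).of_eq fun a => by cases f a <;> rfl

@[fun_prop]
theorem primrec_getD {f : α → Option β} {g : α → β} (hf : Primrec f) (hg : Primrec g) :
    Primrec fun a => (f a).getD (g a) :=
  Primrec.option_getD.comp hf hg

@[fun_prop]
theorem primrec_sum_elim {f : α → β ⊕ γ} {g : α → β → σ} {h : α → γ → σ} (hf : Primrec f)
    (hg : Primrec fun p : α × β => g p.1 p.2) (hh : Primrec fun p : α × γ => h p.1 p.2) :
    Primrec fun a => Sum.elim (g a) (h a) (f a) :=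
  (Primrec.sumCasesOn hf hg hh).of_eq fun a => by cases f a <;> rfl

@[fun_prop]
theorem primrec_decode {f : α → ℕ} (hf : Primrec f) : Primrec fun a => (decode (f a) : Option β) :=
  Primrec.decode.comp hf

@[fun_prop]
theorem primrec_ofNat {β : Type} [Denumerable β] {f : α → ℕ} (hf : Primrec f) :
    Primrec fun a => ofNat β (f a) :=
  (Primrec.ofNat β).comp hf

@[fun_prop]
theorem primrec_evaln {f : α → ℕ} {g : α → Nat.Partrec.Code} {h : α → ℕ} (hf : Primrec f)
    (hg : Primrec g) (hh : Primrec h) : Primrec fun a => Nat.Partrec.Code.evaln (f a) (g a) (h a) :=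
  Nat.Partrec.Code.primrec_evaln.comp (hf.pair hg |>.pair hh)

@[fun_prop]
theorem primrec_nat_rec {f : α → ℕ} {g : α → σ} {h : α → ℕ → σ → σ} (hf : Primrec f)
    (hg : Primrec g) (hh : Primrec fun p : α × ℕ × σ => h p.1 p.2.1 p.2.2) :
    Primrec fun a => (Nat.rec (g a) (h a) (f a) : σ) :=
  Primrec.nat_rec' (h := fun a p => h a p.1 p.2) hf hg hh

@[fun_prop]
theorem computable_append {f g : α → List β} (hf : Computable f) (hg : Computable g) :
    Computable fun a => f a ++ g a :=
  Computable.list_append.comp hf hg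

end Automation

/-! ### Computably enumerable predicates -/

section RE

variable {α β γ : Type} [Primcodable α] [Primcodable β] [Primcodable γ]

/-- A computably enumerable predicate is the increasing union of primitive recursive stages. -/
theorem exists_stage {p : α → Prop} (hp : REPred p) :
    ∃ T : α → ℕ → Bool, (Primrec fun x : α × ℕ => T x.1 x.2) ∧
      (∀ a s t, s ≤ t → T a s = true → T a t = true) ∧ ∀ a, p a ↔ ∃ t, T a t = true := by
  obtain ⟨c, hc⟩ := Nat.Partrec.Code.exists_code.1 hp
  refine ⟨fun a t => (Nat.Partrec.Code.evaln t c (encode a)).isSome, by fun_prop, ?_, ?_⟩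
  · intro a s t hst h
    obtain ⟨x, hx⟩ := Option.isSome_iff_exists.1 h
    exact Option.isSome_iff_exists.2 ⟨x, Nat.Partrec.Code.evaln_mono hst hx⟩
  · intro a
    have h1 : p a ↔ (Nat.Partrec.Code.eval c (encode a)).Dom := by
      rw [hc]
      simp [Part.assert]
    rw [h1, Part.dom_iff_mem]
    constructor
    · rintro ⟨y, hy⟩
      obtain ⟨k, hk⟩ := Nat.Partrec.Code.evaln_complete.1 hy
      exact ⟨k, Option.isSome_iff_exists.2 ⟨y, hk⟩⟩
    · rintro ⟨k, hk⟩
      obtain ⟨y, hy⟩ := Option.isSome_iff_exists.1 hk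
      exact ⟨y, Nat.Partrec.Code.evaln_complete.2 ⟨k, hy⟩⟩

theorem re_of_stage {T : α → ℕ → Bool} (hT : Computable fun x : α × ℕ => T x.1 x.2) :
    REPred fun a => ∃ t, T a t = true := by
  have h : Partrec fun a => Nat.rfindOpt fun t => bif T a t then some () else none :=
    Partrec.rfindOpt (Computable.cond hT (Computable.const _) (Computable.const _))
  refine h.dom_re.of_eq fun a => ?_
  rw [Nat.rfindOpt_dom]
  refine exists_congr fun t => ?_
  cases T a t <;> simp

theorem re_of_bool {T : α → Bool} (hT : Computable T) : REPred fun a => T a = true :=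
  (re_of_stage (T := fun a _ => T a) (hT.comp Computable.fst)).of_eq fun _ => by simp

theorem re_comp {p : β → Prop} (hp : REPred p) {f : α → β} (hf : Computable f) :
    REPred fun a => p (f a) :=
  Partrec.comp hp hf

theorem re_and {p q : α → Prop} (hp : REPred p) (hq : REPred q) :
    REPred fun a => p a ∧ q a := by
  obtain ⟨T, hT, mT, iT⟩ := exists_stage hp
  obtain ⟨S, hS, mS, iS⟩ := exists_stage hq
  refine (re_of_stage (T := fun a t => T a t && S a t) (Primrec.to_comp (by fun_prop))).of_eq
    fun a => ?_
  rw [iT, iS]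
  constructor
  · rintro ⟨t, ht⟩
    simp only [Bool.and_eq_true] at ht
    exact ⟨⟨t, ht.1⟩, ⟨t, ht.2⟩⟩
  · rintro ⟨⟨t, ht⟩, ⟨s, hs⟩⟩
    exact ⟨max t s, by simp [mT a _ _ (le_max_left t s) ht, mS a _ _ (le_max_right t s) hs]⟩

theorem re_or {p q : α → Prop} (hp : REPred p) (hq : REPred q) :
    REPred fun a => p a ∨ q a := by
  obtain ⟨T, hT, mT, iT⟩ := exists_stage hp
  obtain ⟨S, hS, mS, iS⟩ := exists_stage hq
  refine (re_of_stage (T := fun a t => T a t || S a t) (Primrec.to_comp (by fun_prop))).of_eq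
    fun a => ?_
  rw [iT, iS, ← exists_or]
  simp

theorem re_exists {p : α × β → Prop} (hp : REPred p) : REPred fun a => ∃ b, p (a, b) := by
  obtain ⟨T, hT, mT, iT⟩ := exists_stage hp
  -- The search parameter codes a candidate witness together with a stage; numbers that code no
  -- element of `β` answer `false`.
  have hT' : Primrec fun x : α × ℕ => (decode (α := β) x.2.unpair.1).elim false
      fun b => T (x.1, b) x.2.unpair.2 := by
    have : Primrec fun y : (α × ℕ) × β => T (y.1.1, y.2) y.1.2.unpair.2 :=
      hT.comp (f := fun x : (α × β) × ℕ => T x.1 x.2)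
        (g := fun y : (α × ℕ) × β => ((y.1.1, y.2), y.1.2.unpair.2)) (by fun_prop)
    fun_prop
  refine (re_of_stage (T := fun a t => (decode (α := β) t.unpair.1).elim false
      fun b => T (a, b) t.unpair.2) hT'.to_comp).of_eq fun a => ?_
  constructor
  · rintro ⟨t, ht⟩
    cases h : decode (α := β) t.unpair.1 with
    | none => simp [h] at ht
    | some b => exact ⟨b, (iT _).2 ⟨_, by simpa [h] using ht⟩⟩
  · rintro ⟨b, hb⟩
    obtain ⟨t, ht⟩ := (iT _).1 hb
    exact ⟨Nat.pair (encode b) t, by simpa using ht⟩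

/-- Stages are monotone, so finitely many facts are confirmed at a common stage. -/
theorem re_forall_mem {p : α × β → Prop} (hp : REPred p) :
    REPred fun x : α × List β => ∀ b ∈ x.2, p (x.1, b) := by
  obtain ⟨T, hT, mT, iT⟩ := exists_stage hp
  have hT' : Primrec fun x : (α × List β) × ℕ => x.1.2.all fun b => T (x.1.1, b) x.2 := by
    have : Primrec fun y : ((α × List β) × ℕ) × β => T (y.1.1.1, y.2) y.1.2 :=
      hT.comp (f := fun x : (α × β) × ℕ => T x.1 x.2)
        (g := fun y : ((α × List β) × ℕ) × β => ((y.1.1.1, y.2), y.1.2)) (by fun_prop)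
    fun_prop
  refine (re_of_stage (T := fun x t => x.2.all fun b => T (x.1, b) t) hT'.to_comp).of_eq
    fun ⟨a, L⟩ => ?_
  simp only [List.all_eq_true, iT]
  induction L with
  | nil => simp
  | cons b L ih =>
    simp only [List.forall_mem_cons, ← ih]
    constructor
    · rintro ⟨t, h1, h2⟩
      exact ⟨⟨t, h1⟩, t, h2⟩
    · rintro ⟨⟨t, h1⟩, s, h2⟩
      exact ⟨max t s, mT _ _ _ (le_max_left _ _) h1,
        fun b hb => mT _ _ _ (le_max_right _ _) (h2 b hb)⟩

theorem re_forall_le {p : α × ℕ → Prop} (hp : REPred p) :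
    REPred fun x : α × ℕ => ∀ y ≤ x.2, p (x.1, y) := by
  have h := re_comp (re_forall_mem hp) (f := fun x : α × ℕ => (x.1, List.range (x.2 + 1)))
    (Primrec.to_comp (by fun_prop))
  exact h.of_eq fun x => by simp

end RE

/-- Codes for a uniformly computably enumerable family of sets. -/
theorem exists_code_family {α β : Type} [Primcodable α] [Primcodable β] {p : α × β → Prop}
    (hp : REPred p) : ∃ c : α → Nat.Partrec.Code, Computable c ∧
      ∀ a b, ((c a).eval (encode b)).Dom ↔ p (a, b) := by
  have hp' : REPred fun n : ℕ => ∃ x : α × β, encode x = n ∧ p x :=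
    re_exists (α := ℕ) (β := α × β) (p := fun y => encode y.2 = y.1 ∧ p y.2)
      (re_and ((re_of_bool (T := fun y : ℕ × α × β => decide (encode y.2 = y.1))
        (Primrec.to_comp (by fun_prop))).of_eq fun _ => by simp) (re_comp hp Computable.snd))
  obtain ⟨T, hT, -, iT⟩ := exists_stage hp'
  have h : Partrec fun n => Nat.rfindOpt fun t => bif T n t then some 0 else none :=
    Partrec.rfindOpt (Computable.cond hT.to_comp (Computable.const _) (Computable.const _))
  obtain ⟨c, hc⟩ := Nat.Partrec.Code.exists_code.1 (Partrec.nat_iff.1 h)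
  -- The s-m-n theorem: the code of `(a, b)` is the pair of the two codes, so `curry` hard-wires the
  -- parameter computably.
  refine ⟨fun a => Nat.Partrec.Code.curry c (encode a),
    Nat.Partrec.Code.primrec₂_curry.to_comp.comp (Computable.const c) Computable.encode, ?_⟩
  intro a b
  rw [Nat.Partrec.Code.eval_curry, hc, Nat.rfindOpt_dom]
  have : Nat.pair (encode a) (encode b) = encode (a, b) := rfl
  rw [this]
  have h2 : p (a, b) ↔ ∃ x : α × β, encode x = encode (a, b) ∧ p x := by
    simp [Encodable.encode_inj]
  rw [h2, iT]
  refine exists_congr fun t => ?_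
  cases T (encode (a, b)) t <;> simp

section

variable {α σ : Type} [Primcodable α] [Primcodable σ]

@[fun_prop]
theorem primrec_iterate {f : α → ℕ} {g : α → σ} {h : α → σ → σ} (hf : Primrec f)
    (hg : Primrec g) (hh : Primrec fun p : α × σ => h p.1 p.2) :
    Primrec fun a => (h a)^[f a] (g a) :=
  Primrec.nat_iterate hf hg hh

end

/-! ### Forests -/

/-- A forest: a partial successor function that lowers the rank. -/
structure Forest (ι : Type) where
  nxt : ι → Option ι
  rank : ι → ℕ
  rank_lt : ∀ {x y}, nxt x = some y → rank y < rank x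

namespace Forest

variable {ι : Type} (F : Forest ι)

/-- One step towards the root. -/
def step (x : ι) : ι := (F.nxt x).getD x

/-- The end of the successor chain. -/
def root (x : ι) : ι := F.step^[F.rank x] x

variable {F}

theorem step_of_none {x : ι} (h : F.nxt x = none) : F.step x = x := by simp [step, h]

theorem step_of_some {x y : ι} (h : F.nxt x = some y) : F.step x = y := by simp [step, h]

theorem iterate_of_none {x : ι} (h : F.nxt x = none) (n : ℕ) : F.step^[n] x = x :=
  Function.iterate_fixed (step_of_none h) n

theorem nxt_iterate (n : ℕ) : ∀ x, F.rank x ≤ n → F.nxt (F.step^[n] x) = none := by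
  induction n with
  | zero =>
    intro x hx
    cases h : F.nxt x with
    | none => exact h
    | some y => have := F.rank_lt h; omega
  | succ n ih =>
    intro x hx
    cases h : F.nxt x with
    | none => rw [iterate_of_none h]; exact h
    | some y =>
      rw [Function.iterate_succ_apply, step_of_some h]
      exact ih y (by have := F.rank_lt h; omega)

theorem iterate_eq_root {n : ℕ} {x : ι} (h : F.rank x ≤ n) : F.step^[n] x = F.root x := by
  obtain ⟨k, rfl⟩ := Nat.exists_eq_add_of_le h
  rw [Nat.add_comm, Function.iterate_add_apply, root, iterate_of_none (nxt_iterate _ _ le_rfl)]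

theorem nxt_root (x : ι) : F.nxt (F.root x) = none := nxt_iterate _ _ le_rfl

theorem root_of_none {x : ι} (h : F.nxt x = none) : F.root x = x := iterate_of_none h _

theorem root_of_some {x y : ι} (h : F.nxt x = some y) : F.root x = F.root y := by
  rw [← iterate_eq_root (Nat.le_succ (F.rank x)), Function.iterate_succ_apply, step_of_some h,
    iterate_eq_root (F.rank_lt h).le]

theorem induction {C : ι → Prop} (h0 : ∀ x, F.nxt x = none → C x)
    (h1 : ∀ x y, F.nxt x = some y → C y → C x) (x : ι) : C x := by
  induction h : F.rank x using Nat.strong_induction_on generalizing x with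
  | _ n ih =>
    cases hx : F.nxt x with
    | none => exact h0 x hx
    | some y => exact h1 x y hx (ih _ (h ▸ F.rank_lt hx) y rfl)

/-- A function that is constant along edges is determined by its values at the roots. -/
theorem apply_root {β : Type*} {f : ι → β} (hf : ∀ x y, F.nxt x = some y → f x = f y) (x : ι) :
    f (F.root x) = f x := by
  induction x using Forest.induction (F := F) with
  | h0 x hx => rw [root_of_none hx]
  | h1 x y hxy ih => rw [root_of_some hxy, ih, hf x y hxy]

end Forest

open Classical in
/-- The value taken by some member of a sequence of options. -/
noncomputable def limit {ι : Type} (f : ℕ → Option ι) : Option ι :=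
  if h : ∃ y s, f s = some y then some h.choose else none

theorem limit_eq_some {ι : Type} {f : ℕ → Option ι}
    (hf : ∀ s t x y, f s = some x → f t = some y → x = y) {y : ι} :
    limit f = some y ↔ ∃ s, f s = some y := by
  unfold limit
  split_ifs with h
  · obtain ⟨s, hs⟩ := h.choose_spec
    constructor
    · intro hj
      rw [Option.some_inj] at hj
      exact ⟨s, hj ▸ hs⟩
    · rintro ⟨t, ht⟩
      rw [hf _ _ _ _ hs ht]
  · exact ⟨fun h' => by simp at h', fun ⟨s, hs⟩ => absurd ⟨y, s, hs⟩ h⟩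

/-! ### A universal ceer -/

/-- Stage `s` of the universal forest: `⟨c, x⟩` points to `⟨c, y⟩` if the program `c` maps `x` to
`y < x` within `s` steps. -/
def parS (s i : ℕ) : Option ℕ :=
  (evaln s (ofNat Code i.unpair.1) i.unpair.2).bind fun y =>
    if y < i.unpair.2 then some (Nat.pair i.unpair.1 y) else none

theorem primrec_parS : Primrec fun p : ℕ × ℕ => parS p.1 p.2 := by
  unfold parS
  fun_prop

@[fun_prop]
theorem primrec_parS_comp {α : Type} [Primcodable α] {f g : α → ℕ} (hf : Primrec f)
    (hg : Primrec g) : Primrec fun a => parS (f a) (g a) :=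
  primrec_parS.comp (hf.pair hg)

theorem parS_eq_some {s i j : ℕ} : parS s i = some j ↔
    ∃ y ∈ evaln s (ofNat Code i.unpair.1) i.unpair.2,
      y < i.unpair.2 ∧ Nat.pair i.unpair.1 y = j := by
  simp [parS, Option.bind_eq_some_iff]

theorem parS_mono {s t i j : ℕ} (h : s ≤ t) (hs : parS s i = some j) : parS t i = some j := by
  rw [parS_eq_some] at hs ⊢
  obtain ⟨y, hy, h2⟩ := hs
  exact ⟨y, evaln_mono h hy, h2⟩

theorem parS_lt {s i j : ℕ} (h : parS s i = some j) : j < i := by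
  obtain ⟨y, -, h1, rfl⟩ := parS_eq_some.1 h
  conv_rhs => rw [← Nat.pair_unpair i]
  exact Nat.pair_lt_pair_right _ h1

theorem parS_unique {s t i j k : ℕ} (hs : parS s i = some j) (ht : parS t i = some k) : j = k := by
  have h1 := parS_mono (le_max_left s t) hs
  have h2 := parS_mono (le_max_right s t) ht
  exact Option.some_injective _ (h1.symm.trans h2)

/-- The universal forest. -/
noncomputable def par (i : ℕ) : Option ℕ := limit fun s => parS s i

theorem par_eq_some {i j : ℕ} : par i = some j ↔ ∃ s, parS s i = some j :=
  limit_eq_some fun _ _ _ _ => parS_unique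

theorem parS_of_par_none {i : ℕ} (h : par i = none) (s : ℕ) : parS s i = none := by
  cases hs : parS s i with
  | none => rfl
  | some j => rw [par_eq_some.2 ⟨s, hs⟩] at h; cases h

/-- The universal forest on `ℕ`. -/
noncomputable def parForest : Forest ℕ where
  nxt := par
  rank := id
  rank_lt h := by
    obtain ⟨s, hs⟩ := par_eq_some.1 h
    exact parS_lt hs

/-- The stages of the universal forest. -/
def parForestS (s : ℕ) : Forest ℕ where
  nxt := parS s
  rank := id
  rank_lt h := parS_lt h

/-- A universal ceer: having the same root in the universal forest. -/
def RInf (x y : ℕ) : Prop := parForest.root x = parForest.root y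

/-- Edges present at a stage are edges of the limit forest, along which the limit root is constant.
-/
theorem root_rootS (s x : ℕ) : parForest.root ((parForestS s).root x) = parForest.root x :=
  Forest.apply_root (F := parForestS s) (f := parForest.root)
    (fun _ _ h => Forest.root_of_some (F := parForest) (par_eq_some.2 ⟨s, h⟩)) x

/-- The path to the root is finite and each of its edges appears at some stage. -/
theorem eventually_rootS (x : ℕ) : ∃ s₀, ∀ s ≥ s₀, (parForestS s).root x = parForest.root x := by
  induction x using Forest.induction (F := parForest) with
  | h0 x hx =>
    refine ⟨0, fun s _ => ?_⟩
    rw [Forest.root_of_none hx, Forest.root_of_none (F := parForestS s) (parS_of_par_none hx s)]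
  | h1 x y hxy ih =>
    obtain ⟨s₀, h⟩ := ih
    obtain ⟨s₁, h1⟩ := par_eq_some.1 hxy
    refine ⟨max s₀ s₁, fun s hs => ?_⟩
    rw [Forest.root_of_some hxy, Forest.root_of_some (F := parForestS s)
      (parS_mono (le_trans (le_max_right _ _) hs) h1), h s (le_trans (le_max_left _ _) hs)]

theorem re_rInf : REPred fun p : ℕ × ℕ => RInf p.1 p.2 := by
  have hp : Primrec fun x : (ℕ × ℕ) × ℕ =>
      decide ((parForestS x.2).root x.1.1 = (parForestS x.2).root x.1.2) := by
    unfold Forest.root Forest.step parForestS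
    dsimp only [id]
    fun_prop
  refine (re_of_stage (T := fun (x : ℕ × ℕ) s =>
    decide ((parForestS s).root x.1 = (parForestS s).root x.2)) hp.to_comp).of_eq fun ⟨x, y⟩ => ?_
  simp only [decide_eq_true_eq, RInf]
  constructor
  · rintro ⟨s, hs⟩
    rw [← root_rootS s x, hs, root_rootS]
  · intro h
    obtain ⟨s, hs⟩ := eventually_rootS x
    obtain ⟨t, ht⟩ := eventually_rootS y
    exact ⟨max s t, by rw [hs _ (le_max_left _ _), ht _ (le_max_right _ _), h]⟩

theorem isCeer_rInf : IsCeer RInf :=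
  ⟨⟨fun _ => rfl, fun h => h.symm, fun h h' => h.trans h'⟩, re_rInf⟩

/-- Let the program `c` search, on input `x`, for some `j < x` equivalent to `x`. In the copy of `ℕ`
belonging to `c`, every chain of edges then descends inside one class and can stop only at its least
element, so classes correspond to roots. -/
theorem reduces_rInf {R : ℕ → ℕ → Prop} (hR : IsCeer R) : Reduces R RInf := by
  obtain ⟨eR, hre⟩ := hR
  obtain ⟨T, hT, -, iT⟩ := exists_stage hre
  let g : ℕ → ℕ → Option ℕ := fun x n =>
    bif decide (n.unpair.1 < x) && T (x, n.unpair.1) n.unpair.2 then some n.unpair.1 else none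
  have hT' : Primrec fun y : ℕ × ℕ => T (y.1, y.2.unpair.1) y.2.unpair.2 :=
    hT.comp (f := fun x : (ℕ × ℕ) × ℕ => T x.1 x.2)
      (g := fun y : ℕ × ℕ => ((y.1, y.2.unpair.1), y.2.unpair.2)) (by fun_prop)
  have hg : Primrec fun y : ℕ × ℕ => g y.1 y.2 := by
    simp only [g]
    fun_prop
  have hf : Partrec fun x => Nat.rfindOpt (g x) := Partrec.rfindOpt hg.to_comp
  obtain ⟨c, hc⟩ := Nat.Partrec.Code.exists_code.1 (Partrec.nat_iff.1 hf)
  have gspec : ∀ x n j, g x n = some j → j < x ∧ R x j := by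
    intro x n j h
    simp only [g] at h
    cases hb : (decide (n.unpair.1 < x) && T (x, n.unpair.1) n.unpair.2) with
    | false => rw [hb] at h; cases h
    | true =>
      rw [hb] at h
      simp only [Bool.and_eq_true, decide_eq_true_eq] at hb
      obtain rfl : n.unpair.1 = j := Option.some_injective _ h
      exact ⟨hb.1, (iT (x, n.unpair.1)).2 ⟨_, hb.2⟩⟩
  have gdom : ∀ x j, j < x → R x j → (eval c x).Dom := by
    intro x j hj h
    obtain ⟨t, ht⟩ := (iT (x, j)).1 h
    rw [hc, Nat.rfindOpt_dom]
    exact ⟨Nat.pair j t, j, by simp [g, hj, ht]⟩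
  let e : ℕ → ℕ := fun x => Nat.pair (encode c) x
  have pnone : ∀ x, par (e x) = none → ∀ j < x, ¬ R x j := by
    intro x hx j hj h
    have hd := gdom x j hj h
    obtain ⟨y, hy⟩ := Part.dom_iff_mem.1 hd
    have hy' : y ∈ Nat.rfindOpt (g x) := by simpa [hc] using hy
    obtain ⟨n, hn⟩ := Nat.rfindOpt_spec hy'
    obtain ⟨k, hk⟩ := evaln_complete.1 hy
    have := parS_of_par_none hx k
    rw [Option.eq_none_iff_forall_ne_some] at this
    refine this (Nat.pair (encode c) y) (parS_eq_some.2 ⟨y, ?_, ?_, ?_⟩)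
    · simpa [e] using hk
    · simpa [e] using (gspec x n y hn).1
    · simp [e]
  have psome : ∀ x i, par (e x) = some i → ∃ j, i = e j ∧ R x j := by
    intro x i hi
    obtain ⟨s, hs⟩ := par_eq_some.1 hi
    obtain ⟨y, hy, hlt, rfl⟩ := parS_eq_some.1 hs
    have hy1 : y ∈ eval c x := evaln_complete.2 ⟨s, by simpa [e] using hy⟩
    have hy' : y ∈ Nat.rfindOpt (g x) := by simpa [hc] using hy1
    obtain ⟨n, hn⟩ := Nat.rfindOpt_spec hy'
    exact ⟨y, by simp [e], (gspec x n y hn).2⟩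
  have key : ∀ i x, i = e x → ∃ r, parForest.root i = e r ∧ R x r ∧ ∀ j < r, ¬ R r j := by
    intro i
    induction i using Forest.induction (F := parForest) with
    | h0 i hi =>
      rintro x rfl
      exact ⟨x, Forest.root_of_none hi, eR.refl x, pnone x hi⟩
    | h1 i k hik ih =>
      rintro x rfl
      obtain ⟨j, hj, hR⟩ := psome x k hik
      obtain ⟨r, h1, h2, h3⟩ := ih j hj
      exact ⟨r, (Forest.root_of_some hik).trans h1, eR.trans hR h2, h3⟩
  refine ⟨e, (Primrec.to_comp (by simp only [e]; fun_prop)), fun x y => ?_⟩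
  obtain ⟨r, h1, h2, h3⟩ := key _ x rfl
  obtain ⟨r', h1', h2', h3'⟩ := key _ y rfl
  rw [RInf, h1, h1']
  constructor
  · intro h
    have hrr : R r r' := eR.trans (eR.symm h2) (eR.trans h h2')
    rcases lt_trichotomy r r' with hlt | heq | hlt
    · exact absurd (eR.symm hrr) (h3' _ hlt)
    · rw [heq]
    · exact absurd hrr (h3 _ hlt)
  · intro h
    have : r = r' := (Nat.pair_eq_pair.1 h).2
    subst this
    exact eR.trans h2 (eR.symm h2')

theorem Reduces.trans {α β γ : Type} [Primcodable α] [Primcodable β] [Primcodable γ]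
    {E : α → α → Prop} {R : β → β → Prop} {S : γ → γ → Prop} (h : Reduces E R)
    (h' : Reduces R S) : Reduces E S := by
  obtain ⟨f, hf, h1⟩ := h
  obtain ⟨g, hg, h2⟩ := h'
  exact ⟨fun a => g (f a), hg.comp hf, fun x y => (h1 x y).trans (h2 _ _)⟩

theorem isUniversalCeer_iff {α : Type} [Primcodable α] {E : α → α → Prop} (hE : IsCeer E) :
    IsUniversalCeer E ↔ Reduces RInf E :=
  ⟨fun h => h.2 _ isCeer_rInf, fun h => ⟨hE, fun _ hR => (reduces_rInf hR).trans h⟩⟩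

/-! ### Counting along initial segments -/

/-- For an initial segment of `ℕ`, counting finds its end. -/
theorem countP_range_antitone {p : ℕ → Bool} (hp : ∀ i j, i ≤ j → p j = true → p i = true)
    (n : ℕ) : (∀ j < (List.range n).countP p, p j = true) ∧
      ((List.range n).countP p < n → p ((List.range n).countP p) = false) := by
  induction n with
  | zero => simp
  | succ n ih =>
    obtain ⟨h1, h2⟩ := ih
    have hle : (List.range n).countP p ≤ n := by
      simpa using List.countP_le_length (p := p) (l := List.range n)
    rw [List.range_succ, List.countP_append, List.countP_singleton]
    cases hn : p n with
    | false =>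
      simp only [Bool.false_eq_true, if_false, Nat.add_zero]
      refine ⟨h1, fun _ => ?_⟩
      rcases hle.lt_or_eq with h | h
      · exact h2 h
      · rw [h, hn]
    | true =>
      have heq : (List.range n).countP p = n := by
        by_contra hne
        have := h2 (lt_of_le_of_ne hle hne)
        rw [hp _ _ hle hn] at this
        cases this
      simp only [if_true, heq]
      exact ⟨fun j hj => hp _ _ (Nat.lt_succ_iff.1 hj) hn, fun h => absurd h (lt_irrefl _)⟩

theorem mem_lt_encode {α : Type} [Encodable α] {a : α} {l : List α} (h : a ∈ l) :
    encode a < encode l := by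
  induction l with
  | nil => cases h
  | cons b l ih =>
    rw [encode_list_cons]
    rcases List.mem_cons.1 h with rfl | h
    · exact Nat.lt_succ_of_le (Nat.left_le_pair _ _)
    · exact Nat.lt_succ_of_le ((ih h).le.trans (Nat.right_le_pair _ _))

/-! ### Products of involutions -/

theorem prod_eq_one_of_even {ι M : Type} [BEq ι] [LawfulBEq ι] [CommMonoid M] {g : ι → M}
    (hg : ∀ y, g y ^ 2 = 1) {L : List ι} (hL : ∀ y, Even (L.count y) ∨ g y = 1) :
    (L.map g).prod = 1 := by
  classical
  rw [Finset.prod_list_map_count]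
  refine Finset.prod_eq_one fun y _ => ?_
  -- The product formula counts with the equality test from `DecidableEq`, the hypothesis with the
  -- given `BEq`.
  have hc : @List.count ι instBEqOfDecidableEq y L = L.count y :=
    List.countP_congr fun x _ => by simp
  rw [hc]
  rcases hL y with ⟨m, hm⟩ | h
  · rw [hm, ← two_mul, pow_mul, hg, one_pow]
  · rw [h, one_pow]

/-- Replace each member by the sign `-1` or `1` according to `h`: the parity of the count is the
product of the signs, and members of even multiplicity contribute `1`. -/
theorem even_countP_of_even {ι : Type} [BEq ι] [LawfulBEq ι] {h : ι → Bool} {L : List ι}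
    (hL : ∀ y, Even (L.count y) ∨ h y = false) : Even (L.countP h) := by
  have h1 : ∀ L : List ι, (L.map fun y => if h y then (-1 : ℤ) else 1).prod
      = (-1) ^ L.countP h := by
    intro L
    induction L with
    | nil => simp
    | cons x L ih => cases hx : h x <;> simp [hx, ih, pow_succ]
  have h2 : (L.map fun y => if h y then (-1 : ℤ) else 1).prod = 1 :=
    prod_eq_one_of_even (fun y => by cases h y <;> simp) fun y =>
      (hL y).imp_right fun hy => by simp [hy]
  rw [h1] at h2
  exact (neg_one_pow_eq_one_iff_even (by norm_num)).1 h2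

/-! ### Requirements and protection -/

/-- The colour protected by the `k`-th requirement. -/
def reqColour (k : ℕ) : Bool := decide (k % 2 = 1)

/-- The program attacked by the `k`-th requirement. -/
def reqCode (k : ℕ) : Code := ofNat Code (k / 2).unpair.1.unpair.1

/-- The root tested by the `k`-th requirement. -/
def reqRoot (k : ℕ) : List ℕ := ofNat (List ℕ) (k / 2).unpair.1.unpair.2

/-- The `k`-th requirement protects its colour on the numbers `i` with
`protect s k ≤ i < protect s (k + 1)`. -/
def protect (s k : ℕ) : ℕ :=
  Nat.rec 0 (fun k J => J + 1 + ((List.range (Nat.pair k (Nat.pair J J) + 1)).map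
    fun z => (evaln s (reqCode k) z).getD 0).sum) k

/-- The colour of the nodes above `i` which is not killed if `i` converges at stage `s`. -/
def keptAt (s i : ℕ) : Bool :=
  reqColour ((List.range i).countP fun k => decide (protect s (k + 1) ≤ i))

/-- The first stage at which `i` converges, if it does so before stage `s`. -/
def firstConv (s i : ℕ) : ℕ := (List.range s).countP fun t => !(parS t i).isSome

/-- The colour of the nodes above `i` which is not killed when `i` converges. -/
@[irreducible] def kept (s i : ℕ) : Bool := keptAt (firstConv s i) i

@[fun_prop]
theorem primrec_reqColour {α : Type} [Primcodable α] {f : α → ℕ} (hf : Primrec f) :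
    Primrec fun a => reqColour (f a) := by
  unfold reqColour
  fun_prop

@[fun_prop]
theorem primrec_reqCode {α : Type} [Primcodable α] {f : α → ℕ} (hf : Primrec f) :
    Primrec fun a => reqCode (f a) := by
  unfold reqCode
  fun_prop

@[fun_prop]
theorem primrec_reqRoot {α : Type} [Primcodable α] {f : α → ℕ} (hf : Primrec f) :
    Primrec fun a => reqRoot (f a) := by
  unfold reqRoot
  fun_prop

theorem primrec_protect_uncurried : Primrec fun p : ℕ × ℕ => protect p.1 p.2 := by
  have h : Primrec fun p : (ℕ × ℕ) × ℕ × ℕ => p.2.2 + 1 +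
      ((List.range (Nat.pair p.2.1 (Nat.pair p.2.2 p.2.2) + 1)).map
        fun z => (evaln p.1.1 (reqCode p.2.1) z).getD 0).sum := by fun_prop
  exact Primrec.nat_rec' (α := ℕ × ℕ) (h := fun p q => q.2 + 1 +
    ((List.range (Nat.pair q.1 (Nat.pair q.2 q.2) + 1)).map
      fun z => (evaln p.1 (reqCode q.1) z).getD 0).sum) Primrec.snd (Primrec.const 0) h

@[fun_prop]
theorem primrec_protect {α : Type} [Primcodable α] {f g : α → ℕ} (hf : Primrec f)
    (hg : Primrec g) : Primrec fun a => protect (f a) (g a) :=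
  primrec_protect_uncurried.comp (hf.pair hg)

theorem primrec_kept_uncurried : Primrec fun p : ℕ × ℕ => kept p.1 p.2 := by
  unfold kept keptAt firstConv
  fun_prop

@[fun_prop]
theorem primrec_kept {α : Type} [Primcodable α] {f g : α → ℕ} (hf : Primrec f)
    (hg : Primrec g) : Primrec fun a => kept (f a) (g a) :=
  primrec_kept_uncurried.comp (hf.pair hg)

theorem pair_mono {a b c d : ℕ} (h : a ≤ c) (h' : b ≤ d) : Nat.pair a b ≤ Nat.pair c d := by
  refine le_trans (b := Nat.pair c b) ?_ ?_
  · rcases h.lt_or_eq with h | h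
    · exact (Nat.pair_lt_pair_left _ h).le
    · rw [h]
  · rcases h'.lt_or_eq with h | h
    · exact (Nat.pair_lt_pair_right _ h).le
    · rw [h]

theorem protect_succ (s k : ℕ) : protect s (k + 1) = protect s k + 1 +
    ∑ z ∈ Finset.range (Nat.pair k (Nat.pair (protect s k) (protect s k)) + 1),
      (evaln s (reqCode k) z).getD 0 := rfl

theorem protect_lt_succ (s k : ℕ) : protect s k < protect s (k + 1) := by
  rw [protect_succ]; omega

theorem protect_strictMono (s : ℕ) : StrictMono (protect s) :=
  strictMono_nat_of_lt_succ (protect_lt_succ s)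

theorem protect_mono {s t : ℕ} (h : s ≤ t) (k : ℕ) : protect s k ≤ protect t k := by
  induction k with
  | zero => exact le_rfl
  | succ k ih =>
    rw [protect_succ, protect_succ]
    refine Nat.add_le_add (Nat.succ_le_succ ih) ?_
    refine (Finset.sum_le_sum (g := fun z => (evaln t (reqCode k) z).getD 0) fun z _ => ?_).trans
      (Finset.sum_le_sum_of_subset (Finset.range_mono (Nat.succ_le_succ ?_)))
    · cases hz : evaln s (reqCode k) z with
      | none => simp
      | some w => rw [Option.mem_def.1 (evaln_mono h hz)]
    · exact pair_mono le_rfl (pair_mono ih ih)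

theorem eventually_evaln (c : Code) (z : ℕ) : ∃ w, ∀ᶠ s in atTop, evaln s c z = w := by
  by_cases h : ∃ w s, evaln s c z = some w
  · obtain ⟨w, s, hs⟩ := h
    exact ⟨some w, eventually_atTop.2 ⟨s, fun t ht => evaln_mono ht hs⟩⟩
  · refine ⟨none, Eventually.of_forall fun s => ?_⟩
    push Not at h
    exact Option.eq_none_iff_forall_ne_some.2 fun w => h w s

/-- Finite injury: once `protect s k` has settled, the next boundary depends on finitely many
computations, each of which settles. -/
theorem eventually_protect (k : ℕ) : ∃ J, ∀ᶠ s in atTop, protect s k = J := by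
  induction k with
  | zero => exact ⟨0, Eventually.of_forall fun _ => rfl⟩
  | succ k ih =>
    obtain ⟨J, hJ⟩ := ih
    choose w hw using eventually_evaln (reqCode k)
    refine ⟨J + 1 + ∑ z ∈ Finset.range (Nat.pair k (Nat.pair J J) + 1), (w z).getD 0, ?_⟩
    have := (Finset.eventually_all (Finset.range (Nat.pair k (Nat.pair J J) + 1))).2
      fun z _ => hw z
    filter_upwards [hJ, this] with s h1 h2
    rw [protect_succ, h1]
    congr 1
    exact Finset.sum_congr rfl fun z hz => by rw [h2 z hz]

/-- The boundaries increase strictly, so those at most `i` form an initial segment whose size is the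
index of the interval containing `i`. Their indices are below `i`, so counting up to `i` misses
none. -/
theorem keptAt_eq {s i k : ℕ} (h1 : protect s k ≤ i) (h2 : i < protect s (k + 1)) :
    keptAt s i = reqColour k := by
  unfold keptAt
  congr 1
  have hm := protect_strictMono s
  obtain ⟨h3, h4⟩ := countP_range_antitone (p := fun k => decide (protect s (k + 1) ≤ i))
    (fun a b hab hb => by
      simp only [decide_eq_true_eq] at hb ⊢
      exact (hm.monotone (Nat.succ_le_succ hab)).trans hb) i
  simp only [decide_eq_true_eq, decide_eq_false_iff_not, not_le] at h3 h4
  set m := (List.range i).countP fun k => decide (protect s (k + 1) ≤ i)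
  have hki : k ≤ i := (hm.id_le k).trans h1
  rcases lt_trichotomy m k with h | h | h
  · have := h4 (h.trans_le hki)
    exact absurd ((hm.monotone h).trans h1) (not_le.2 this)
  · exact h
  · exact absurd (h3 k h) (not_le.2 h2)

theorem firstConv_spec {s i j : ℕ} (h : parS s i = some j) :
    parS (firstConv s i) i = some j ∧ ∀ t < firstConv s i, parS t i = none := by
  obtain ⟨h3, h4⟩ := countP_range_antitone (p := fun t => !(parS t i).isSome)
    (fun a b hab hb => by
      cases ha : parS a i with
      | none => rfl
      | some j => rw [parS_mono hab ha] at hb; exact hb) s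
  change (∀ t < firstConv s i, _) at h3
  change firstConv s i < s → (!(parS (firstConv s i) i).isSome) = false at h4
  have hle : firstConv s i ≤ s :=
    (List.countP_le_length (p := fun t => !(parS t i).isSome) (l := List.range s)).trans_eq
      List.length_range
  refine ⟨?_, fun t ht => by simpa using h3 t ht⟩
  rcases hle.lt_or_eq with h' | h'
  · have := h4 h'
    simp only [Bool.not_eq_false', Option.isSome_iff_exists] at this
    obtain ⟨k, hk⟩ := this
    rw [hk, parS_unique hk h]
  · rw [h', h]

theorem firstConv_eq {s t i j k : ℕ} (hs : parS s i = some j) (ht : parS t i = some k) :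
    firstConv s i = firstConv t i := by
  obtain ⟨a1, a2⟩ := firstConv_spec hs
  obtain ⟨b1, b2⟩ := firstConv_spec ht
  rcases lt_trichotomy (firstConv s i) (firstConv t i) with h | h | h
  · rw [b2 _ h] at a1; cases a1
  · exact h
  · rw [a2 _ h] at b1; cases b1

/-- The kept colour is settled at the first convergence of `i`. Later growth of the intervals cannot
revise it, so the edges of the list forests are permanent. -/
theorem kept_eq {s t i j k : ℕ} (hs : parS s i = some j) (ht : parS t i = some k) :
    kept s i = kept t i := by
  rw [kept, kept, firstConv_eq hs ht]

/-! ### The coloured forests on lists -/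

/-- Stage `s` of the forest of colour `b` on lists. When `i` converges to `j`, the list `i :: j :: l`
points to `j :: l`, and the other lists `i :: l` point to `[]` except in the colour which is kept. -/
def listS (s : ℕ) (b : Bool) : List ℕ → Option (List ℕ)
  | [] => none
  | i :: l => (parS s i).bind fun j =>
      if l.head? = some j then some l else if kept s i = b then none else some []

theorem listS_mono {s t : ℕ} {b : Bool} {l m : List ℕ} (h : s ≤ t) (hs : listS s b l = some m) :
    listS t b l = some m := by
  cases l with
  | nil => exact hs
  | cons i l =>
    cases hi : parS s i with
    | none => simp [listS, hi] at hs
    | some j =>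
      have hj := parS_mono h hi
      rw [listS, hj]
      rw [listS, hi, kept_eq hi hj] at hs
      exact hs

theorem listS_unique {s t : ℕ} {b : Bool} {l m n : List ℕ} (hs : listS s b l = some m)
    (ht : listS t b l = some n) : m = n :=
  Option.some_injective _ ((listS_mono (le_max_left s t) hs).symm.trans
    (listS_mono (le_max_right s t) ht))

/-- The successor function of the forest of colour `b` on lists. -/
noncomputable def listNxt (b : Bool) (l : List ℕ) : Option (List ℕ) := limit fun s => listS s b l

theorem listNxt_eq_some {b : Bool} {l m : List ℕ} :
    listNxt b l = some m ↔ ∃ s, listS s b l = some m :=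
  limit_eq_some fun _ _ _ _ => listS_unique

theorem listS_cases {s : ℕ} {b : Bool} {l m : List ℕ} (h : listS s b l = some m) :
    ∃ i l' j, l = i :: l' ∧ parS s i = some j ∧
      (l'.head? = some j ∧ m = l' ∨ l'.head? ≠ some j ∧ kept s i ≠ b ∧ m = []) := by
  cases l with
  | nil => simp [listS] at h
  | cons i l =>
    cases hi : parS s i with
    | none => simp [listS, hi] at h
    | some j =>
      refine ⟨i, l, j, rfl, hi, ?_⟩
      by_cases h1 : l.head? = some j
      · simp only [listS, hi, Option.bind_some, h1, if_true, Option.some_inj] at h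
        exact .inl ⟨h1, h.symm⟩
      · by_cases h2 : kept s i = b
        · simp [listS, hi, h1, h2] at h
        · simp only [listS, hi, Option.bind_some, h1, h2, if_false, Option.some_inj] at h
          exact .inr ⟨h1, h2, h.symm⟩

theorem listNxt_length {b : Bool} {l m : List ℕ} (h : listNxt b l = some m) :
    m.length < l.length := by
  obtain ⟨s, hs⟩ := listNxt_eq_some.1 h
  obtain ⟨i, l', j, rfl, -, ⟨-, rfl⟩ | ⟨-, -, rfl⟩⟩ := listS_cases hs <;> simp

theorem listNxt_mem {b : Bool} {l m : List ℕ} (h : listNxt b l = some m) {i : ℕ} (hi : i ∈ m) :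
    i ∈ l := by
  obtain ⟨s, hs⟩ := listNxt_eq_some.1 h
  obtain ⟨i, l', j, rfl, -, ⟨-, rfl⟩ | ⟨-, -, rfl⟩⟩ := listS_cases hs
  · exact List.mem_cons_of_mem _ hi
  · cases hi

/-- The forest of colour `b` on lists. -/
noncomputable def listForest (b : Bool) : Forest (List ℕ) where
  nxt := listNxt b
  rank := List.length
  rank_lt := listNxt_length

theorem root_mem {b : Bool} {l : List ℕ} {i : ℕ} (hi : i ∈ (listForest b).root l) : i ∈ l := by
  induction l using Forest.induction (F := listForest b) with
  | h0 x hx => rwa [Forest.root_of_none hx] at hi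
  | h1 x y hxy ih =>
    rw [Forest.root_of_some hxy] at hi
    exact listNxt_mem hxy (ih hi)

/-- `u` is trivial in the elementary abelian 2-group generated by the roots of the forest,
with the empty list as the neutral element. -/
def Null (b : Bool) (u : List (List ℕ)) : Prop :=
  ∀ y ≠ [], Even ((u.map (listForest b).root).count y)

/-! ### The diagonal pair -/

/-- The recursion step of `predict`. -/
@[irreducible] def predictStep (s J : ℕ) (b : Bool) (i : ℕ) (l r : List ℕ) : List ℕ :=
  (parS s i).elim (if i < J then i :: l else r) fun j =>
    if l.head? = some j then r else if kept s i = b then i :: l else []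

/-- The root of `l` as predicted at stage `s`, if the elements below `J` have converged already or
never will, and if colour `b` is protected on the other elements of `l` from stage `s` on. -/
def predict (s J : ℕ) (b : Bool) : List ℕ → List ℕ
  | [] => []
  | i :: l => predictStep s J b i l (predict s J b l)

/-- In the branch where `i` has not converged and `J ≤ i`, the value need not be the true root.
Passing to the tail is right for any later edge from `i :: l` to `l`, whatever `j` turns out to be,
and no other edge out of `i :: l` appears if the colour is kept. -/
theorem predict_cons (s J : ℕ) (b : Bool) (i : ℕ) (l : List ℕ) : predict s J b (i :: l) =
    (parS s i).elim (if i < J then i :: l else predict s J b l) fun j =>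
      if l.head? = some j then predict s J b l else if kept s i = b then i :: l else [] := by
  rw [predict, predictStep]

theorem primrec_predict_uncurried :
    Primrec fun p : (ℕ × ℕ × Bool) × List ℕ => predict p.1.1 p.1.2.1 p.1.2.2 p.2 := by
  have h : Primrec fun p : ((ℕ × ℕ × Bool) × List ℕ) × ℕ × List ℕ × List ℕ =>
      predictStep p.1.1.1 p.1.1.2.1 p.1.1.2.2 p.2.1 p.2.2.1 p.2.2.2 := by
    unfold predictStep
    fun_prop
  refine (Primrec.list_rec (α := (ℕ × ℕ × Bool) × List ℕ) (f := fun a => a.2) (g := fun _ => [])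
    (h := fun a p => predictStep a.1.1 a.1.2.1 a.1.2.2 p.1 p.2.1 p.2.2)
    Primrec.snd (Primrec.const []) h).of_eq fun ⟨⟨s, J, b⟩, l⟩ => ?_
  induction l with
  | nil => rfl
  | cons i l ih =>
    simp only at ih
    simp only [predict, ← ih]

@[fun_prop]
theorem primrec_predict {α : Type} [Primcodable α] {f g : α → ℕ} {b : α → Bool} {l : α → List ℕ}
    (hf : Primrec f) (hg : Primrec g) (hb : Primrec b) (hl : Primrec l) :
    Primrec fun a => predict (f a) (g a) (b a) (l a) :=
  primrec_predict_uncurried.comp ((hf.pair (hg.pair hb)).pair hl)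

/-- The number of elements below `J` that have converged by stage `s`. -/
def convCount (s J : ℕ) : ℕ := (List.range J).countP fun i => (parS s i).isSome

/-- The witness `z = ⟨k, ⟨J, q⟩⟩` of the `k`-th requirement may act at stage `s`. -/
def ready (s z : ℕ) : Bool :=
  decide (z.unpair.2.unpair.1 ≤ protect s z.unpair.1) &&
    (decide (z.unpair.2.unpair.2 ≤ convCount s z.unpair.2.unpair.1) &&
      (evaln s (reqCode z.unpair.1) z).isSome)

/-- The side on which the witness `z` is put at stage `s`. -/
def side (s z : ℕ) : Bool :=
  decide (((ofNat (List (List ℕ)) ((evaln s (reqCode z.unpair.1) z).getD 0)).countP fun l =>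
    decide (predict s z.unpair.2.unpair.1 (reqColour z.unpair.1) l = reqRoot z.unpair.1)) % 2 = 1)

/-- `s` is the first stage at which `z` may act. -/
def acts (s z : ℕ) : Bool := ready s z && (decide (s = 0) || !ready (s - 1) z)

/-- The two halves of the diagonal pair. -/
def Diag (c : Bool) (z : ℕ) : Prop := ∃ s, (acts s z && decide (side s z = c)) = true

theorem re_diag (c : Bool) : REPred (Diag c) := by
  have h1 : Primrec fun p : ℕ × ℕ => ready p.1 p.2 := by
    unfold ready convCount
    fun_prop
  have h2 : Primrec fun p : ℕ × ℕ => side p.1 p.2 := by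
    unfold side
    fun_prop
  have h3 : Primrec fun p : ℕ × ℕ => ready (p.1 - 1) p.2 :=
    h1.comp (g := fun p : ℕ × ℕ => (p.1 - 1, p.2)) (by fun_prop)
  have h4 : Primrec fun p : ℕ × ℕ => (acts p.1 p.2 && decide (side p.1 p.2 = c)) := by
    unfold acts
    fun_prop
  exact re_of_stage (h4.comp (g := fun p : ℕ × ℕ => (p.2, p.1)) (by fun_prop)).to_comp

theorem convCount_mono {s t : ℕ} (h : s ≤ t) (J : ℕ) : convCount s J ≤ convCount t J :=
  List.countP_mono_left fun i _ hi => by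
    obtain ⟨j, hj⟩ := Option.isSome_iff_exists.1 hi
    exact Option.isSome_iff_exists.2 ⟨j, parS_mono h hj⟩

theorem ready_mono {s t z : ℕ} (h : s ≤ t) (hs : ready s z = true) : ready t z = true := by
  simp only [ready, Bool.and_eq_true, decide_eq_true_eq] at hs ⊢
  obtain ⟨h1, h2, h3⟩ := hs
  obtain ⟨w, hw⟩ := Option.isSome_iff_exists.1 h3
  exact ⟨h1.trans (protect_mono h _), h2.trans (convCount_mono h _),
    Option.isSome_iff_exists.2 ⟨w, evaln_mono h hw⟩⟩

theorem acts_unique {s t z : ℕ} (hs : acts s z = true) (ht : acts t z = true) : s = t := by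
  simp only [acts, Bool.and_eq_true, Bool.or_eq_true, decide_eq_true_eq, Bool.not_eq_true'] at hs ht
  have key : ∀ a b, ready a z = true → (b = 0 ∨ ready (b - 1) z = false) → b ≤ a := by
    intro a b ha hb
    by_contra hlt
    rcases hb with rfl | hb
    · omega
    · rw [ready_mono (by omega : a ≤ b - 1) ha] at hb
      cases hb
  exact le_antisymm (key t s ht.1 hs.2) (key s t hs.1 ht.2)

theorem diag_disjoint {z : ℕ} (h1 : Diag true z) (h2 : Diag false z) : False := by
  obtain ⟨s, hs⟩ := h1
  obtain ⟨t, ht⟩ := h2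
  simp only [Bool.and_eq_true, decide_eq_true_eq] at hs ht
  have := acts_unique hs.1 ht.1
  subst this
  exact Bool.noConfusion (hs.2.symm.trans ht.2)

theorem exists_acts {s z : ℕ} (h : ready s z = true) : ∃ t, acts t z = true := by
  classical
  let P : ∃ s, ready s z = true := ⟨s, h⟩
  refine ⟨Nat.find P, ?_⟩
  simp only [acts, Bool.and_eq_true, Bool.or_eq_true, decide_eq_true_eq, Bool.not_eq_true']
  refine ⟨Nat.find_spec P, ?_⟩
  rcases Nat.eq_zero_or_pos (Nat.find P) with h0 | h0
  · exact .inl h0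
  · have := Nat.find_min P (Nat.sub_lt h0 one_pos)
    exact .inr (by simpa using this)

/-- If the guess about convergence below `J` is right and colour `b` is protected on the elements
of `l`, then the prediction is constant along the forest. -/
theorem predict_root {s J b} (N : ℕ) (h1 : ∀ i < J, parS s i = none → par i = none)
    (h2 : ∀ t i j, J ≤ i → i < N → parS s i = none → parS t i = some j → kept t i = b)
    (l : List ℕ) (hl : ∀ i ∈ l, i < N) :
    predict s J b ((listForest b).root l) = predict s J b l := by
  induction l using Forest.induction (F := listForest b) with
  | h0 x hx => rw [Forest.root_of_none hx]
  | h1 x y hxy ih =>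
    rw [Forest.root_of_some hxy, ih fun i hi => hl i (listNxt_mem hxy hi)]
    obtain ⟨t, ht⟩ := listNxt_eq_some.1 hxy
    obtain ⟨i, l', j, rfl, hj, hcase⟩ := listS_cases ht
    cases hs : parS s i with
    | some j' =>
      obtain rfl := parS_unique hs hj
      rcases hcase with ⟨hh, rfl⟩ | ⟨hh, hk, rfl⟩
      · simp [predict_cons, hs, hh]
      · rw [← kept_eq hs hj] at hk
        rw [predict_cons, hs]
        simp [hh, hk, predict]
    | none =>
      have hiJ : ¬ i < J := by
        intro hi
        exact absurd (h1 i hi hs) (by rw [par_eq_some.2 ⟨t, hj⟩]; simp)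
      have hk := h2 t i j (not_lt.1 hiJ) (hl i List.mem_cons_self) hs hj
      rcases hcase with ⟨hh, rfl⟩ | ⟨hh, hk', rfl⟩
      · simp [predict_cons, hs, hiJ]
      · exact absurd hk hk'

/-- A head below `J` excludes the branch that passes to the tail before convergence, and for a root
the two remaining branches that change the list would be edges. -/
theorem predict_of_root {s J b} {l : List ℕ} (h : listNxt b l = none) (hl : ∀ i ∈ l, i < J) :
    predict s J b l = l := by
  cases l with
  | nil => rfl
  | cons i l =>
    cases hs : parS s i with
    | none => simp [predict_cons, hs, hl i List.mem_cons_self]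
    | some j =>
      have hn : listS s b (i :: l) = none := by
        by_contra hne
        obtain ⟨y, hy⟩ := Option.ne_none_iff_exists'.1 hne
        rw [listNxt_eq_some.2 ⟨s, hy⟩] at h
        cases h
      by_cases hh : l.head? = some j
      · simp [listS, hs, hh] at hn
      · by_cases hk : kept s i = b
        · simp [predict_cons, hs, hh, hk]
        · simp [listS, hs, hh, hk] at hn

/-- The set of converged elements below `J` only grows, so once its size is maximal it is complete.
-/
theorem parS_none_of_convCount {s J : ℕ} (h : ∀ t, convCount t J ≤ convCount s J) :
    ∀ i < J, parS s i = none → par i = none := by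
  intro i hi hs
  by_contra hne
  obtain ⟨j, hj⟩ := Option.ne_none_iff_exists'.1 hne
  obtain ⟨t, ht⟩ := par_eq_some.1 hj
  have h1 : (List.range J).filter (fun i => (parS s i).isSome) =
      (List.range J).filter fun i => (parS (max s t) i).isSome := by
    refine List.Sublist.eq_of_length_le (List.monotone_filter_right _ fun i hi => ?_) ?_
    · obtain ⟨j, hj⟩ := Option.isSome_iff_exists.1 hi
      exact Option.isSome_iff_exists.2 ⟨j, parS_mono (le_max_left _ _) hj⟩
    · rw [← List.countP_eq_length_filter, ← List.countP_eq_length_filter]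
      exact h _
  have h2 : i ∈ (List.range J).filter fun i => (parS (max s t) i).isSome := by
    simp [hi, parS_mono (le_max_right s t) ht]
  rw [← h1] at h2
  simp [hs] at h2

/-- No computable function separates the diagonal pair in one of the coloured groups. -/
theorem not_separated {b : Bool} {u : List (List ℕ)} (hu : ¬ Null b u)
    {φ : ℕ → List (List ℕ)} (hφ : Computable φ) (h0 : ∀ z, Diag true z → Null b (φ z))
    (h1 : ∀ z, Diag false z → Null b (φ z ++ u)) : False := by
  classical
  obtain ⟨x, hx, hxu⟩ : ∃ x ≠ [], ¬ Even ((u.map (listForest b).root).count x) := by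
    simpa [Null] using hu
  obtain ⟨p, hp⟩ := Code.exists_code.1
    (Partrec.nat_iff.1 (Computable.encode.comp hφ).partrec)
  replace hp : ∀ z, encode (φ z) ∈ eval p z := by
    intro z
    rw [hp]
    exact Part.mem_some _
  -- The last bit of `k` is the colour. Padding with `encode u` makes `k`, and hence the boundary
  -- `J` chosen below, exceed every entry of `u`.
  obtain ⟨k, hkb, hkp, hkx, hku⟩ : ∃ k, reqColour k = b ∧ reqCode k = p ∧ reqRoot k = x ∧
      encode u ≤ k := by
    refine ⟨2 * Nat.pair (Nat.pair (encode p) (encode x)) (encode u) + cond b 1 0, ?_, ?_, ?_, ?_⟩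
    · cases b <;> simp [reqColour]
    · have : (2 * Nat.pair (Nat.pair (encode p) (encode x)) (encode u) + cond b 1 0) / 2
        = Nat.pair (Nat.pair (encode p) (encode x)) (encode u) := by cases b <;> simp; omega
      simp [reqCode, this]
    · have : (2 * Nat.pair (Nat.pair (encode p) (encode x)) (encode u) + cond b 1 0) / 2
        = Nat.pair (Nat.pair (encode p) (encode x)) (encode u) := by cases b <;> simp; omega
      simp [reqRoot, this]
    · have := Nat.right_le_pair (Nat.pair (encode p) (encode x)) (encode u)
      omega
  obtain ⟨J, hJ⟩ := eventually_protect k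
  have hJle : ∀ s, protect s k ≤ J := by
    intro s
    obtain ⟨t, ht⟩ := eventually_atTop.1 hJ
    rw [← ht _ (le_max_right s t)]
    exact protect_mono (le_max_left _ _) k
  have hkJ : k ≤ J := ((protect_strictMono 0).id_le k).trans (hJle 0)
  -- The true number of elements below `J` that ever converge. Put into the witness as advice, it
  -- tells the construction when convergence below `J` is decided.
  obtain ⟨q, hq, hqmax⟩ : ∃ q, (∃ s, convCount s J = q) ∧ ∀ s, convCount s J ≤ q := by
    have hb : ∃ q, ∀ s, convCount s J ≤ q := ⟨J, fun s => by
      have := List.countP_le_length (p := fun i => (parS s i).isSome) (l := List.range J)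
      rwa [List.length_range] at this⟩
    refine ⟨Nat.find hb, ?_, Nat.find_spec hb⟩
    by_contra hne
    push Not at hne
    have hlt : ∀ s, convCount s J < Nat.find hb := fun s =>
      lt_of_le_of_ne (Nat.find_spec hb s) (hne s)
    exact Nat.find_min hb (Nat.sub_lt (Nat.zero_lt_of_lt (hlt 0)) one_pos) fun s => by have := hlt s; omega
  have hqJ : q ≤ J := by
    obtain ⟨s, rfl⟩ := hq
    have := List.countP_le_length (p := fun i => (parS s i).isSome) (l := List.range J)
    rwa [List.length_range] at this
  set z := Nat.pair k (Nat.pair J q) with hz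
  obtain ⟨s, hs⟩ : ∃ s, acts s z = true := by
    obtain ⟨s₁, e1⟩ := eventually_atTop.1 hJ
    obtain ⟨s₂, e2⟩ := hq
    obtain ⟨s₃, e3⟩ := evaln_complete.1 (hp z)
    refine exists_acts (s := max s₁ (max s₂ s₃)) ?_
    simp only [ready, hz, Nat.unpair_pair, Bool.and_eq_true, decide_eq_true_eq]
    refine ⟨(e1 _ (le_max_left _ _)).ge, e2.symm.le.trans (convCount_mono (by simp) J), ?_⟩
    exact Option.isSome_iff_exists.2 ⟨_, hkp ▸ evaln_mono (by simp) e3⟩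
  obtain ⟨r1, r2, w, hw⟩ : J ≤ protect s k ∧ q ≤ convCount s J ∧
      ∃ w, evaln s p z = some w := by
    have := (Bool.and_eq_true _ _ ▸ hs : _ ∧ _).1
    simpa only [ready, hz, Nat.unpair_pair, Bool.and_eq_true, decide_eq_true_eq, hkp,
      Option.isSome_iff_exists] using this
  obtain rfl : w = encode (φ z) :=
    Part.mem_unique (evaln_complete.2 ⟨s, hw⟩) (hp z)
  have hconv := parS_none_of_convCount fun t => (hqmax t).trans r2
  have hprot : ∀ t i j, J ≤ i → i < encode (φ z) → parS s i = none → parS t i = some j →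
      kept t i = b := by
    intro t i j hJi hiN hsn hts
    obtain ⟨c1, -⟩ := firstConv_spec hts
    -- Since `i` has not converged at stage `s`, its kept colour is settled at stage `s` or later,
    -- when the interval of the `k`-th requirement already contains `i`.
    have hst : s ≤ firstConv t i := by
      by_contra hlt
      rw [parS_mono (not_le.1 hlt).le c1] at hsn
      cases hsn
    rw [kept, keptAt_eq (k := k) ((hJle _).trans hJi) ?_, hkb]
    refine hiN.trans_le (le_trans ?_ (protect_mono hst (k + 1)))
    rw [protect_succ]
    -- The output on `z` is one of the summands defining `protect s (k + 1)`: `J` and `q` are at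
    -- most `protect s k`, so `z` lies in the range of summation.
    refine le_add_left (le_trans ?_ (Finset.single_le_sum
      (f := fun z => (evaln s (reqCode k) z).getD 0) (fun _ _ => Nat.zero_le _)
      (Finset.mem_range.2 (Nat.lt_succ_of_le
        (pair_mono le_rfl (pair_mono r1 (hqJ.trans r1)))))))
    change _ ≤ (evaln s (reqCode k) z).getD 0
    rw [hkp, hw]
    rfl
  have hent : ∀ l ∈ φ z, ∀ i ∈ l, i < encode (φ z) := fun l hl i hi =>
    (mem_lt_encode hi).trans (mem_lt_encode hl)
  have huent : ∀ l ∈ u, ∀ i ∈ l, i < J := fun l hl i hi =>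
    ((mem_lt_encode hi).trans (mem_lt_encode hl)).trans_le (hku.trans hkJ)
  -- The prediction is constant along edges, so replacing lists by their unknown true roots does not
  -- change the count computed at stage `s`.
  have hφc : ((φ z).map (listForest b).root).countP (fun l => decide (predict s J b l = x)) =
      (φ z).countP fun l => decide (predict s J b l = x) := by
    rw [List.countP_map]
    refine List.countP_congr fun l hl => ?_
    simp only [Function.comp, predict_root _ hconv hprot l (hent l hl)]
  have huc : (u.map (listForest b).root).countP (fun l => decide (predict s J b l = x)) =
      (u.map (listForest b).root).count x := by
    rw [List.count]
    refine List.countP_congr fun y hy => ?_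
    obtain ⟨l, hl, rfl⟩ := List.mem_map.1 hy
    rw [predict_of_root (Forest.nxt_root (F := listForest b) l) fun i hi => huent l hl i (root_mem hi)]
    simp
  have hside : side s z = decide (((φ z).countP fun l => decide (predict s J b l = x)) % 2 = 1) := by
    simp [side, hz, hkp, hkb, hkx]
    rw [← hz, hw]
    simp
  -- `z` is put on the side that contradicts the observed parity. For `true` the count over `φ z` is
  -- odd although `φ z` should be null; for `false` it is even, while `u` adds the odd multiplicity
  -- of `x`.
  cases hsd : side s z with
  | true =>
    have hN := h0 z ⟨s, by simp [hs, hsd]⟩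
    have hE := even_countP_of_even (h := fun l => decide (predict s J b l = x))
      (L := (φ z).map (listForest b).root) fun y => by
        by_cases hy : y = []
        · exact .inr (by simp [hy, predict, hx.symm])
        · exact .inl (hN y hy)
    rw [hφc] at hE
    rw [hsd] at hside
    have := of_decide_eq_true hside.symm
    rw [Nat.even_iff] at hE
    omega
  | false =>
    have hN := h1 z ⟨s, by simp [hs, hsd]⟩
    have hE := even_countP_of_even (h := fun l => decide (predict s J b l = x))
      (L := (φ z ++ u).map (listForest b).root) fun y => by
        by_cases hy : y = []
        · exact .inr (by simp [hy, predict, hx.symm])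
        · exact .inl (hN y hy)
    rw [List.map_append, List.countP_append, hφc, huc] at hE
    rw [hsd] at hside
    have := of_decide_eq_false hside.symm
    rw [Nat.even_iff] at hE hxu
    omega

/-! ### The diagonal ceer -/

/-- The classes of `0` and `1` in the diagonal ceer. -/
def DiagClass (c : Bool) : ℕ → Prop
  | 0 => c = true
  | 1 => c = false
  | z + 2 => Diag c z

/-- The ceer whose only nontrivial classes are given by the diagonal pair. -/
def DiagCeer (x y : ℕ) : Prop := x = y ∨ ∃ c, DiagClass c x ∧ DiagClass c y

theorem diagClass_unique {x : ℕ} {c d : Bool} (h : DiagClass c x) (h' : DiagClass d x) :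
    c = d := by
  match x, c, d with
  | 0, _, _ => exact Eq.trans h (Eq.symm h')
  | 1, _, _ => exact Eq.trans h (Eq.symm h')
  | _ + 2, true, true => rfl
  | _ + 2, false, false => rfl
  | _ + 2, true, false => exact (diag_disjoint h h').elim
  | _ + 2, false, true => exact (diag_disjoint h' h).elim

theorem re_diagClass (c : Bool) : REPred (DiagClass c) := by
  have h : REPred fun x => ((decide (x = 0) && c) || (decide (x = 1) && !c)) = true :=
    re_of_bool (Primrec.to_comp (by fun_prop))
  have h' : REPred fun x : ℕ => decide (2 ≤ x) = true ∧ Diag c (x - 2) :=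
    re_and (re_of_bool (Primrec.to_comp (by fun_prop)))
      (re_comp (re_diag c) (Primrec.to_comp (by fun_prop)))
  refine (re_or h h').of_eq fun x => ?_
  match x with
  | 0 => cases c <;> simp [DiagClass]
  | 1 => cases c <;> simp [DiagClass]
  | z + 2 => simp [DiagClass]

theorem isCeer_diagCeer : IsCeer DiagCeer := by
  refine ⟨⟨fun x => .inl rfl, ?_, ?_⟩, ?_⟩
  · rintro x y (h | ⟨c, h1, h2⟩)
    · exact .inl h.symm
    · exact .inr ⟨c, h2, h1⟩
  · rintro x y z (rfl | ⟨c, h1, h2⟩) (rfl | ⟨d, h3, h4⟩)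
    · exact .inl rfl
    · exact .inr ⟨d, h3, h4⟩
    · exact .inr ⟨c, h1, h2⟩
    · exact .inr ⟨c, h1, diagClass_unique h2 h3 ▸ h4⟩
  · have hc : ∀ c, REPred fun p : ℕ × ℕ => DiagClass c p.1 ∧ DiagClass c p.2 := fun c =>
      re_and (re_comp (re_diagClass c) Computable.fst) (re_comp (re_diagClass c) Computable.snd)
    have he : REPred fun p : ℕ × ℕ => decide (p.1 = p.2) = true :=
      re_of_bool (Primrec.to_comp (by fun_prop))
    refine (re_or he (re_or (hc true) (hc false))).of_eq fun p => ?_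
    simp [DiagCeer, or_comm]

/-- What every use of `DiagCeer` needs: two distinct target classes, `a` and `b`, between which a
computable function sends the two halves of the pair. -/
theorem exists_of_reduces_diagCeer {α : Type} [Primcodable α] {E : α → α → Prop}
    (h : Reduces DiagCeer E) : ∃ (f : ℕ → α) (a b : α), Computable f ∧ ¬ E a b ∧
      (∀ z, Diag true z → E (f z) a) ∧ ∀ z, Diag false z → E (f z) b := by
  obtain ⟨f, hf, hE⟩ := h
  refine ⟨fun z => f (z + 2), f 0, f 1, hf.comp (Primrec.to_comp (by fun_prop)), ?_, ?_, ?_⟩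
  · rw [← hE]
    rintro (h | ⟨c, h1, h2⟩)
    · cases h
    · exact Bool.noConfusion (Eq.trans (Eq.symm h1) h2)
  · exact fun z hz => (hE _ _).1 (.inr ⟨true, hz, rfl⟩)
  · exact fun z hz => (hE _ _).1 (.inr ⟨false, hz, rfl⟩)

theorem par_zero : par 0 = none := by
  by_contra h
  obtain ⟨j, hj⟩ := Option.ne_none_iff_exists'.1 h
  obtain ⟨s, hs⟩ := par_eq_some.1 hj
  exact Nat.not_lt_zero _ (parS_lt hs)

/-- The two halves of the diagonal pair are recursively inseparable. -/
theorem diag_inseparable {D : ℕ → Bool} (hD : Computable D) (h0 : ∀ z, Diag true z → D z = true)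
    (h1 : ∀ z, Diag false z → D z = false) : False := by
  have hr : (listForest true).root [0] = [0] := by
    refine Forest.root_of_none (F := listForest true) ?_
    by_contra h
    obtain ⟨y, hy⟩ := Option.ne_none_iff_exists'.1 h
    obtain ⟨s, hs⟩ := listNxt_eq_some.1 hy
    simp [listS, parS_of_par_none par_zero] at hs
  -- A separating function would select between the neutral element and a fixed nontrivial root of
  -- the list forest.
  refine not_separated (b := true) (u := [[0]]) (φ := fun z => bif D z then [] else [[0]]) ?_
    (Computable.cond hD (Computable.const _) (Computable.const _)) ?_ ?_
  · intro h
    have := h [0] (by simp)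
    simp [hr] at this
  · intro z hz y _
    simp [h0 z hz]
  · intro z hz y _
    simp only [h1 z hz, cond_false, List.map_append, List.count_append]
    exact ⟨_, rfl⟩

/-! ### Elementary abelian 2-groups presented by forests -/

/-- Nodes `(k, c, l)`: row `k`, colour `c`. -/
abbrev Node : Type := ℕ × ℕ × List ℕ

/-- The successor function in a row of colour `c`: a copy of one of the two forests on lists if
`c < 2`, and a copy of the universal forest otherwise. -/
noncomputable def rowNxt (c : ℕ) (l : List ℕ) : Option (List ℕ) :=
  if c < 2 then listNxt (decide (c = 1)) l else (l.head?.bind par).map fun j => [j]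

/-- The code is a rank for both kinds of rows; the length would not decrease along the edges `[i] →
[j]` of the universal rows. -/
theorem rowNxt_encode_lt {c : ℕ} {l m : List ℕ} (h : rowNxt c l = some m) :
    encode m < encode l := by
  unfold rowNxt at h
  split_ifs at h
  · obtain ⟨s, hs⟩ := listNxt_eq_some.1 h
    obtain ⟨i, l', j, rfl, -, ⟨-, rfl⟩ | ⟨-, -, rfl⟩⟩ := listS_cases hs
    · rw [encode_list_cons]
      exact Nat.lt_succ_of_le (Nat.right_le_pair _ _)
    · rw [encode_list_cons]
      exact Nat.succ_pos _
  · cases l with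
    | nil => simp at h
    | cons i l =>
      simp only [List.head?_cons, Option.bind_some, Option.map_eq_some_iff] at h
      obtain ⟨j, hj, rfl⟩ := h
      obtain ⟨s, hs⟩ := par_eq_some.1 hj
      rw [encode_list_cons, encode_list_cons]
      exact Nat.succ_lt_succ ((Nat.pair_lt_pair_left _ (parS_lt hs)).trans_le
        (pair_mono le_rfl (Nat.zero_le _)))

open Classical in
/-- The forest on nodes in which row `k` of colour `c` is restricted to the lists with a code `m`
such that `G k c m`. -/
noncomputable def nodeForest (G : ℕ → ℕ → ℕ → Prop) : Forest Node where
  nxt x := if G x.1 x.2.1 (encode x.2.2) then (rowNxt x.2.1 x.2.2).map fun l => (x.1, x.2.1, l)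
    else none
  rank x := encode x.2.2
  rank_lt {x y} h := by
    split_ifs at h
    obtain ⟨l, hl, rfl⟩ := Option.map_eq_some_iff.1 h
    exact rowNxt_encode_lt hl

variable {G : ℕ → ℕ → ℕ → Prop}

theorem nodeForest_eq_some {k c : ℕ} {l : List ℕ} {y : Node} :
    (nodeForest G).nxt (k, c, l) = some y ↔
      G k c (encode l) ∧ ∃ m, rowNxt c l = some m ∧ y = (k, c, m) := by
  classical
  change (if G k c (encode l) then (rowNxt c l).map fun l => ((k, c, l) : Node) else none)
    = some y ↔ _
  split_ifs with h
  · simp [h, eq_comm]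
  · simp [h]

theorem root_row (x : Node) : ((nodeForest G).root x).1 = x.1 ∧
    ((nodeForest G).root x).2.1 = x.2.1 := by
  constructor
  · refine Forest.apply_root (f := fun x : Node => x.1) (fun x y h => ?_) x
    obtain ⟨-, m, -, rfl⟩ := nodeForest_eq_some.1 h
    rfl
  · refine Forest.apply_root (f := fun x : Node => x.2.1) (fun x y h => ?_) x
    obtain ⟨-, m, -, rfl⟩ := nodeForest_eq_some.1 h
    rfl

/-- The relators of the elementary abelian 2-group presented by the forest on nodes. -/
def nodeRel (G : ℕ → ℕ → ℕ → Prop) : Set (Word ℕ) :=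
  {r | (∃ x : Node, r = [(encode x, true)] ∧ x.2.2 = []) ∨
    (∃ x : Node, r = [(encode x, true), (encode x, true)]) ∨
    (∃ x y : Node, r = [(encode x, true), (encode y, true), (encode x, false), (encode y, false)]) ∨
    ∃ x y : Node, r = [(encode x, true), (encode y, false)] ∧ (nodeForest G).nxt x = some y}

/-- The elementary abelian 2-group presented by the forest on nodes. -/
abbrev NodeGroup (G : ℕ → ℕ → ℕ → Prop) : Type := PresentedGroup (FreeGroup.mk '' nodeRel G)

/-- The element represented by a word. -/
def val (G : ℕ → ℕ → ℕ → Prop) (w : Word ℕ) : NodeGroup G :=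
  FreeGroup.lift (fun x => PresentedGroup.of x) (FreeGroup.mk w)

/-- The generator attached to a node. -/
def nodeGen (G : ℕ → ℕ → ℕ → Prop) (x : Node) : NodeGroup G := PresentedGroup.of (encode x)

theorem mk_relator {r : Word ℕ} (hr : r ∈ nodeRel G) :
    PresentedGroup.mk (FreeGroup.mk '' nodeRel G) (FreeGroup.mk r) = 1 :=
  PresentedGroup.one_of_mem ⟨r, hr, rfl⟩

theorem mk_word (w : Word ℕ) : PresentedGroup.mk (FreeGroup.mk '' nodeRel G) (FreeGroup.mk w) =
    (w.map fun p => cond p.2 (PresentedGroup.of p.1 : NodeGroup G)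
      (PresentedGroup.of p.1)⁻¹).prod := by
  rw [← FreeGroup.lift_mk]
  congr 1
  ext x
  simp [PresentedGroup.of]

theorem nodeGen_nil {x : Node} (hx : x.2.2 = []) : nodeGen G x = 1 := by
  have := mk_relator (G := G) (.inl ⟨x, rfl, hx⟩)
  rw [mk_word] at this
  simp only [List.map_cons, cond_true, List.map_nil, List.prod_cons, List.prod_nil,
    mul_one] at this
  exact this

theorem nodeGen_mul_self (x : Node) : nodeGen G x * nodeGen G x = 1 := by
  have := mk_relator (G := G) (.inr (.inl ⟨x, rfl⟩))
  rw [mk_word] at this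
  simp only [List.map_cons, cond_true, List.map_nil, List.prod_cons, List.prod_nil,
    mul_one] at this
  exact this

theorem nodeGen_inv (x : Node) : (nodeGen G x)⁻¹ = nodeGen G x :=
  inv_eq_of_mul_eq_one_left (nodeGen_mul_self x)

theorem nodeGen_comm (x y : Node) : nodeGen G x * nodeGen G y = nodeGen G y * nodeGen G x := by
  have := mk_relator (G := G) (.inr (.inr (.inl ⟨x, y, rfl⟩)))
  rw [mk_word] at this
  simp only [List.map_cons, cond_true, cond_false, List.map_nil, List.prod_cons, List.prod_nil,
    mul_one] at this
  change nodeGen G x * (nodeGen G y * ((nodeGen G x)⁻¹ * (nodeGen G y)⁻¹)) = 1 at this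
  rw [← mul_assoc, ← mul_inv_rev, mul_inv_eq_one] at this
  exact this

theorem nodeGen_eq {x y : Node} (h : (nodeForest G).nxt x = some y) :
    nodeGen G x = nodeGen G y := by
  have := mk_relator (G := G) (.inr (.inr (.inr ⟨x, y, rfl, h⟩)))
  rw [mk_word] at this
  simp only [List.map_cons, cond_true, cond_false, List.map_nil, List.prod_cons, List.prod_nil,
    mul_one] at this
  exact mul_inv_eq_one.1 this

theorem nodeGen_root (x : Node) : nodeGen G ((nodeForest G).root x) = nodeGen G x :=
  Forest.apply_root (fun _ _ h => nodeGen_eq h) x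

/-- The node attached to a letter. -/
def letterNode (p : ℕ × Bool) : Node := ofNat Node p.1

/-- The generators are involutions, so the exponents of the letters do not matter. -/
theorem val_eq_prod (w : Word ℕ) :
    val G w = (w.map fun p => nodeGen G (letterNode p)).prod := by
  rw [val, FreeGroup.lift_mk]
  congr 1
  refine List.map_congr_left fun p _ => ?_
  have h : (PresentedGroup.of p.1 : NodeGroup G) = nodeGen G (letterNode p) := by
    simp [nodeGen, letterNode]
  rw [h, nodeGen_inv, Bool.cond_self]

theorem val_append (u v : Word ℕ) : val G (u ++ v) = val G u * val G v := by
  simp [val_eq_prod]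

theorem nodeGroup_comm (a b : NodeGroup G) : a * b = b * a := by
  have h1 : ∀ (x : Node) (b : NodeGroup G), nodeGen G x * b = b * nodeGen G x := by
    intro x b
    refine Subgroup.mem_centralizer_singleton_iff.1 (PresentedGroup.generated_by _
      (Subgroup.centralizer {nodeGen G x}) (fun j => ?_) b) |>.symm
    have : (PresentedGroup.of j : NodeGroup G) = nodeGen G (ofNat Node j) := by simp [nodeGen]
    rw [this, Subgroup.mem_centralizer_singleton_iff]
    exact nodeGen_comm _ _
  refine (Subgroup.mem_centralizer_singleton_iff.1 (PresentedGroup.generated_by _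
      (Subgroup.centralizer {b}) (fun j => ?_) a))
  have : (PresentedGroup.of j : NodeGroup G) = nodeGen G (ofNat Node j) := by simp [nodeGen]
  rw [this, Subgroup.mem_centralizer_singleton_iff]
  exact h1 _ _

/-- The universal property of the group presented by the forest on nodes. -/
theorem exists_hom {H : Type} [Group H] (f : Node → H) (h0 : ∀ x : Node, x.2.2 = [] → f x = 1)
    (h1 : ∀ x, f x * f x = 1) (h2 : ∀ x y, f x * f y = f y * f x)
    (h3 : ∀ x y, (nodeForest G).nxt x = some y → f x = f y) :
    ∃ θ : NodeGroup G →* H, ∀ x, θ (nodeGen G x) = f x := by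
  have h : ∀ r ∈ FreeGroup.mk '' nodeRel G, FreeGroup.lift (fun i => f (ofNat Node i)) r = 1 := by
    rintro _ ⟨r, hr, rfl⟩
    rcases hr with ⟨x, rfl, hx⟩ | ⟨x, rfl⟩ | ⟨x, y, rfl⟩ | ⟨x, y, rfl, hxy⟩
    · simp only [FreeGroup.lift_mk, List.map_cons, cond_true, List.map_nil, List.prod_cons,
        List.prod_nil, mul_one, ofNat_encode, h0 x hx]
    · simp only [FreeGroup.lift_mk, List.map_cons, cond_true, List.map_nil, List.prod_cons,
        List.prod_nil, mul_one, ofNat_encode, h1 x]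
    · simp only [FreeGroup.lift_mk, List.map_cons, cond_true, cond_false, List.map_nil,
        List.prod_cons, List.prod_nil, mul_one, ofNat_encode]
      rw [← mul_assoc, h2 x y, ← mul_inv_rev, mul_inv_cancel]
    · simp only [FreeGroup.lift_mk, List.map_cons, cond_true, cond_false, List.map_nil,
        List.prod_cons, List.prod_nil, mul_one, ofNat_encode]
      rw [h3 x y hxy, mul_inv_cancel]
  refine ⟨PresentedGroup.toGroup h, fun x => ?_⟩
  rw [nodeGen, PresentedGroup.toGroup.of, ofNat_encode]

/-- A `ZMod 2`-valued functional on the group presented by the forest on nodes. -/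
structure IsFunctional (G : ℕ → ℕ → ℕ → Prop) (f : Node → Bool) : Prop where
  nil : ∀ x : Node, x.2.2 = [] → f x = false
  nxt : ∀ x y, (nodeForest G).nxt x = some y → f x = f y

theorem IsFunctional.exists_hom {f : Node → Bool} (hf : IsFunctional G f) :
    ∃ θ : NodeGroup G →* ℤˣ, ∀ w, θ (val G w) = (-1) ^ w.countP fun p => f (letterNode p) := by
  obtain ⟨θ, hθ⟩ := CeerGroups.exists_hom (G := G) (fun x => if f x then (-1 : ℤˣ) else 1)
    (fun x hx => by simp [hf.nil x hx]) (fun x => by cases f x <;> simp)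
    (fun x y => mul_comm _ _) (fun x y hxy => by rw [hf.nxt x y hxy])
  refine ⟨θ, fun w => ?_⟩
  rw [val_eq_prod]
  induction w with
  | nil => simp
  | cons p w ih =>
    rw [List.map_cons, List.prod_cons, map_mul, ih, hθ]
    cases h : f (letterNode p) <;> simp [h, pow_succ]

/-- A functional is a character with values `±1`, and equal elements of an elementary abelian
2-group have product `1`. -/
theorem IsFunctional.even {f : Node → Bool} (hf : IsFunctional G f) {u v : Word ℕ}
    (h : val G u = val G v) : Even ((u ++ v).countP fun p => f (letterNode p)) := by
  obtain ⟨θ, hθ⟩ := hf.exists_hom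
  have h1 : θ (val G (u ++ v)) = 1 := by
    rw [val_append, h, map_mul, ← sq]
    exact Int.units_sq _
  rw [hθ] at h1
  refine (neg_one_pow_eq_one_iff_even (R := ℤ) (by norm_num)).1 ?_
  have := congrArg Units.val h1
  rwa [Units.val_pow_eq_pow_val, Units.val_neg, Units.val_one] at this

/-- The coordinate functional of a root. -/
noncomputable def coord (G : ℕ → ℕ → ℕ → Prop) (y x : Node) : Bool :=
  decide ((nodeForest G).root x = y)

theorem isFunctional_coord {y : Node} (hy : y.2.2 ≠ []) : IsFunctional G (coord G y) where
  nil x hx := by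
    have : (nodeForest G).nxt x = none := by
      by_contra h
      obtain ⟨z, hz⟩ := Option.ne_none_iff_exists'.1 h
      have := (nodeForest G).rank_lt hz
      change _ < encode x.2.2 at this
      rw [hx] at this
      exact Nat.not_lt_zero _ this
    rw [coord, Forest.root_of_none this]
    exact decide_eq_false fun h => hy (h ▸ hx)
  nxt x z hxz := by rw [coord, coord, Forest.root_of_some hxz]

/-- Replace every node by its root. If each nonempty root occurs an even number of times, the
commuting involutions cancel in pairs and the product is `1`. -/
theorem exists_coord {w : Word ℕ} (h : val G w ≠ 1) :
    ∃ y : Node, y.2.2 ≠ [] ∧ ¬ Even (w.countP fun p => coord G y (letterNode p)) := by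
  by_contra hne
  push Not at hne
  apply h
  let _ : CommGroup (NodeGroup G) := { (inferInstance : Group (NodeGroup G)) with
    mul_comm := nodeGroup_comm }
  rw [val_eq_prod]
  have : (w.map fun p => nodeGen G (letterNode p)) =
      ((w.map fun p => (nodeForest G).root (letterNode p)).map (nodeGen G)) := by
    rw [List.map_map]
    exact List.map_congr_left fun p _ => (nodeGen_root _).symm
  rw [this]
  refine prod_eq_one_of_even (fun y => by rw [sq]; exact nodeGen_mul_self y) fun y => ?_
  by_cases hy : y.2.2 = []
  · exact .inr (nodeGen_nil hy)
  · refine .inl ?_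
    have := hne y hy
    rw [List.count, List.countP_map]
    refine (congrArg Even (List.countP_congr fun p _ => ?_)).mp this
    simp [coord]

theorem exists_coord_of_ne {u v : Word ℕ} (h : val G u ≠ val G v) :
    ∃ y : Node, y.2.2 ≠ [] ∧ ¬ Even ((u ++ v).countP fun p => coord G y (letterNode p)) := by
  refine exists_coord fun h1 => h ?_
  rw [val_append] at h1
  rw [eq_inv_of_mul_eq_one_left h1, inv_eq_iff_mul_eq_one, ← val_append]
  by_contra hne
  obtain ⟨y, -, hy⟩ := exists_coord hne
  exact hy (by rw [List.countP_append]; exact ⟨_, rfl⟩)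

/-! ### Full and restricted rows -/

/-- The coordinates of a restricted row are computable. -/
theorem primrec_coord (hG : ∀ k c m n, m ≤ n → G k c n → G k c m) {y : Node} {m : ℕ}
    (hm : ¬ G y.1 y.2.1 m) : Primrec (coord G y) := by
  -- In this row only lists with a code below `m` can have an edge. Their coordinates form a finite
  -- table, which need not be found effectively; every other node of the row is its own root.
  let T : List Bool := (List.range m).map fun n => coord G y (y.1, y.2.1, ofNat (List ℕ) n)
  have h : Primrec fun x : Node => (decide (x.1 = y.1) && decide (x.2.1 = y.2.1)) &&
      (if encode x.2.2 < m then T.getD (encode x.2.2) false else decide (x = y)) := by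
    have h1 : Primrec fun x : Node => T.getD (encode x.2.2) false :=
      (Primrec.list_getD false).comp (Primrec.const T) (by fun_prop)
    fun_prop
  refine h.of_eq fun x => ?_
  by_cases hx : x.1 = y.1 ∧ x.2.1 = y.2.1
  · obtain ⟨k, c, l⟩ := x
    obtain ⟨k', c', l'⟩ := y
    obtain ⟨rfl, rfl⟩ := hx
    simp only [decide_true, Bool.true_and]
    split_ifs with hl
    · simp [T, hl]
    · have hn : (nodeForest G).nxt (k, c, l) = none := by
        by_contra hne
        obtain ⟨z, hz⟩ := Option.ne_none_iff_exists'.1 hne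
        exact hm (hG _ _ _ _ (not_lt.1 hl) (nodeForest_eq_some.1 hz).1)
      rw [coord, Forest.root_of_none hn]
  · have : coord G y x = false := by
      refine decide_eq_false fun h => hx ?_
      rw [← h]
      exact ⟨(root_row x).1.symm, (root_row x).2.symm⟩
    rw [this]
    simp only [Bool.and_eq_false_iff, decide_eq_false_iff_not]
    left
    tauto

theorem root_full {k c : ℕ} (hc : c < 2) (hG : ∀ m, G k c m) (l : List ℕ) :
    (nodeForest G).root (k, c, l) = (k, c, (listForest (decide (c = 1))).root l) := by
  induction l using Forest.induction (F := listForest (decide (c = 1))) with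
  | h0 l hl =>
    rw [Forest.root_of_none hl, Forest.root_of_none]
    by_contra h
    obtain ⟨y, hy⟩ := Option.ne_none_iff_exists'.1 h
    obtain ⟨-, m, hm, -⟩ := nodeForest_eq_some.1 hy
    rw [rowNxt, if_pos hc] at hm
    change listNxt _ l = none at hl
    rw [hl] at hm
    cases hm
  | h1 l m hlm ih =>
    rw [Forest.root_of_some hlm, ← ih]
    exact Forest.root_of_some (nodeForest_eq_some.2 ⟨hG _, m, by rw [rowNxt, if_pos hc]; exact hlm,
      rfl⟩)

theorem root_full_par {k c : ℕ} (hc : ¬ c < 2) (hG : ∀ m, G k c m) (i : ℕ) :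
    (nodeForest G).root (k, c, [i]) = (k, c, [parForest.root i]) := by
  induction i using Forest.induction (F := parForest) with
  | h0 i hi =>
    rw [Forest.root_of_none hi, Forest.root_of_none]
    by_contra h
    obtain ⟨y, hy⟩ := Option.ne_none_iff_exists'.1 h
    obtain ⟨-, m, hm, -⟩ := nodeForest_eq_some.1 hy
    change par i = none at hi
    simp [rowNxt, hc, hi] at hm
  | h1 i j hij ih =>
    rw [Forest.root_of_some hij, ← ih]
    change par i = some j at hij
    exact Forest.root_of_some (nodeForest_eq_some.2 ⟨hG _, [j], by simp [rowNxt, hc, hij], rfl⟩)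

/-- The part of a word in row `k` of colour `c`. -/
def rowPart (k c : ℕ) (w : Word ℕ) : List (List ℕ) :=
  w.filterMap fun p => if (letterNode p).1 = k then
    if (letterNode p).2.1 = c then some (letterNode p).2.2 else none else none

theorem computable_rowPart (k c : ℕ) : Computable (rowPart k c) := by
  apply Primrec.to_comp
  unfold rowPart letterNode
  fun_prop

theorem count_rowPart {k c : ℕ} (hc : c < 2) (hG : ∀ m, G k c m) (y : List ℕ) (w : Word ℕ) :
    ((rowPart k c w).map (listForest (decide (c = 1))).root).count y =
      w.countP fun p => coord G (k, c, y) (letterNode p) := by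
  induction w with
  | nil => simp [rowPart]
  | cons p w ih =>
    rw [List.countP_cons, ← ih]
    rcases hx : letterNode p with ⟨k', c', l⟩
    by_cases h : k' = k ∧ c' = c
    · obtain ⟨rfl, rfl⟩ := h
      simp [rowPart, hx, coord, root_full hc hG, List.count_cons]
    · have : coord G (k, c, y) (k', c', l) = false := by
        refine decide_eq_false fun he => h ?_
        have := root_row (G := G) (k', c', l)
        rw [he] at this
        exact ⟨this.1.symm, this.2.symm⟩
      rw [this]
      have h2 : rowPart k c (p :: w) = rowPart k c w := by
        unfold rowPart
        rw [List.filterMap_cons_none]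
        rw [hx]
        dsimp only
        split_ifs with h1 h2
        · exact absurd ⟨h1, h2⟩ h
        · rfl
        · rfl
      rw [h2]
      simp

/-- If no row of colour at least `2` is full, then the diagonal ceer does not reduce to the word
problem. -/
theorem not_reduces_val (hG : ∀ k c m n, m ≤ n → G k c n → G k c m)
    (hr : ∀ k c, ¬ c < 2 → ∃ m, ¬ G k c m) :
    ¬ Reduces DiagCeer fun u v : Word ℕ => val G u = val G v := by
  intro h
  obtain ⟨f, u₀, u₁, hf, hne, h0, h1⟩ := exists_of_reduces_diagCeer h
  obtain ⟨⟨k, c, y⟩, hy, hodd⟩ := exists_coord_of_ne hne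
  have hfun := isFunctional_coord (G := G) hy
  have e1 := fun z hz => hfun.even (h0 z hz)
  have e2 := fun z hz => hfun.even (h1 z hz)
  -- If the row of the detecting coordinate is full, it is one of the two list forests and
  -- `not_separated` applies; otherwise the coordinate is computable and would separate the pair.
  by_cases hfull : ∀ m, G k c m
  · have hc : c < 2 := by
      by_contra hc
      obtain ⟨m, hm⟩ := hr k c hc
      exact hm (hfull m)
    have hnull : ∀ w w', val G w = val G w' → Null (decide (c = 1)) (rowPart k c (w ++ w')) := by
      intro w w' h x hx
      have := (isFunctional_coord (G := G) (y := (k, c, x)) hx).even h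
      rw [← count_rowPart hc hfull] at this
      exact this
    have happ : ∀ w w', rowPart k c (w ++ w') = rowPart k c w ++ rowPart k c w' :=
      fun w w' => List.filterMap_append
    -- If `f z` equals `u₀`, then `f z ++ u₀` is null. If it equals `u₁`, then so is `f z ++ u₀ ++
    -- u₀ ++ u₁`, since the two copies of `u₀` cancel modulo 2.
    refine not_separated (b := decide (c = 1)) (u := rowPart k c (u₀ ++ u₁))
      (φ := fun z => rowPart k c (f z ++ u₀)) ?_
      ((computable_rowPart k c).comp (computable_append hf (Computable.const u₀))) ?_ ?_
    · intro hN
      have := hN y hy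
      rw [count_rowPart hc hfull] at this
      exact hodd this
    · exact fun z hz => hnull _ _ (h0 z hz)
    · intro z hz x hx
      have := hnull _ _ (h1 z hz) x hx
      simp only [happ, List.map_append, List.count_append, Nat.even_iff] at this ⊢
      omega
  · push Not at hfull
    obtain ⟨m, hm⟩ := hfull
    have hp : Primrec fun w : Word ℕ => decide
        (w.countP (fun p => coord G (k, c, y) (letterNode p)) % 2 = 0) := by
      have := primrec_coord hG (y := (k, c, y)) hm
      unfold letterNode
      fun_prop
    refine diag_inseparable (hp.to_comp.comp (computable_append hf (Computable.const u₀)))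
      (fun z hz => ?_) fun z hz => ?_
    · have := e1 z hz
      rw [Nat.even_iff] at this
      exact decide_eq_true this
    · have := e2 z hz
      simp only [List.countP_append, Nat.even_iff] at this hodd ⊢
      exact decide_eq_false (by omega)

/-- If some row of colour at least `2` is full, then the word problem is universal. -/
theorem reduces_val {k c : ℕ} (hc : ¬ c < 2) (hG : ∀ m, G k c m) :
    Reduces RInf fun u v : Word ℕ => val G u = val G v := by
  refine ⟨fun i => [(encode ((k, c, [i]) : Node), true)], Primrec.to_comp (by fun_prop), ?_⟩
  intro i j
  have hv : ∀ i, val G [(encode ((k, c, [i]) : Node), true)] =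
      nodeGen G (k, c, [parForest.root i]) := by
    intro i
    rw [← root_full_par hc hG, nodeGen_root, val_eq_prod]
    simp [letterNode]
  constructor
  · intro h
    change val G _ = val G _
    rw [RInf] at h
    rw [hv, hv, h]
  · intro h
    have := (isFunctional_coord (G := G) (y := (k, c, [parForest.root i])) (by simp)).even
      (u := [(encode ((k, c, [i]) : Node), true)]) (v := [(encode ((k, c, [j]) : Node), true)]) h
    simp only [List.countP_append, List.countP_singleton, letterNode, ofNat_encode, coord,
      root_full_par hc hG, decide_true, if_true] at this
    by_contra hne
    rw [RInf] at hne
    simp [Ne.symm hne] at this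

/-! ### Normal forms in free products -/

section Alternating

variable {A B : Type} [Group A] [Group B]

/-- The element of the free product given by a letter. -/
def letterVal : A ⊕ B → Coprod A B := Sum.elim Coprod.inl Coprod.inr

/-- Alternating products of nontrivial letters. -/
structure Alternating (L : List (A ⊕ B)) : Prop where
  ne_one : ∀ g ∈ L, Sum.elim (· ≠ 1) (· ≠ 1) g
  isChain : L.IsChain fun g g' => g.isLeft ≠ g'.isLeft

theorem Alternating.tail {g : A ⊕ B} {L : List (A ⊕ B)} (h : Alternating (g :: L)) :
    Alternating L :=
  ⟨fun x hx => h.ne_one x (List.mem_cons_of_mem _ hx), h.isChain.of_cons⟩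

/-- Multiply letters on from the left: a letter is prepended, merged with a first letter from the
same factor, or cancelled with it. -/
theorem exists_alternating (a : Coprod A B) :
    ∃ L : List (A ⊕ B), Alternating L ∧ (L.map letterVal).prod = a := by
  induction a using Coprod.induction_on' with
  | one => exact ⟨[], ⟨by simp, .nil⟩, rfl⟩
  | inl_mul x a ih =>
    obtain ⟨L, hL, rfl⟩ := ih
    by_cases hx : x = 1
    · exact ⟨L, hL, by simp [hx]⟩
    match L, hL with
    | [], _ => exact ⟨[.inl x], ⟨by simpa, .singleton _⟩, by simp [letterVal]⟩
    | .inl y :: L, hL =>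
      by_cases hxy : x * y = 1
      · refine ⟨L, hL.tail, ?_⟩
        simp [letterVal, ← mul_assoc, ← map_mul, hxy]
      · refine ⟨.inl (x * y) :: L, ⟨?_, ?_⟩, by simp [letterVal, mul_assoc]⟩
        · intro g hg
          rcases List.mem_cons.1 hg with rfl | hg
          · exact hxy
          · exact hL.tail.ne_one g hg
        · have := hL.isChain
          rw [List.isChain_cons] at this ⊢
          exact this
    | .inr y :: L, hL =>
      refine ⟨.inl x :: .inr y :: L, ⟨?_, hL.isChain.cons_cons (by simp)⟩, by simp [letterVal]⟩
      intro g hg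
      rcases List.mem_cons.1 hg with rfl | hg
      · exact hx
      · exact hL.ne_one g hg
  | inr_mul x a ih =>
    obtain ⟨L, hL, rfl⟩ := ih
    by_cases hx : x = 1
    · exact ⟨L, hL, by simp [hx]⟩
    match L, hL with
    | [], _ => exact ⟨[.inr x], ⟨by simpa, .singleton _⟩, by simp [letterVal]⟩
    | .inr y :: L, hL =>
      by_cases hxy : x * y = 1
      · refine ⟨L, hL.tail, ?_⟩
        simp [letterVal, ← mul_assoc, ← map_mul, hxy]
      · refine ⟨.inr (x * y) :: L, ⟨?_, ?_⟩, by simp [letterVal, mul_assoc]⟩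
        · intro g hg
          rcases List.mem_cons.1 hg with rfl | hg
          · exact hxy
          · exact hL.tail.ne_one g hg
        · have := hL.isChain
          rw [List.isChain_cons] at this ⊢
          exact this
    | .inl y :: L, hL =>
      refine ⟨.inr x :: .inl y :: L, ⟨?_, hL.isChain.cons_cons (by simp)⟩, by simp [letterVal]⟩
      intro g hg
      rcases List.mem_cons.1 hg with rfl | hg
      · exact hx
      · exact hL.ne_one g hg

end Alternating

/-! ### Moves on the natural numbers -/

/-- The map exchanging `m` and `m + 1` whenever `p m`. -/
def move (p : ℕ → Bool) (m : ℕ) : ℕ :=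
  if p m then m + 1 else if 0 < m ∧ p (m - 1) then m - 1 else m

theorem move_false : move (fun _ => false) = id := by
  ext m
  simp [move]

/-- Since `S` contains no two consecutive numbers, the transpositions of `m` and `m + 1` for `m` in
`S` are disjoint. They generate an elementary abelian 2-group in which composition is `xor`. -/
theorem move_move {S p q : ℕ → Bool} (hS : ∀ m, ¬ (S m ∧ S (m + 1))) (hp : ∀ m, p m → S m)
    (hq : ∀ m, q m → S m) (m : ℕ) : move p (move q m) = move (fun j => p j ^^ q j) m := by
  have h : ∀ m, S m → S (m + 1) = false := fun m h => by
    by_contra h'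
    exact hS m ⟨h, by simpa using h'⟩
  have h' : ∀ r : ℕ → Bool, (∀ m, r m → S m) → ∀ m, S m → r (m + 1) = false := fun r hr m hm => by
    by_contra h1
    exact hS m ⟨hm, hr _ (by simpa using h1)⟩
  have hS' : ∀ r : ℕ → Bool, (∀ m, r m → S m) → ∀ m, S (m + 1) → r m = false := fun r hr m hm => by
    by_contra h1
    exact hS m ⟨hr _ (by simpa using h1), hm⟩
  have hn : ∀ r : ℕ → Bool, (∀ m, r m → S m) → ∀ m, S m = false → r m = false := fun r hr m hm => by
    by_contra h1
    rw [hr m (by simpa using h1)] at hm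
    cases hm
  rcases hm : S m with _ | _
  · match m with
    | 0 => simp [move, hn p hp _ hm, hn q hq _ hm]
    | m + 1 =>
      have e1 := hn p hp _ hm
      have e2 := hn q hq _ hm
      have e3 : ∀ r : ℕ → Bool, (∀ m, r m → S m) → S m → ¬ (0 < m ∧ r (m - 1)) := by
        rintro r hr h ⟨h0, h1⟩
        rw [hS' r hr (m - 1) (by rwa [Nat.sub_add_cancel h0])] at h1
        cases h1
      cases hp' : p m <;> cases hq' : q m
      · simp [move, e1, e2, hp', hq']
      · simp [move, e1, e2, hp', hq', e3 p hp (hq _ hq')]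
      · simp [move, e1, e2, hp', hq']
      · simp [move, e1, e2, hp', hq']
  · have e1 := h' p hp _ hm
    have e2 := h' q hq _ hm
    match m with
    | 0 => cases hp' : p 0 <;> cases hq' : q 0 <;> simp [move, e1, hp', hq']
    | m + 1 =>
      have e3 := hS' p hp m hm
      have e4 := hS' q hq m hm
      cases hp' : p (m + 1) <;> cases hq' : q (m + 1) <;> simp [move, e1, hp', hq', e3, e4]

/-- The permutation exchanging `m` and `m + 1` whenever `p m`. -/
def movePerm (S : ℕ → Bool) (hS : ∀ m, ¬ (S m ∧ S (m + 1))) (p : ℕ → Bool)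
    (hp : ∀ m, p m → S m) : Equiv.Perm ℕ :=
  Function.Involutive.toPerm (move p) fun m => by
    rw [move_move hS hp hp]
    simp [move_false]

theorem exists_val (g : NodeGroup G) : ∃ w, val G w = g := by
  obtain ⟨x, rfl⟩ := PresentedGroup.mk_surjective _ g
  refine ⟨x.toWord, ?_⟩
  rw [val, FreeGroup.mk_toWord]
  have : FreeGroup.lift (fun x => (PresentedGroup.of x : NodeGroup G)) =
      PresentedGroup.mk _ := by
    ext x
    simp [PresentedGroup.of]
  rw [this]

/-- The moves of a node: step `j` is exchanged when the `j`-th entry of `K` is on the given side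
and its coordinate of the node is nonzero. -/
noncomputable def nodeMoves (G : ℕ → ℕ → ℕ → Prop) (K : List (Bool × Node)) (σ : Bool) (x : Node)
    (j : ℕ) : Bool :=
  (K.map fun t => decide (t.1 = σ) && coord G t.2 x).getD j false

theorem nodeMoves_eq_true {K : List (Bool × Node)} {σ : Bool} {x : Node} {j : ℕ} :
    nodeMoves G K σ x j = true ↔ ∃ y, K[j]? = some (σ, y) ∧ coord G y x = true := by
  rw [nodeMoves, List.getD_eq_getElem?_getD, List.getElem?_map]
  rcases K[j]? with _ | ⟨τ, y⟩
  · simp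
  · simp only [Option.map_some, Option.getD_some, Bool.and_eq_true, decide_eq_true_eq,
      Option.some.injEq, Prod.ext_iff]
    exact ⟨fun h => ⟨y, ⟨h.1, rfl, rfl, rfl⟩, h.2⟩, fun ⟨z, h, hz⟩ =>
      ⟨h.1, (Prod.ext h.2.1 (Prod.ext h.2.2.1 h.2.2.2) : y = z) ▸ hz⟩⟩

/-- The moves of a word. -/
noncomputable def wordMoves (G : ℕ → ℕ → ℕ → Prop) (K : List (Bool × Node)) (σ : Bool)
    (w : Word ℕ) (j : ℕ) : Bool :=
  decide (w.countP (fun p => nodeMoves G K σ (letterNode p) j) % 2 = 1)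

/-- The sides of the entries of `K` alternate, so the steps used by one factor are never adjacent
and the generators act by commuting involutions. The coordinates respect the forest, hence the
relators. -/
theorem exists_hom_perm {K : List (Bool × Node)} (hK : ∀ t ∈ K, t.2.2.2 ≠ [])
    (hc : K.IsChain fun t t' => t.1 ≠ t'.1) (σ : Bool) :
    ∃ θ : NodeGroup G →* Equiv.Perm ℕ, (∀ x m, θ (nodeGen G x) m = move (nodeMoves G K σ x) m) ∧
      ∀ w m, θ (val G w) m = move (wordMoves G K σ w) m := by
  let S : ℕ → Bool := fun j => (K[j]?).any fun t => decide (t.1 = σ)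
  have hS : ∀ m, ¬ (S m ∧ S (m + 1)) := by
    rintro m ⟨h1, h2⟩
    simp only [S, Option.any_eq_true] at h1 h2
    obtain ⟨t, h1, h1'⟩ := h1
    obtain ⟨t', h2, h2'⟩ := h2
    rw [List.isChain_iff_getElem] at hc
    obtain ⟨h3, rfl⟩ := List.getElem?_eq_some_iff.1 h2
    obtain ⟨h4, rfl⟩ := List.getElem?_eq_some_iff.1 h1
    exact hc m h3 ((of_decide_eq_true h1').trans (of_decide_eq_true h2').symm)
  have hp : ∀ x m, nodeMoves G K σ x m → S m := by
    intro x m h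
    obtain ⟨y, h1, h2⟩ := nodeMoves_eq_true.1 h
    simp [S, h1]
  have hex : ∃ θ : NodeGroup G →* Equiv.Perm ℕ, ∀ x, θ (nodeGen G x) =
      movePerm S hS (nodeMoves G K σ x) (hp x) := by
    refine CeerGroups.exists_hom _ ?_ ?_ ?_ ?_
    · intro x hx
      ext m
      have : nodeMoves G K σ x = fun _ => false := by
        ext j
        by_contra h
        obtain ⟨y, h1, h2⟩ := nodeMoves_eq_true.1 (by simpa using h)
        rw [(isFunctional_coord (hK _ (List.mem_of_getElem? h1))).nil x hx] at h2
        cases h2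
      change move (nodeMoves G K σ x) m = m
      rw [this, move_false, id]
    · intro x
      ext m
      change move _ (move _ m) = m
      rw [move_move hS (hp x) (hp x)]
      simp [move_false]
    · intro x y
      ext m
      change move _ (move _ m) = move _ (move _ m)
      rw [move_move hS (hp x) (hp y), move_move hS (hp y) (hp x)]
      simp only [Bool.xor_comm]
    · intro x y hxy
      have : nodeMoves G K σ x = nodeMoves G K σ y := by
        ext j
        rw [Bool.eq_iff_iff, nodeMoves_eq_true, nodeMoves_eq_true]
        refine exists_congr fun z => and_congr_right fun h => ?_
        rw [(isFunctional_coord (hK _ (List.mem_of_getElem? h))).nxt x y hxy]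
      ext m
      change move _ m = move _ m
      rw [this]
  obtain ⟨θ, hθ⟩ := hex
  have h1 : ∀ x m, θ (nodeGen G x) m = move (nodeMoves G K σ x) m := fun x m => by
    rw [hθ]
    rfl
  refine ⟨θ, h1, fun w m => ?_⟩
  rw [val_eq_prod]
  have hw : ∀ (w : Word ℕ) m, wordMoves G K σ w m → S m := by
    intro w m h
    by_contra hn
    have : w.countP (fun p => nodeMoves G K σ (letterNode p) m) = 0 := by
      rw [List.countP_eq_zero]
      intro p _ h
      exact hn (hp _ _ h)
    simp [wordMoves, this] at h
  induction w with
  | nil =>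
    have : wordMoves G K σ [] = fun _ => false := by
      ext j
      simp [wordMoves]
    simp [this, move_false]
  | cons p w ih =>
    rw [List.map_cons, List.prod_cons, map_mul, Equiv.Perm.mul_apply, ih, h1,
      move_move hS (hp _) (hw w)]
    congr 1
    ext j
    simp only [wordMoves, List.countP_cons]
    cases nodeMoves G K σ (letterNode p) j with
    | false => simp
    | true =>
      rcases Nat.mod_two_eq_zero_or_one
        (w.countP fun p => nodeMoves G K σ (letterNode p) j) with h | h <;>
      simp [h, Nat.add_mod]

/-- The list `K` is fixed, so no uniformity of `h` in its first argument is required. -/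
theorem primrec_map_const {α β γ : Type} [Primcodable α] [Primcodable γ] (K : List β)
    {h : β → α → γ} (hh : ∀ t ∈ K, Primrec (h t)) : Primrec fun a => K.map fun t => h t a := by
  induction K with
  | nil => exact Primrec.const _
  | cons t K ih =>
    exact Primrec.list_cons.comp (hh t (by simp)) (ih fun t ht => hh t (List.mem_cons_of_mem _ ht))

/-- In a free product of two copies of a group all of whose rows are restricted, nontrivial elements
act nontrivially in a computable action. -/
theorem exists_action (hG : ∀ k c m n, m ≤ n → G k c n → G k c m) (hr : ∀ k c, ∃ m, ¬ G k c m)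
    {a : Coprod (NodeGroup G) (NodeGroup G)} (ha : a ≠ 1) :
    ∃ (ρ : Coprod (NodeGroup G) (NodeGroup G) →* Equiv.Perm ℕ) (μ : ℕ ⊕ ℕ → ℕ → ℕ) (n : ℕ),
      (Primrec fun p : (ℕ ⊕ ℕ) × ℕ => μ p.1 p.2) ∧
      (∀ x m, ρ (Coprod.inl (PresentedGroup.of x)) m = μ (.inl x) m) ∧
      (∀ x m, ρ (Coprod.inr (PresentedGroup.of x)) m = μ (.inr x) m) ∧ ρ a n ≠ n := by
  obtain ⟨L, hL, rfl⟩ := exists_alternating a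
  -- Each nontrivial letter gets a representing word and a coordinate that is odd on it; trivial
  -- letters get a dummy, as they do not occur in `L`.
  have ht : ∀ g : NodeGroup G ⊕ NodeGroup G, ∃ t : Bool × Word ℕ × Node,
      t.1 = g.isLeft ∧ letterVal g = cond t.1 (Coprod.inl (val G t.2.1)) (Coprod.inr (val G t.2.1)) ∧
      (Sum.elim (· ≠ 1) (· ≠ 1) g → t.2.2.2.2 ≠ [] ∧
        ¬ Even (t.2.1.countP fun p => coord G t.2.2 (letterNode p))) := by
    rintro (g | g)
    · obtain ⟨w, rfl⟩ := exists_val g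
      by_cases h : val G w = 1
      · exact ⟨(true, w, (0, 0, [])), rfl, rfl, fun h' => (h' h).elim⟩
      · obtain ⟨y, hy⟩ := exists_coord h
        exact ⟨(true, w, y), rfl, rfl, fun _ => hy⟩
    · obtain ⟨w, rfl⟩ := exists_val g
      by_cases h : val G w = 1
      · exact ⟨(false, w, (0, 0, [])), rfl, rfl, fun h' => (h' h).elim⟩
      · obtain ⟨y, hy⟩ := exists_coord h
        exact ⟨(false, w, y), rfl, rfl, fun _ => hy⟩
  choose t ht1 ht2 ht3 using ht
  let K : List (Bool × Node) := L.map fun g => ((t g).1, (t g).2.2)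
  have hK : ∀ s ∈ K, s.2.2.2 ≠ [] := by
    intro s hs
    obtain ⟨g, hg, rfl⟩ := List.mem_map.1 hs
    exact (ht3 g (hL.ne_one g hg)).1
  have hc : K.IsChain fun t t' => t.1 ≠ t'.1 := by
    rw [List.isChain_map]
    refine hL.isChain.imp fun g g' h => ?_
    simpa only [ht1] using h
  obtain ⟨θ, hθ, hθ'⟩ := exists_hom_perm (G := G) hK hc true
  obtain ⟨η, hη, hη'⟩ := exists_hom_perm (G := G) hK hc false
  refine ⟨Coprod.lift θ η, fun x m => move (nodeMoves G K x.isLeft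
    (ofNat Node (Sum.elim id id x))) m, L.length, ?_, ?_, ?_, ?_⟩
  · have h : ∀ t : Bool × Node, Primrec (coord G t.2) := by
      intro t
      obtain ⟨m, hm⟩ := hr t.2.1 t.2.2.1
      exact primrec_coord hG hm
    have hl : Primrec fun p : (ℕ ⊕ ℕ) × ℕ => Sum.elim (id : ℕ → ℕ) id p.1 := by
      have : Primrec fun p : (ℕ ⊕ ℕ) × ℕ => Sum.elim (fun x : ℕ => x) (fun x => x) p.1 := by
        fun_prop
      exact this
    have hs : Primrec fun p : (ℕ ⊕ ℕ) × ℕ => p.1.isLeft := by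
      have : Primrec fun p : (ℕ ⊕ ℕ) × ℕ => Sum.elim (fun _ => true) (fun _ => false) p.1 := by
        fun_prop
      exact this.of_eq fun p => by cases p.1 <;> rfl
    have hm : Primrec fun q : ((ℕ ⊕ ℕ) × ℕ) × ℕ => nodeMoves G K q.1.1.isLeft
        (ofNat Node (Sum.elim id id q.1.1)) q.2 := by
      unfold nodeMoves
      refine (Primrec.list_getD false).comp ?_ (by fun_prop)
      refine primrec_map_const K fun s _ => ?_
      have h1 : Primrec fun q : ((ℕ ⊕ ℕ) × ℕ) × ℕ => coord G s.2
          (ofNat Node (Sum.elim id id q.1.1)) :=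
        (h s).comp ((Primrec.ofNat Node).comp (hl.comp Primrec.fst))
      have h2 : Primrec fun q : ((ℕ ⊕ ℕ) × ℕ) × ℕ => q.1.1.isLeft := hs.comp Primrec.fst
      fun_prop
    have h1 : Primrec fun p : (ℕ ⊕ ℕ) × ℕ => nodeMoves G K p.1.isLeft
        (ofNat Node (Sum.elim id id p.1)) p.2 := hm.comp (Primrec.id.pair Primrec.snd)
    have h2 : Primrec fun p : (ℕ ⊕ ℕ) × ℕ => nodeMoves G K p.1.isLeft
        (ofNat Node (Sum.elim id id p.1)) (p.2 - 1) :=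
      hm.comp (Primrec.id.pair (by fun_prop))
    have h3 : Primrec fun p : (ℕ ⊕ ℕ) × ℕ => bif nodeMoves G K p.1.isLeft
        (ofNat Node (Sum.elim id id p.1)) p.2 then p.2 + 1 else
        bif decide (0 < p.2) && nodeMoves G K p.1.isLeft
          (ofNat Node (Sum.elim id id p.1)) (p.2 - 1) then p.2 - 1 else p.2 := by
      fun_prop
    refine h3.of_eq fun p => ?_
    simp [move, cond_eq_ite]
  · intro x m
    have : (PresentedGroup.of x : NodeGroup G) = nodeGen G (ofNat Node x) := by simp [nodeGen]
    rw [Coprod.lift_apply_inl, this, hθ]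
    rfl
  · intro x m
    have : (PresentedGroup.of x : NodeGroup G) = nodeGen G (ofNat Node x) := by simp [nodeGen]
    rw [Coprod.lift_apply_inr, this, hη]
    rfl
  -- The `i`-th letter moves `i + 1` to `i`: its chosen coordinate is odd, and step `i + 1` belongs
  -- to the other factor. The whole product thus walks the point `L.length` down to `0`.
  · have key : ∀ (i : ℕ) (g), L[i]? = some g → Coprod.lift θ η (letterVal g) (i + 1) = i := by
      intro i g hi
      have hKi : K[i]? = some ((t g).1, (t g).2.2) := by simp [K, hi]
      have h1 : Coprod.lift θ η (letterVal g) (i + 1) =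
          move (wordMoves G K (t g).1 (t g).2.1) (i + 1) := by
        rw [ht2]
        cases (t g).1
        · exact hη' _ _
        · exact hθ' _ _
      have hodd := (ht3 g (hL.ne_one g (List.mem_of_getElem? hi))).2
      have h2 : wordMoves G K (t g).1 (t g).2.1 i = true := by
        refine decide_eq_true ?_
        rw [Nat.not_even_iff] at hodd
        rw [← hodd]
        congr 1
        refine List.countP_congr fun p _ => ?_
        rw [nodeMoves_eq_true, hKi]
        simp
      have h3 : wordMoves G K (t g).1 (t g).2.1 (i + 1) = false := by
        refine decide_eq_false ?_
        rw [List.countP_eq_zero.2]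
        · decide
        · intro p _ h
          obtain ⟨y, hy, -⟩ := nodeMoves_eq_true.1 h
          rw [List.isChain_iff_getElem] at hc
          obtain ⟨h5, h6⟩ := List.getElem?_eq_some_iff.1 hy
          obtain ⟨h7, h8⟩ := List.getElem?_eq_some_iff.1 hKi
          refine hc i h5 ?_
          rw [h6, h8]
      rw [h1]
      simp [move, h2, h3]
    have : ∀ i ≤ L.length, Coprod.lift θ η ((L.drop i).map letterVal).prod L.length = i := by
      intro i hi
      induction hi using Nat.decreasingInduction with
      | self => simp
      | of_succ i hi ih =>
        rw [List.drop_eq_getElem_cons hi, List.map_cons, List.prod_cons, map_mul,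
          Equiv.Perm.mul_apply, ih]
        exact key i _ (List.getElem?_eq_getElem hi)
    have h0 := this 0 (Nat.zero_le _)
    rw [List.drop_zero] at h0
    rw [h0]
    intro h
    have : L = [] := List.length_eq_zero_iff.1 h.symm
    subst this
    exact ha rfl

/-- The family of generators of the free product of two copies of a group. -/
abbrev pairGen {X A : Type} [Group A] (φ : X → A) : X ⊕ X → Coprod A A :=
  Sum.elim (fun x => Coprod.inl (φ x)) fun x => Coprod.inr (φ x)

/-- If no row is full, then the diagonal ceer does not reduce to the word problem of the free
square. -/
theorem not_reduces_square (hG : ∀ k c m n, m ≤ n → G k c n → G k c m)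
    (hr : ∀ k c, ∃ m, ¬ G k c m) :
    ¬ Reduces DiagCeer (WordProblem (pairGen fun x => (PresentedGroup.of x : NodeGroup G))) := by
  intro h
  obtain ⟨f, u₀, u₁, hf, hne, h0, h1⟩ := exists_of_reduces_diagCeer h
  set ν : Word (ℕ ⊕ ℕ) → Coprod (NodeGroup G) (NodeGroup G) := fun w =>
    FreeGroup.lift (pairGen fun x => (PresentedGroup.of x : NodeGroup G)) (FreeGroup.mk w) with hν
  obtain ⟨ρ, μ, n, hμ, hl, hr, hn⟩ := exists_action hG hr (a := (ν u₁)⁻¹ * ν u₀)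
    fun h => hne (inv_mul_eq_one.1 h).symm
  have hinv : ∀ x : ℕ, (PresentedGroup.of x : NodeGroup G)⁻¹ = PresentedGroup.of x := by
    intro x
    have : (PresentedGroup.of x : NodeGroup G) = nodeGen G (ofNat Node x) := by simp [nodeGen]
    rw [this, nodeGen_inv]
  have hw : ∀ w : Word (ℕ ⊕ ℕ), ρ (ν w) n = w.foldr (fun p m => μ p.1 m) n := by
    intro w
    rw [hν]
    dsimp only
    rw [FreeGroup.lift_mk]
    induction w with
    | nil => simp
    | cons p w ih =>
      rw [List.map_cons, List.prod_cons, map_mul, Equiv.Perm.mul_apply, ih, List.foldr_cons]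
      rcases p with ⟨x | x, b⟩
      · have : (cond b (pairGen (fun x => (PresentedGroup.of x : NodeGroup G)) (.inl x))
            (pairGen (fun x => (PresentedGroup.of x : NodeGroup G)) (.inl x))⁻¹) =
            Coprod.inl (PresentedGroup.of x) := by
          cases b
          · simp [← map_inv, hinv]
          · rfl
        rw [this, hl]
      · have : (cond b (pairGen (fun x => (PresentedGroup.of x : NodeGroup G)) (.inr x))
            (pairGen (fun x => (PresentedGroup.of x : NodeGroup G)) (.inr x))⁻¹) =
            Coprod.inr (PresentedGroup.of x) := by
          cases b
          · simp [← map_inv, hinv]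
          · rfl
        rw [this, hr]
  -- The images of `n` under `u₀` and `u₁` differ, so computing the image under `f z` tells the two
  -- halves of the diagonal pair apart.
  have hc : Primrec fun w : Word (ℕ ⊕ ℕ) => decide (w.foldr (fun p m => μ p.1 m) n = ρ (ν u₀) n) := by
    have : Primrec fun w : Word (ℕ ⊕ ℕ) => w.foldr (fun p m => μ p.1 m) n :=
      primrec_foldr Primrec.id (Primrec.const n) (hμ.comp (g := fun p : Word (ℕ ⊕ ℕ) × ((ℕ ⊕ ℕ) × Bool) × ℕ => (p.2.1.1, p.2.2))
          (by fun_prop))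
    fun_prop
  refine diag_inseparable (hc.to_comp.comp hf) (fun z hz => ?_) fun z hz => ?_
  · rw [← hw]
    exact decide_eq_true (by rw [show ν (f z) = ν u₀ from h0 z hz])
  · rw [← hw]
    refine decide_eq_false ?_
    rw [show ν (f z) = ν u₁ from h1 z hz]
    intro h
    apply hn
    rw [map_mul, map_inv, Equiv.Perm.mul_apply, ← h]
    exact Equiv.symm_apply_apply (ρ (ν u₁)) n

/-! ### The universal ceer in the free square -/

/-- The nonempty strictly decreasing lists with entries less than `n`. -/
def descLists : ℕ → List (List ℕ)
  | 0 => []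
  | n + 1 => descLists n ++ ([] :: descLists n).map fun l => n :: l

theorem primrec_descLists : Primrec descLists := by
  have : Primrec fun n : ℕ => Nat.rec (motive := fun _ => List (List ℕ)) []
      (fun n L => L ++ ([] :: L).map fun l => n :: l) n := by fun_prop
  refine this.of_eq fun n => ?_
  induction n with
  | zero => rfl
  | succ n ih => exact congrArg (fun L => L ++ ([] :: L).map fun l => n :: l) ih

theorem ne_nil_of_mem_descLists {n : ℕ} {l : List ℕ} (h : l ∈ descLists n) : l ≠ [] := by
  induction n with
  | zero => simp [descLists] at h
  | succ n ih =>
    rcases List.mem_append.1 h with h | h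
    · exact ih h
    · obtain ⟨m, -, rfl⟩ := List.mem_map.1 h
      simp

theorem lt_of_mem_descLists {n i : ℕ} {l : List ℕ} (h : l ∈ descLists n) (hi : i ∈ l) : i < n := by
  induction n generalizing l with
  | zero => simp [descLists] at h
  | succ n ih =>
    rcases List.mem_append.1 h with h | h
    · exact (ih h hi).trans (Nat.lt_succ_self n)
    · obtain ⟨m, hm, rfl⟩ := List.mem_map.1 h
      rcases List.mem_cons.1 hi with rfl | hi
      · exact Nat.lt_succ_self _
      · rcases List.mem_cons.1 hm with rfl | hm
        · cases hi
        · exact (ih hm hi).trans (Nat.lt_succ_self n)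

/-- The recursion of `descLists` adds the lists with head `n` as one block, so if only lists with
head `j` contribute, a single block remains. -/
theorem prod_descLists {M : Type} [Monoid M] (g : List ℕ → M) (j : ℕ)
    (hg : ∀ l, l.head? ≠ some j → g l = 1) (i : ℕ) : ((descLists i).map g).prod =
      if j < i then (([] :: descLists j).map fun l => g (j :: l)).prod else 1 := by
  induction i with
  | zero => simp [descLists]
  | succ n ih =>
    rw [descLists, List.map_append, List.prod_append, ih, List.map_map]
    rcases eq_or_ne n j with rfl | hn
    · rw [if_neg (lt_irrefl _), one_mul, if_pos (Nat.lt_succ_self _)]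
      rfl
    · have : (([] :: descLists n).map (g ∘ fun l => n :: l)).prod = 1 := by
        refine List.prod_eq_one fun x hx => ?_
        obtain ⟨l, -, rfl⟩ := List.mem_map.1 hx
        exact hg _ (by simpa using hn)
      rw [this, mul_one]
      have : j < n ↔ j < n + 1 := by omega
      simp only [this]

/-- The commutators attached to `i` and a list. -/
noncomputable def commElt (G : ℕ → ℕ → ℕ → Prop) (k : ℕ) (l : List ℕ) :
    Coprod (NodeGroup G) (NodeGroup G) :=
  ⁅(Coprod.inl (nodeGen G (k, 0, l)) : Coprod (NodeGroup G) (NodeGroup G)),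
    Coprod.inr (nodeGen G (k, 1, l))⁆

/-- The element of the free square attached to `i`. -/
noncomputable def commProd (G : ℕ → ℕ → ℕ → Prop) (k i : ℕ) :
    Coprod (NodeGroup G) (NodeGroup G) :=
  (([] :: descLists i).map fun l => commElt G k (i :: l)).prod

theorem nodeGen_eq_of_listNxt {k c : ℕ} (hc : c < 2) (hG : ∀ m, G k c m) {l m : List ℕ}
    (h : listNxt (decide (c = 1)) l = some m) : nodeGen G (k, c, l) = nodeGen G (k, c, m) :=
  nodeGen_eq (nodeForest_eq_some.2 ⟨hG _, m, by rw [rowNxt, if_pos hc, h], rfl⟩)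

/-- When `i` converges to `j`, a list `i :: l` with `l` not starting with `j` is killed in the
colour that is not kept, which trivializes its commutator. The lists `i :: j :: l` merge with `j ::
l` in both colours, and since `j < i` their tails run through exactly the lists used for `j`. -/
theorem commProd_par {k : ℕ} (h0 : ∀ m, G k 0 m) (h1 : ∀ m, G k 1 m) {i j : ℕ}
    (hij : par i = some j) : commProd G k i = commProd G k j := by
  obtain ⟨s, hs⟩ := par_eq_some.1 hij
  have hne : ∀ l : List ℕ, l.head? ≠ some j → commElt G k (i :: l) = 1 := by
    intro l hl
    have h : ∀ c, kept s i ≠ decide (c = 1) →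
        listNxt (decide (c = 1)) (i :: l) = some [] := fun c hc =>
      listNxt_eq_some.2 ⟨s, by simp [listS, hs, hl, hc]⟩
    rw [commElt]
    cases hk : kept s i
    · rw [nodeGen_eq_of_listNxt (c := 1) (by norm_num) h1 (h 1 (by simp [hk])), nodeGen_nil (x := (k, 1, [])) rfl,
        map_one, commutatorElement_one_right]
    · rw [nodeGen_eq_of_listNxt (c := 0) (by norm_num) h0 (h 0 (by simp [hk])), nodeGen_nil (x := (k, 0, [])) rfl,
        map_one, commutatorElement_one_left]
  have heq : ∀ l : List ℕ, commElt G k (i :: j :: l) = commElt G k (j :: l) := by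
    intro l
    have h : ∀ b, listNxt b (i :: j :: l) = some (j :: l) := fun b =>
      listNxt_eq_some.2 ⟨s, by simp [listS, hs]⟩
    rw [commElt, commElt, nodeGen_eq_of_listNxt (by norm_num) h0 (h _),
      nodeGen_eq_of_listNxt (by norm_num) h1 (h _)]
  rw [commProd, List.map_cons, List.prod_cons, hne [] (by simp), one_mul,
    prod_descLists (fun l => commElt G k (i :: l)) j hne i, if_pos (parS_lt hs)]
  simp only [heq]
  rfl

theorem listForest_root_of_par_none {b : Bool} {i : ℕ} (h : par i = none) (l : List ℕ) :
    (listForest b).root (i :: l) = i :: l := by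
  refine Forest.root_of_none (F := listForest b) ?_
  by_contra hn
  obtain ⟨y, hy⟩ := Option.ne_none_iff_exists'.1 hn
  obtain ⟨s, hs⟩ := listNxt_eq_some.1 hy
  simp [listS, parS_of_par_none h] at hs

theorem notMem_listForest_root {b : Bool} {i : ℕ} {l : List ℕ} (h : i ∉ l) :
    i ∉ (listForest b).root l := by
  induction l using Forest.induction (F := listForest b) with
  | h0 l hl => rwa [Forest.root_of_none hl]
  | h1 l m hlm ih =>
    rw [Forest.root_of_some hlm]
    apply ih
    obtain ⟨s, hs⟩ := listNxt_eq_some.1 hlm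
    obtain ⟨a, l', j, rfl, -, ⟨-, rfl⟩ | ⟨-, -, rfl⟩⟩ := listS_cases hs
    · exact fun h' => h (List.mem_cons_of_mem _ h')
    · simp

theorem exists_hom_coord {H : Type} [Group H] (τ : H) (hτ : τ * τ = 1) {y : Node}
    (hy : y.2.2 ≠ []) : ∃ θ : NodeGroup G →* H, ∀ x, θ (nodeGen G x) =
      if coord G y x then τ else 1 := by
  have hf := isFunctional_coord (G := G) hy
  refine exists_hom _ (fun x hx => by simp [hf.nil x hx]) (fun x => ?_) (fun x z => ?_)
    fun x z hxz => by rw [hf.nxt x z hxz]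
  · split_ifs
    · exact hτ
    · exact one_mul 1
  · split_ifs <;> simp

/-- Distinct roots of the universal forest give distinct elements of the free square. -/
theorem commProd_ne {k : ℕ} (h0 : ∀ m, G k 0 m) (h1 : ∀ m, G k 1 m) {i j : ℕ} (hji : j < i)
    (hi : par i = none) : commProd G k j ≠ commProd G k i := by
  -- The coordinates of `[i]` in the two colours are sent to two noncommuting transpositions of
  -- three points, one for each factor.
  obtain ⟨θ, hθ⟩ := exists_hom_coord (G := G) (Equiv.swap (0 : Fin 3) 1) (by decide)
    (y := (k, 0, [i])) (by simp)
  obtain ⟨η, hη⟩ := exists_hom_coord (G := G) (Equiv.swap (1 : Fin 3) 2) (by decide)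
    (y := (k, 1, [i])) (by simp)
  have hc : ∀ (c : ℕ) (hc : c < 2) (hG : ∀ m, G k c m) (l), coord G (k, c, [i]) (k, c, l) =
      decide ((listForest (decide (c = 1))).root l = [i]) := by
    intro c hc hG l
    simp [coord, root_full hc hG]
  have hz : ∀ l, (∀ c, c < 2 → (listForest (decide (c = 1))).root l ≠ [i]) →
      Coprod.lift θ η (commElt G k l) = 1 := by
    intro l hl
    rw [commElt, map_commutatorElement, Coprod.lift_apply_inl, Coprod.lift_apply_inr, hθ,
      hc 0 (by norm_num) h0, decide_eq_false (hl 0 (by norm_num))]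
    simp
  intro he
  have e1 : Coprod.lift θ η (commProd G k j) = 1 := by
    rw [commProd, map_list_prod, List.map_map]
    refine List.prod_eq_one fun x hx => ?_
    obtain ⟨l, hl, rfl⟩ := List.mem_map.1 hx
    refine hz _ fun c _ h => ?_
    have : i ∉ j :: l := by
      intro hm
      rcases List.mem_cons.1 hm with rfl | hm
      · exact lt_irrefl _ hji
      · rcases List.mem_cons.1 hl with rfl | hl
        · cases hm
        · exact absurd ((lt_of_mem_descLists hl hm).trans hji) (lt_irrefl _)
    exact notMem_listForest_root this (by rw [h]; simp)
  -- As `i` never converges, all lists `i :: l` are roots, and only `[i]` itself has a nonzero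
  -- coordinate. In `e1` no list contains `i`, so neither does its root.
  have e2 : Coprod.lift θ η (commProd G k i) = ⁅Equiv.swap (0 : Fin 3) 1, Equiv.swap 1 2⁆ := by
    rw [commProd, map_list_prod, List.map_map, List.map_cons, List.prod_cons, List.prod_eq_one,
      mul_one]
    · rw [Function.comp, commElt, map_commutatorElement, Coprod.lift_apply_inl,
        Coprod.lift_apply_inr, hθ, hη, hc 0 (by norm_num) h0, hc 1 (by norm_num) h1,
        listForest_root_of_par_none hi, listForest_root_of_par_none hi]
      simp
    · intro x hx
      obtain ⟨l, hl, rfl⟩ := List.mem_map.1 hx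
      refine hz _ fun c _ h => ?_
      rw [listForest_root_of_par_none hi] at h
      exact ne_nil_of_mem_descLists hl (List.cons.inj h).2
  rw [he, e2] at e1
  exact absurd e1 (by decide)

/-- The word attached to `i`. -/
def commWord (k i : ℕ) : Word (ℕ ⊕ ℕ) :=
  ([] :: descLists i).flatMap fun l =>
    [(.inl (encode ((k, 0, i :: l) : Node)), true), (.inr (encode ((k, 1, i :: l) : Node)), true),
      (.inl (encode ((k, 0, i :: l) : Node)), false), (.inr (encode ((k, 1, i :: l) : Node)), false)]

theorem lift_commWord (k i : ℕ) :
    FreeGroup.lift (pairGen fun x => (PresentedGroup.of x : NodeGroup G))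
      (FreeGroup.mk (commWord k i)) = commProd G k i := by
  rw [FreeGroup.lift_mk, commWord, commProd]
  induction ([] :: descLists i) with
  | nil => simp
  | cons l L ih =>
    rw [List.flatMap_cons, List.map_append, List.prod_append, ih, List.map_cons, List.prod_cons]
    congr 1

/-- If the rows `k` of colours `0` and `1` are full, then the word problem of the free square is
universal. -/
theorem reduces_square {k : ℕ} (h0 : ∀ m, G k 0 m) (h1 : ∀ m, G k 1 m) :
    Reduces RInf (WordProblem (pairGen fun x => (PresentedGroup.of x : NodeGroup G))) := by
  refine ⟨commWord k, Primrec.to_comp ?_, fun i j => ?_⟩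
  · have := primrec_descLists
    have h : Primrec fun i : ℕ => descLists i := this
    have hl : Primrec fun i : ℕ => (Sum.inl i : ℕ ⊕ ℕ) := Primrec.sumInl
    have hr : Primrec fun i : ℕ => (Sum.inr i : ℕ ⊕ ℕ) := Primrec.sumInr
    have h3 : Primrec fun p : ℕ × List ℕ =>
        (Sum.inl (encode ((k, 0, p.1 :: p.2) : Node)) : ℕ ⊕ ℕ) :=
      hl.comp (Primrec.encode.comp (by fun_prop))
    have h4 : Primrec fun p : ℕ × List ℕ =>
        (Sum.inr (encode ((k, 1, p.1 :: p.2) : Node)) : ℕ ⊕ ℕ) :=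
      hr.comp (Primrec.encode.comp (by fun_prop))
    unfold commWord
    fun_prop
  · rw [WordProblem, lift_commWord, lift_commWord]
    have hroot : ∀ i, commProd G k (parForest.root i) = commProd G k i :=
      Forest.apply_root (F := parForest) fun i j hij => commProd_par h0 h1 hij
    constructor
    · intro h
      rw [RInf] at h
      rw [← hroot i, ← hroot j, h]
    · intro h
      rw [← hroot i, ← hroot j] at h
      rw [RInf]
      by_contra hne
      rcases Nat.lt_or_gt_of_ne hne with hlt | hlt
      · exact commProd_ne h0 h1 hlt (parForest.nxt_root j) h
      · exact commProd_ne h0 h1 hlt (parForest.nxt_root i) h.symm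

/-! ### The free square inside other free products -/

section Embedding

variable {A B : Type} [Group A] [Group B]

/-- Alternating products are nontrivial. -/
theorem Alternating.prod_ne_one {L : List (A ⊕ B)} (hL : Alternating L) (hne : L ≠ []) :
    (L.map letterVal).prod ≠ 1 := by
  classical
  -- The binary free product is mapped to an indexed one, where reduced words are known to represent
  -- distinct elements.
  let M : Bool → Type := fun b => match b with
    | true => A
    | false => B
  let _ : ∀ b, Group (M b) := fun b => match b with
    | true => (inferInstance : Group A)
    | false => (inferInstance : Group B)
  let η : Coprod A B →* CoprodI M :=
    Coprod.lift (CoprodI.of (M := M) (i := true)) (CoprodI.of (M := M) (i := false))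
  let σ : A ⊕ B → Σ b, M b := Sum.elim (fun a => ⟨true, a⟩) fun b => ⟨false, b⟩
  let W : CoprodI.Word M := ⟨L.map σ, by
      intro l hl
      obtain ⟨g, hg, rfl⟩ := List.mem_map.1 hl
      have := hL.ne_one g hg
      rcases g with g | g <;> exact this, by
      rw [List.isChain_map]
      refine hL.isChain.imp fun g g' h => ?_
      rcases g with g | g <;> rcases g' with g' | g' <;> simp_all [σ]⟩
  have hW : η (L.map letterVal).prod = W.prod := by
    rw [map_list_prod, List.map_map, CoprodI.Word.prod, List.map_map]
    congr 1
    refine List.map_congr_left fun g _ => ?_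
    rcases g with g | g <;> rfl
  intro h
  rw [h, map_one] at hW
  have : W = CoprodI.Word.empty := CoprodI.Word.equiv.symm.injective
    (hW.symm.trans CoprodI.Word.prod_empty.symm)
  exact hne (List.map_eq_nil_iff.1 (congrArg CoprodI.Word.toList this))

/-- The homomorphism from the free square conjugating the second factor by `h`. -/
def conjHom (A : Type) [Group A] (h : B) : Coprod A A →* Coprod A B :=
  Coprod.lift Coprod.inl ((MulAut.conj (Coprod.inr h)).toMonoidHom.comp Coprod.inl)

/-- The letters of the image of a letter under `conjHom`. -/
def conjLetters (h : B) : A ⊕ A → List (A ⊕ B) :=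
  Sum.elim (fun x => [.inl x]) fun x => [.inr h, .inl x, .inr h⁻¹]

theorem prod_conjLetters (h : B) (L : List (A ⊕ A)) :
    ((L.flatMap (conjLetters h)).map letterVal).prod = conjHom A h (L.map letterVal).prod := by
  induction L with
  | nil => simp
  | cons g L ih =>
    rw [List.flatMap_cons, List.map_append, List.prod_append, ih, List.map_cons, List.prod_cons,
      map_mul]
    congr 1
    rcases g with g | g <;> simp [conjLetters, letterVal, conjHom, mul_assoc]

/-- A right letter `g` becomes `h g h⁻¹`, which alternates and has letters of `B` at both ends; a
left letter stays in `A`. Outer sides are preserved, so neighbouring blocks still alternate without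
cancellation. -/
theorem alternating_conjLetters {h : B} (hh : h ≠ 1) {L : List (A ⊕ A)} (hL : Alternating L) :
    Alternating (L.flatMap (conjLetters h)) := by
  induction L with
  | nil => exact ⟨by simp, .nil⟩
  | cons g L ih =>
    have ih := ih hL.tail
    have hg := hL.ne_one g (by simp)
    refine ⟨?_, ?_⟩
    · intro x hx
      rw [List.flatMap_cons] at hx
      rcases List.mem_append.1 hx with hx | hx
      · rcases g with g | g
        · simp only [conjLetters, Sum.elim_inl, List.mem_singleton] at hx
          subst hx
          exact hg
        · simp only [conjLetters, Sum.elim_inr, List.mem_cons, List.not_mem_nil, or_false] at hx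
          rcases hx with rfl | rfl | rfl
          · exact hh
          · exact hg
          · exact inv_ne_one.2 hh
      · exact ih.ne_one x hx
    · rw [List.flatMap_cons, List.isChain_append]
      refine ⟨?_, ih.isChain, ?_⟩
      · rcases g with g | g <;> simp [conjLetters]
      · intro x hx y hy
        have hxg : x.isLeft = g.isLeft := by
          rcases g with g | g <;> simp [conjLetters] at hx <;> subst hx <;> rfl
        rcases L with _ | ⟨g', L⟩
        · simp at hy
        · have hyg : y.isLeft = g'.isLeft := by
            rw [List.flatMap_cons] at hy
            rcases g' with g' | g' <;> simp [conjLetters] at hy <;> subst hy <;> rfl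
          rw [hxg, hyg]
          exact (List.isChain_cons_cons.1 hL.isChain).1

theorem conjHom_injective {h : B} (hh : h ≠ 1) : Function.Injective (conjHom A h) := by
  rw [injective_iff_map_eq_one]
  intro a ha
  obtain ⟨L, hL, rfl⟩ := exists_alternating a
  by_contra hne
  have hL0 : L ≠ [] := by
    rintro rfl
    exact hne rfl
  refine (alternating_conjLetters hh hL).prod_ne_one ?_ ((prod_conjLetters h L).trans ha)
  obtain ⟨g, L, rfl⟩ := List.exists_cons_of_ne_nil hL0
  rcases g with g | g <;> simp [conjLetters]

/-- The inverse word. -/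
def invWord {X : Type} (w : Word X) : Word X := (w.map fun p => (p.1, !p.2)).reverse

theorem mk_invWord {X : Type} (w : Word X) : FreeGroup.mk (invWord w) = (FreeGroup.mk w)⁻¹ :=
  FreeGroup.inv_mk.symm

@[fun_prop]
theorem primrec_invWord {α X : Type} [Primcodable α] [Primcodable X] {f : α → Word X}
    (hf : Primrec f) : Primrec fun a => invWord (f a) := by
  have h : Primrec fun b : Bool => !b := Primrec.not
  have : Primrec fun p : α × X × Bool => (p.2.1, !p.2.2) :=
    Primrec.pair (by fun_prop) (h.comp (by fun_prop))
  exact Primrec.list_reverse.comp (primrec_map hf this)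

/-- The word problem of the free square reduces to that of the free product with any group having
a nontrivial element represented by a word. -/
theorem reduces_coprod {X Y : Type} [Primcodable X] [Primcodable Y] (φ : X → A) (ψ : Y → B)
    {w : Word Y} (hw : FreeGroup.lift ψ (FreeGroup.mk w) ≠ 1) :
    Reduces (WordProblem (pairGen φ)) (WordProblem
      (Sum.elim (fun x => Coprod.inl (φ x)) fun y => Coprod.inr (ψ y) : X ⊕ Y → Coprod A B)) := by
  set Φ : X ⊕ Y → Coprod A B := Sum.elim (fun x => Coprod.inl (φ x)) fun y => Coprod.inr (ψ y)
  set h := FreeGroup.lift ψ (FreeGroup.mk w) with hh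
  let w' : Word (X ⊕ Y) := w.map fun p => (.inr p.1, p.2)
  -- The exponent passes to the middle letter only, since conjugation commutes with inversion.
  let f : (X ⊕ X) × Bool → Word (X ⊕ Y) := fun p => Sum.elim (fun x => [(.inl x, p.2)])
    (fun x => w' ++ ([(.inl x, p.2)] ++ invWord w')) p.1
  have hw' : FreeGroup.lift Φ (FreeGroup.mk w') = Coprod.inr h := by
    rw [hh, FreeGroup.lift_mk, FreeGroup.lift_mk, map_list_prod, List.map_map, List.map_map]
    congr 1
    refine List.map_congr_left fun p _ => ?_
    rcases p with ⟨y, _ | _⟩ <;> simp [Φ]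
  have hf : Primrec f := by
    have hl : Primrec fun x : X => (.inl x : X ⊕ Y) := Primrec.sumInl
    have h1 : Primrec fun q : ((X ⊕ X) × Bool) × X => (.inl q.2 : X ⊕ Y) :=
      hl.comp Primrec.snd
    have h2 : Primrec fun q : ((X ⊕ X) × Bool) × X => ((.inl q.2 : X ⊕ Y), q.1.2) :=
      h1.pair (by fun_prop)
    exact primrec_sum_elim Primrec.fst (by fun_prop) (by fun_prop)
  have key : ∀ u : Word (X ⊕ X), FreeGroup.lift Φ (FreeGroup.mk (u.flatMap f)) =
      conjHom A h (FreeGroup.lift (pairGen φ) (FreeGroup.mk u)) := by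
    intro u
    induction u with
    | nil => simp [← FreeGroup.one_eq_mk]
    | cons p u ih =>
      have e : ∀ (Z : Type) (a b : Word Z), FreeGroup.mk (a ++ b) =
          FreeGroup.mk a * FreeGroup.mk b := fun _ _ _ => FreeGroup.mul_mk.symm
      rw [List.flatMap_cons, e, map_mul, ih, ← List.singleton_append, e, map_mul, map_mul]
      congr 1
      rcases p with ⟨x | x, b⟩
      · cases b <;> simp [f, Φ, conjHom]
      · simp only [f, Sum.elim_inr]
        rw [e, e, map_mul, map_mul, mk_invWord, map_inv, hw']
        cases b <;> simp [Φ, conjHom, mul_assoc]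
  refine ⟨fun u => u.flatMap f, Primrec.to_comp ?_, fun u v => ?_⟩
  · exact primrec_flatMap Primrec.id (hf.comp Primrec.snd)
  · rw [WordProblem, WordProblem, key, key, (conjHom_injective hw).eq_iff]

end Embedding

/-! ### A group of order two -/

theorem lift_sign {X : Type} (w : Word X) :
    FreeGroup.lift (fun _ => (-1 : ℤˣ)) (FreeGroup.mk w) = (-1) ^ w.length := by
  rw [FreeGroup.lift_mk]
  induction w with
  | nil => simp
  | cons p w ih =>
    rw [List.map_cons, List.prod_cons, ih, List.length_cons, pow_succ']
    congr 1
    cases p.2 <;> simp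

/-- One generator with all words of even length as relators gives a group of order two. It shows
that the trivial group is not `*`-universal. -/
theorem exists_finite_nontrivial : ∃ Q : RecPres, Nontrivial (RecPres.group Q) ∧
    Finite (RecPres.group Q) := by
  have hp : REPred fun p : Unit × Word (Gen (some 1)) => decide (p.2.length % 2 = 0) = true := by
    refine re_of_bool (Primrec.to_comp ?_)
    have : Primrec fun p : Unit × Word (Gen (some 1)) => p.2.length :=
      Primrec.list_length.comp Primrec.snd
    fun_prop
  obtain ⟨c, -, hc⟩ := exists_code_family hp
  refine ⟨(some 1, c ()), ?_, ?_⟩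
  · have h : ∀ r ∈ FreeGroup.mk '' RecPres.relators (some 1, c ()),
        FreeGroup.lift (fun _ => (-1 : ℤˣ)) r = 1 := by
      rintro _ ⟨r, hr, rfl⟩
      rw [lift_sign]
      have := of_decide_eq_true ((hc () r).1 hr)
      exact (Nat.even_iff.2 this).neg_one_pow
    let x : RecPres.X (some 1, c ()) := (0 : Fin 1)
    refine ⟨PresentedGroup.of x, 1, fun he => ?_⟩
    have := congrArg (PresentedGroup.toGroup h) he
    rw [PresentedGroup.toGroup.of, map_one] at this
    exact absurd this (by decide)
  · let S : Bool → RecPres.group (some 1, c ()) := fun b =>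
      PresentedGroup.mk _ (FreeGroup.mk (cond b [] [((0 : Fin 1), true)]))
    refine Finite.of_surjective S fun g => ?_
    obtain ⟨x, rfl⟩ := PresentedGroup.mk_surjective _ g
    obtain ⟨v, rfl⟩ : ∃ v, FreeGroup.mk v = x := Quot.exists_rep x
    refine ⟨decide (v.length % 2 = 0), ?_⟩
    have hr : ∀ u : Word (Gen (some 1)), u.length % 2 = 0 → (PresentedGroup.mk
        (FreeGroup.mk '' RecPres.relators (some 1, c ())) (FreeGroup.mk u)) = 1 := fun u hu =>
      PresentedGroup.one_of_mem ⟨u, (hc () u).2 (decide_eq_true hu), rfl⟩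
    have hx : ∀ u : Word (Gen (some 1)), (u.length + v.length) % 2 = 0 →
        (PresentedGroup.mk (FreeGroup.mk '' RecPres.relators (some 1, c ())) (FreeGroup.mk u)) =
          PresentedGroup.mk _ (FreeGroup.mk v) := by
      intro u hu
      have := hr (u ++ invWord v) (by simpa [invWord] using hu)
      rw [← FreeGroup.mul_mk, mk_invWord, map_mul, map_inv,
        mul_inv_eq_one] at this
      exact this
    refine hx _ ?_
    rcases Nat.mod_two_eq_zero_or_one v.length with h | h <;> simp [h, Nat.add_mod]

/-! ### Word problems are uniformly computably enumerable -/

section FreeReduction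

variable {α Y : Type}

/-- One step of free reduction. -/
def reduceStep [DecidableEq Y] (p : Y × Bool) (w : Word Y) : Word Y :=
  w.head?.elim [p] fun q => bif decide (p.1 = q.1) && decide (q.2 = !p.2) then w.tail else p :: w

theorem reduce_eq_foldr [DecidableEq Y] (w : Word Y) :
    FreeGroup.reduce w = w.foldr reduceStep [] := by
  induction w with
  | nil => rfl
  | cons p w ih =>
    rw [FreeGroup.reduce.cons, List.foldr_cons, ← ih]
    cases FreeGroup.reduce w with
    | nil => rfl
    | cons q v =>
      have h : (p.2 = !q.2) ↔ (q.2 = !p.2) := by cases p.2 <;> cases q.2 <;> simp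
      by_cases h1 : p.1 = q.1 <;> by_cases h2 : q.2 = !p.2 <;> simp [reduceStep, h1, h2, h]

/-- The product of conjugates of relators and their inverses, as a word. -/
def conjProd (L : List (Word Y × Word Y × Bool)) : Word Y :=
  L.flatMap fun t => t.1 ++ ((bif t.2.2 then t.2.1 else invWord t.2.1) ++ invWord t.1)

/-- A normal closure consists of the products of conjugates of relators and their inverses. Listing
such products makes triviality a search, with equality in the free group decided by reduction. -/
theorem mk_eq_one_iff {S : Set (Word Y)} {w : Word Y} :
    PresentedGroup.mk (FreeGroup.mk '' S) (FreeGroup.mk w) = 1 ↔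
      ∃ L : List (Word Y × Word Y × Bool), (∀ t ∈ L, t.2.1 ∈ S) ∧
        FreeGroup.mk (conjProd L) = FreeGroup.mk w := by
  have e : ∀ a b : Word Y, FreeGroup.mk (a ++ b) = FreeGroup.mk a * FreeGroup.mk b :=
    fun _ _ => FreeGroup.mul_mk.symm
  have hc : ∀ (t : Word Y × Word Y × Bool) L, FreeGroup.mk (conjProd (t :: L)) =
      FreeGroup.mk t.1 * (cond t.2.2 (FreeGroup.mk t.2.1) (FreeGroup.mk t.2.1)⁻¹ *
        (FreeGroup.mk t.1)⁻¹) * FreeGroup.mk (conjProd L) := by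
    rintro ⟨a, r, b⟩ L
    rw [conjProd, List.flatMap_cons, e, e, e, mk_invWord]
    cases b <;> simp [mk_invWord, conjProd]
  constructor
  · intro h
    have h' : FreeGroup.mk w ∈ Subgroup.normalClosure (FreeGroup.mk '' S) :=
      (QuotientGroup.eq_one_iff _).1 h
    have key : ∀ (b : Bool) (y x : FreeGroup Y), y ∈ Group.conjugatesOfSet (FreeGroup.mk '' S) →
        (∃ L : List (Word Y × Word Y × Bool), (∀ t ∈ L, t.2.1 ∈ S) ∧
          FreeGroup.mk (conjProd L) = x) →
        ∃ L : List (Word Y × Word Y × Bool), (∀ t ∈ L, t.2.1 ∈ S) ∧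
          FreeGroup.mk (conjProd L) = cond b y y⁻¹ * x := by
      rintro b y _ hy ⟨L, hL, rfl⟩
      obtain ⟨_, ⟨r, hr, rfl⟩, hg⟩ := Group.mem_conjugatesOfSet_iff.1 hy
      obtain ⟨c, rfl⟩ := isConj_iff.1 hg
      obtain ⟨v, rfl⟩ : ∃ v, FreeGroup.mk v = c := Quot.exists_rep c
      refine ⟨(v, r, b) :: L, ?_, ?_⟩
      · intro t ht
        rcases List.mem_cons.1 ht with rfl | ht
        · exact hr
        · exact hL t ht
      · rw [hc]
        cases b <;> simp only [cond_true, cond_false, mul_inv_rev, inv_inv, mul_assoc]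
    generalize FreeGroup.mk w = g at h'
    induction h' using Subgroup.closure_induction_left with
    | one => exact ⟨[], by simp, rfl⟩
    | mul_left y hy x _ ih => exact key true y x hy ih
    | inv_mul_cancel y hy x _ ih => exact key false y x hy ih
  · rintro ⟨L, hL, hw⟩
    rw [← hw]
    clear hw
    induction L with
    | nil => exact map_one _
    | cons t L ih =>
      have h1 : PresentedGroup.mk (FreeGroup.mk '' S) (FreeGroup.mk t.2.1) = 1 :=
        PresentedGroup.one_of_mem ⟨_, hL t (by simp), rfl⟩
      rw [hc, map_mul, ih fun s hs => hL s (List.mem_cons_of_mem _ hs), map_mul, map_mul, mul_one]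
      cases t.2.2 <;> simp only [cond_true, cond_false, map_inv, h1, inv_one, one_mul,
        mul_inv_cancel]

variable [Primcodable α] [Primcodable Y]

theorem primrec_reduce [DecidableEq Y] {f : α → Word Y} (hf : Primrec f) :
    Primrec fun a => FreeGroup.reduce (f a) := by
  have hs : Primrec fun x : α × (Y × Bool) × Word Y => reduceStep x.2.1 x.2.2 := by
    have ht : Primrec fun y : (α × (Y × Bool) × Word Y) × Y × Bool => y.1.2.2.tail :=
      Primrec.list_tail.comp (by fun_prop)
    have hh : Primrec fun x : α × (Y × Bool) × Word Y => x.2.2.head? :=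
      Primrec.list_head?.comp (by fun_prop)
    have hn : Primrec fun y : (α × (Y × Bool) × Word Y) × Y × Bool => !y.1.2.1.2 :=
      Primrec.not.comp (by fun_prop)
    unfold reduceStep
    fun_prop
  exact (primrec_foldr hf (Primrec.const []) hs).of_eq fun a => (reduce_eq_foldr _).symm

theorem re_mk_eq {f g : α → Word Y} (hf : Primrec f) (hg : Primrec g) :
    REPred fun a => FreeGroup.mk (f a) = FreeGroup.mk (g a) := by
  classical
  have h1 := primrec_reduce hf
  have h2 := primrec_reduce hg
  refine (re_of_bool (T := fun a => decide (FreeGroup.reduce (f a) = FreeGroup.reduce (g a)))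
    (Primrec.to_comp (by fun_prop))).of_eq fun a => ?_
  rw [decide_eq_true_eq]
  exact ⟨FreeGroup.reduce.exact, FreeGroup.reduce.sound⟩

theorem re_presented_eq {R : α → Set (Word Y)} (hR : REPred fun p : α × Word Y => p.2 ∈ R p.1) :
    REPred fun p : α × Word Y × Word Y =>
      PresentedGroup.mk (FreeGroup.mk '' R p.1) (FreeGroup.mk p.2.1) =
        PresentedGroup.mk (FreeGroup.mk '' R p.1) (FreeGroup.mk p.2.2) := by
  have h1 : REPred fun x : (α × Word Y × Word Y) × List (Word Y × Word Y × Bool) =>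
      ∀ t ∈ x.2, t.2.1 ∈ R x.1.1 :=
    re_forall_mem (p := fun y : (α × Word Y × Word Y) × Word Y × Word Y × Bool =>
      y.2.2.1 ∈ R y.1.1) (re_comp (f := fun y : (α × Word Y × Word Y) × Word Y × Word Y × Bool =>
        (y.1.1, y.2.2.1)) hR (Primrec.to_comp (by fun_prop)))
  have h2 : REPred fun x : (α × Word Y × Word Y) × List (Word Y × Word Y × Bool) =>
      FreeGroup.mk (conjProd x.2) = FreeGroup.mk (x.1.2.1 ++ invWord x.1.2.2) := by
    refine re_mk_eq ?_ (by fun_prop)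
    unfold conjProd
    fun_prop
  refine (re_exists (re_and h1 h2)).of_eq fun p => ?_
  rw [← mul_inv_eq_one, ← map_inv, ← map_mul, ← mk_invWord, FreeGroup.mul_mk, mk_eq_one_iff]

end FreeReduction

/-- The word obtained by renaming the letters. -/
def wordMap {X Y : Type} (ε : X → Y) (w : Word X) : Word Y := w.map fun p => (ε p.1, p.2)

theorem lift_wordMap {X Y H : Type} [Group H] (ε : X → Y) (f : Y → H) (w : Word X) :
    FreeGroup.lift f (FreeGroup.mk (wordMap ε w)) =
      FreeGroup.lift (fun x => f (ε x)) (FreeGroup.mk w) := by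
  rw [FreeGroup.lift_mk, FreeGroup.lift_mk, wordMap, List.map_map]
  rfl

theorem encode_wordMap {X Y : Type} [Primcodable X] [Primcodable Y] {ε : X → Y}
    (hε : ∀ x, encode (ε x) = encode x) (w : Word X) : encode (wordMap ε w) = encode w := by
  induction w with
  | nil => rfl
  | cons p w ih =>
    change encode ((ε p.1, p.2) :: wordMap ε w) = _
    rw [encode_list_cons, encode_list_cons, ih, encode_prod_val, encode_prod_val, hε]

theorem exists_wordMap {X Y : Type} {ε : X → Y} {z : Word Y} :
    (∃ w, wordMap ε w = z) ↔ ∀ p ∈ z, ∃ x, ε x = p.1 := by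
  constructor
  · rintro ⟨w, rfl⟩ p hp
    obtain ⟨q, -, rfl⟩ := List.mem_map.1 hp
    exact ⟨q.1, rfl⟩
  · intro h
    induction z with
    | nil => exact ⟨[], rfl⟩
    | cons p z ih =>
      obtain ⟨w, rfl⟩ := ih fun q hq => h q (List.mem_cons_of_mem _ hq)
      obtain ⟨x, hx⟩ := h p (by simp)
      exact ⟨(x, p.2) :: w, by simp [wordMap, hx]⟩

theorem lift_of {Y : Type} (S : Set (FreeGroup Y)) (w : FreeGroup Y) :
    FreeGroup.lift (fun y => (PresentedGroup.of y : PresentedGroup S)) w =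
      PresentedGroup.mk S w := by
  have : FreeGroup.lift (fun y => (PresentedGroup.of y : PresentedGroup S)) =
      PresentedGroup.mk S := by
    ext x
    simp [PresentedGroup.of]
  rw [this]

/-! ### `Σ⁰₃` predicates -/

section Sigma

variable {α β : Type} [Primcodable α] [Primcodable β]

theorem isSigma03_of_re {q : (α × ℕ) × ℕ → Prop} (hq : REPred q) :
    IsSigma03 fun a => ∃ x, ∀ y, q ((a, x), y) := by
  obtain ⟨T, hT, -, iT⟩ := exists_stage hq
  refine ⟨fun p => T ((p.1, p.2.1), p.2.2.1) p.2.2.2 = true, ⟨inferInstance, ?_⟩, fun a => ?_⟩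
  · have : Primrec fun p : α × ℕ × ℕ × ℕ => T ((p.1, p.2.1), p.2.2.1) p.2.2.2 :=
      hT.comp (g := fun p : α × ℕ × ℕ × ℕ => (((p.1, p.2.1), p.2.2.1), p.2.2.2)) (by fun_prop)
    exact this.to_comp.of_eq fun p => by simp
  · simp only [iT]

theorem IsSigma03.comp {p : β → Prop} (hp : IsSigma03 p) {f : α → β} (hf : Computable f) :
    IsSigma03 fun a => p (f a) := by
  obtain ⟨R, hR, h⟩ := hp
  obtain ⟨g, hg, rfl⟩ := ComputablePred.computable_iff.1 hR
  refine ⟨fun x => g (f x.1, x.2) = true, ComputablePred.computable_iff.2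
    ⟨fun x => g (f x.1, x.2), hg.comp ((hf.comp Computable.fst).pair Computable.snd), rfl⟩,
    fun a => h (f a)⟩

theorem re_mem_eval : REPred fun p : ℕ × ℕ × ℕ =>
    p.2.2 ∈ (ofNat Nat.Partrec.Code p.1).eval p.2.1 := by
  refine (re_of_stage (T := fun (p : ℕ × ℕ × ℕ) t => decide
    (Nat.Partrec.Code.evaln t (ofNat Nat.Partrec.Code p.1) p.2.1 = some p.2.2))
    (Primrec.to_comp ?_)).of_eq fun p => ?_
  · have : Primrec fun x : (ℕ × ℕ × ℕ) × ℕ => some x.1.2.2 := Primrec.option_some.comp (by fun_prop)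
    fun_prop
  · simp only [decide_eq_true_eq]
    exact Nat.Partrec.Code.evaln_complete.symm

theorem re_imp_of_stage {T : α → ℕ → Bool} (hT : Primrec fun x : α × ℕ => T x.1 x.2)
    {p : β → Prop} (hp : REPred p) {γ : Type} [Primcodable γ] {f : γ → α × ℕ} {g : γ → β}
    (hf : Primrec f) (hg : Primrec g) :
    REPred fun c => T (f c).1 (f c).2 = true → p (g c) := by
  have h : Primrec fun c => T (f c).1 (f c).2 := hT.comp hf
  refine (re_or (re_of_bool (T := fun c => decide (T (f c).1 (f c).2 = false))
    (Primrec.to_comp (by fun_prop))) (re_comp hp hg.to_comp)).of_eq fun c => ?_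
  cases T (f c).1 (f c).2 <;> simp

/-- Reducibility of a ceer to the members of a uniformly computably enumerable family is `Σ⁰₃`. -/
theorem isSigma03_reduces {B : α → Type} [∀ a, Primcodable (B a)] (E : ∀ a, B a → B a → Prop)
    (ι : ∀ a, B a → β) (hι : ∀ a w, encode (ι a w) = encode w)
    (hV : REPred fun p : α × β => ∃ w, ι p.1 w = p.2) {W : α × β × β → Prop} (hW : REPred W)
    (hE : ∀ a u v, E a u v ↔ W (a, ι a u, ι a v)) : IsSigma03 fun a => Reduces RInf (E a) := by
  obtain ⟨T, hT, -, iT⟩ := exists_stage re_rInf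
  obtain ⟨S, hS, -, iS⟩ := exists_stage hW
  -- The outer number is the program and the next one codes `⟨x, ⟨y, t⟩⟩`. The program must output
  -- codes of genuine words on `x` and `y`, and every equivalence seen on either side by stage `t`
  -- must hold on the other side. The fixed type `β` replaces the types `B a`, which vary with `a`.
  have hu : REPred fun x : (((α × ℕ) × ℕ) × β) × β =>
      (encode x.1.2 ∈ (ofNat Nat.Partrec.Code x.1.1.1.2).eval x.1.1.2.unpair.1 ∧
        encode x.2 ∈ (ofNat Nat.Partrec.Code x.1.1.1.2).eval x.1.1.2.unpair.2.unpair.1) ∧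
      ((∃ w, ι x.1.1.1.1 w = x.1.2) ∧ ∃ w, ι x.1.1.1.1 w = x.2) ∧
      (T (x.1.1.2.unpair.1, x.1.1.2.unpair.2.unpair.1) x.1.1.2.unpair.2.unpair.2 = true →
        W (x.1.1.1.1, x.1.2, x.2)) ∧
      (S (x.1.1.1.1, x.1.2, x.2) x.1.1.2.unpair.2.unpair.2 = true →
        RInf x.1.1.2.unpair.1 x.1.1.2.unpair.2.unpair.1) := by
    refine re_and (re_and ?_ ?_) (re_and (re_and ?_ ?_) (re_and ?_ ?_))
    · exact re_comp (f := fun x : (((α × ℕ) × ℕ) × β) × β =>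
        (x.1.1.1.2, x.1.1.2.unpair.1, encode x.1.2)) re_mem_eval (Primrec.to_comp (by fun_prop))
    · exact re_comp (f := fun x : (((α × ℕ) × ℕ) × β) × β =>
        (x.1.1.1.2, x.1.1.2.unpair.2.unpair.1, encode x.2)) re_mem_eval
        (Primrec.to_comp (by fun_prop))
    · exact re_comp (f := fun x : (((α × ℕ) × ℕ) × β) × β => (x.1.1.1.1, x.1.2)) hV
        (Primrec.to_comp (by fun_prop))
    · exact re_comp (f := fun x : (((α × ℕ) × ℕ) × β) × β => (x.1.1.1.1, x.2)) hV
        (Primrec.to_comp (by fun_prop))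
    · exact re_imp_of_stage hT hW (f := fun x : (((α × ℕ) × ℕ) × β) × β =>
        ((x.1.1.2.unpair.1, x.1.1.2.unpair.2.unpair.1), x.1.1.2.unpair.2.unpair.2))
        (g := fun x => (x.1.1.1.1, x.1.2, x.2)) (by fun_prop) (by fun_prop)
    · exact re_imp_of_stage hS re_rInf (f := fun x : (((α × ℕ) × ℕ) × β) × β =>
        ((x.1.1.1.1, x.1.2, x.2), x.1.1.2.unpair.2.unpair.2))
        (g := fun x => (x.1.1.2.unpair.1, x.1.1.2.unpair.2.unpair.1)) (by fun_prop) (by fun_prop)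
  have hsig := isSigma03_of_re (re_exists (re_exists hu))
  have hEW : ∀ a u v, E a u v ↔ ∃ t, S (a, ι a u, ι a v) t = true := fun a u v => by
    rw [hE, iS]
  refine (?_ : (fun a => Reduces RInf (E a)) = _) ▸ hsig
  funext a
  refine propext ⟨?_, ?_⟩
  · rintro ⟨f, hf, hfE⟩
    obtain ⟨c, hc⟩ := Nat.Partrec.Code.exists_code.1
      (Partrec.nat_iff.1 (Computable.encode.comp hf).partrec)
    have hc' : ∀ x, encode (ι a (f x)) ∈ (ofNat Nat.Partrec.Code (encode c)).eval x := fun x => by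
      rw [ofNat_encode, hc, hι]
      exact Part.mem_some _
    refine ⟨encode c, fun y => ⟨ι a (f y.unpair.1), ι a (f y.unpair.2.unpair.1),
      ⟨hc' _, hc' _⟩, ⟨⟨_, rfl⟩, ⟨_, rfl⟩⟩, fun h => ?_, fun h => ?_⟩⟩
    · exact (hE _ _ _).1 ((hfE _ _).1 ((iT (_, _)).2 ⟨_, h⟩))
    · exact (hfE _ _).2 ((hEW _ _ _).2 ⟨_, h⟩)
  · rintro ⟨e, he⟩
    have h1 : ∀ x, ∃ w : B a, encode w ∈ (ofNat Nat.Partrec.Code e).eval x := by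
      intro x
      obtain ⟨u, v, ⟨hu, -⟩, ⟨⟨w, hw⟩, -⟩, -⟩ := he (Nat.pair x 0)
      refine ⟨w, ?_⟩
      rw [← hι, hw]
      simpa using hu
    choose f hf using h1
    refine ⟨f, ?_, fun x y => ?_⟩
    · rw [← Computable.encode_iff]
      have : Partrec (ofNat Nat.Partrec.Code e).eval :=
        Partrec.nat_iff.2 (Nat.Partrec.Code.exists_code.2 ⟨_, rfl⟩)
      exact this.of_eq_tot hf
    · have h2 : ∀ t, (T (x, y) t = true → E a (f x) (f y)) ∧
          (S (a, ι a (f x), ι a (f y)) t = true → RInf x y) := by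
        intro t
        obtain ⟨u, v, ⟨hu, hv⟩, -, h3, h4⟩ := he (Nat.pair x (Nat.pair y t))
        simp only [Nat.unpair_pair] at hu hv h3 h4
        have hu' : u = ι a (f x) := encode_injective
          ((Part.mem_unique hu (hf x)).trans (hι _ _).symm)
        have hv' : v = ι a (f y) := encode_injective
          ((Part.mem_unique hv (hf y)).trans (hι _ _).symm)
        subst hu' hv'
        exact ⟨fun h => (hE _ _ _).2 (h3 h), h4⟩
      constructor
      · intro h
        obtain ⟨t, ht⟩ := (iT (x, y)).1 h
        exact (h2 t).1 ht
      · intro h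
        obtain ⟨t, ht⟩ := (hEW _ _ _).1 h
        exact (h2 t).2 ht

end Sigma

/-! ### Word problems of recursive presentations -/

/-- The homomorphisms need to be inverse to each other only on the letters in the range of `ε`; the
remaining letters of `Y` may generate anything, as no compared word contains them. -/
theorem wordProblem_iff_of_hom {X Y A : Type} [Group A] {φ : X → A} {ε : X → Y} {S : Set (Word Y)}
    (θ : A →* PresentedGroup (FreeGroup.mk '' S)) (hθ : ∀ x, θ (φ x) = PresentedGroup.of (ε x))
    (η : PresentedGroup (FreeGroup.mk '' S) →* A) (hη : ∀ x, η (PresentedGroup.of (ε x)) = φ x)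
    (u v : Word X) : WordProblem φ u v ↔
      PresentedGroup.mk (FreeGroup.mk '' S) (FreeGroup.mk (wordMap ε u)) =
        PresentedGroup.mk (FreeGroup.mk '' S) (FreeGroup.mk (wordMap ε v)) := by
  have h : ∀ w, PresentedGroup.mk (FreeGroup.mk '' S) (FreeGroup.mk (wordMap ε w)) =
      FreeGroup.lift (fun x => (PresentedGroup.of (ε x) : PresentedGroup (FreeGroup.mk '' S)))
        (FreeGroup.mk w) := by
    intro w
    rw [← lift_of, lift_wordMap]
  have h1 : ∀ w, θ (FreeGroup.lift φ (FreeGroup.mk w)) =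
      PresentedGroup.mk (FreeGroup.mk '' S) (FreeGroup.mk (wordMap ε w)) := by
    intro w
    rw [h, ← MonoidHom.comp_apply]
    congr 1
    ext x
    simp [hθ]
  have h2 : ∀ w, η (PresentedGroup.mk (FreeGroup.mk '' S) (FreeGroup.mk (wordMap ε w))) =
      FreeGroup.lift φ (FreeGroup.mk w) := by
    intro w
    rw [h, ← MonoidHom.comp_apply]
    congr 1
    ext x
    simp [hη]
  constructor
  · intro he
    rw [← h1, ← h1]
    exact congrArg θ he
  · intro he
    have := congrArg η he
    rw [h2, h2] at this
    exact this

section Coding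

variable {α Y : Type} [Primcodable α] [Primcodable Y] {X : α → Type} [∀ a, Primcodable (X a)]
  {A : α → Type} [∀ a, Group (A a)]

/-- A uniform family of groups with generators `φ a`, presented over a fixed alphabet `Y`. -/
structure IsCoding (φ : ∀ a, X a → A a) (ε : ∀ a, X a → Y) (R : α → Set (Word Y)) : Prop where
  encode_eq : ∀ a x, encode (ε a x) = encode x
  re_range : REPred fun p : α × Y => ∃ x, ε p.1 x = p.2
  re_rel : REPred fun p : α × Word Y => p.2 ∈ R p.1
  wordProblem_iff : ∀ a u v, WordProblem (φ a) u v ↔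
    PresentedGroup.mk (FreeGroup.mk '' R a) (FreeGroup.mk (wordMap (ε a) u)) =
      PresentedGroup.mk (FreeGroup.mk '' R a) (FreeGroup.mk (wordMap (ε a) v))

variable {φ : ∀ a, X a → A a} {ε : ∀ a, X a → Y} {R : α → Set (Word Y)}

theorem IsCoding.isCeer (h : IsCoding φ ε R) (a : α) : IsCeer (WordProblem (φ a)) := by
  refine ⟨⟨fun _ => rfl, fun h => Eq.symm h, fun h h' => Eq.trans h h'⟩, ?_⟩
  -- Renaming does not change the code of a word, so on codes it is the identity.
  have hm : Computable (wordMap (ε a)) := Computable.encode_iff.1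
    (Computable.encode.of_eq fun w => (encode_wordMap (h.encode_eq a) w).symm)
  refine (re_comp (f := fun p : Word (X a) × Word (X a) =>
    (a, wordMap (ε a) p.1, wordMap (ε a) p.2)) (re_presented_eq h.re_rel)
    ((Computable.const a).pair ((hm.comp Computable.fst).pair (hm.comp Computable.snd)))).of_eq
    fun p => (h.wordProblem_iff a p.1 p.2).symm

theorem IsCoding.isSigma03 (h : IsCoding φ ε R) :
    IsSigma03 fun a => Reduces RInf (WordProblem (φ a)) := by
  refine isSigma03_reduces (fun a => WordProblem (φ a)) (fun a => wordMap (ε a))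
    (fun a => encode_wordMap (h.encode_eq a)) ?_ (re_presented_eq h.re_rel) h.wordProblem_iff
  have h1 : REPred fun p : α × Word Y => ∀ q ∈ p.2, ∃ x, ε p.1 x = q.1 :=
    re_forall_mem (p := fun x : α × Y × Bool => ∃ y, ε x.1 y = x.2.1)
      (re_comp (f := fun x : α × Y × Bool => (x.1, x.2.1)) h.re_range
        (Primrec.to_comp (by fun_prop)))
  exact h1.of_eq fun p => exists_wordMap.symm

end Coding

/-- The inclusion of the generators of a recursive presentation into `ℕ`. -/
def genCode (P : RecPres) (x : RecPres.X P) : ℕ := encode x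

theorem genCode_injective (P : RecPres) : Function.Injective (genCode P) :=
  fun _ _ h => encode_injective h

theorem exists_genCode {P : RecPres} {y : ℕ} :
    (∃ x, genCode P x = y) ↔ P.1.elim true (fun k => decide (y < k)) = true := by
  obtain ⟨_ | k, c⟩ := P
  · simp only [Option.elim_none, iff_true]
    exact ⟨(y : ℕ), rfl⟩
  · simp only [Option.elim_some, decide_eq_true_eq]
    constructor
    · rintro ⟨x, rfl⟩
      exact Fin.isLt (n := k) x
    · intro h
      exact ⟨(⟨y, h⟩ : Fin k), rfl⟩

theorem re_exists_genCode : REPred fun p : RecPres × ℕ => ∃ x, genCode p.1 x = p.2 := by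
  refine (re_of_bool (T := fun p : RecPres × ℕ =>
    p.1.1.elim true (fun k => decide (p.2 < k))) (Primrec.to_comp (by fun_prop))).of_eq
    fun p => exists_genCode.symm

/-- The relators of a recursive presentation, as words over `ℕ`. -/
def natRelators (P : RecPres) : Set (Word ℕ) := wordMap (genCode P) '' RecPres.relators P

theorem re_natRelators : REPred fun p : RecPres × Word ℕ => p.2 ∈ natRelators p.1 := by
  have h1 : REPred fun p : RecPres × Word ℕ => ∀ q ∈ p.2, ∃ x, genCode p.1 x = q.1 :=
    re_forall_mem (p := fun x : RecPres × ℕ × Bool => ∃ y, genCode x.1 y = x.2.1)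
      (re_comp (f := fun x : RecPres × ℕ × Bool => (x.1, x.2.1)) re_exists_genCode
        (Primrec.to_comp (by fun_prop)))
  have h2 : REPred fun p : RecPres × Word ℕ =>
      ∃ y, y ∈ (ofNat Nat.Partrec.Code (encode p.1.2)).eval (encode p.2) :=
    re_exists (p := fun x : (RecPres × Word ℕ) × ℕ =>
        x.2 ∈ (ofNat Nat.Partrec.Code (encode x.1.1.2)).eval (encode x.1.2))
      (re_comp (f := fun x : (RecPres × Word ℕ) × ℕ =>
        (encode x.1.1.2, encode x.1.2, x.2)) re_mem_eval (Primrec.to_comp (by fun_prop)))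
  refine (re_and h1 h2).of_eq fun p => ?_
  rw [← exists_wordMap, ofNat_encode, ← Part.dom_iff_mem]
  have he : ∀ w, encode (wordMap (genCode p.1) w) = encode w := encode_wordMap fun _ => rfl
  constructor
  · rintro ⟨⟨w, hw⟩, h⟩
    refine ⟨w, ?_, hw⟩
    rw [← hw, he] at h
    exact h
  · rintro ⟨w, h, hw⟩
    refine ⟨⟨w, hw⟩, ?_⟩
    rw [← hw, he]
    exact h

theorem isCoding_gen : IsCoding (α := RecPres) RecPres.gen genCode natRelators where
  encode_eq _ _ := rfl
  re_range := re_exists_genCode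
  re_rel := re_natRelators
  wordProblem_iff P := by
    have h1 : ∀ r ∈ FreeGroup.mk '' RecPres.relators P, FreeGroup.lift
        (fun x => (PresentedGroup.of (genCode P x) :
          PresentedGroup (FreeGroup.mk '' natRelators P))) r = 1 := by
      rintro _ ⟨r, hr, rfl⟩
      rw [← lift_wordMap (genCode P) fun y =>
        (PresentedGroup.of y : PresentedGroup (FreeGroup.mk '' natRelators P)), lift_of]
      exact PresentedGroup.one_of_mem ⟨_, ⟨r, hr, rfl⟩, rfl⟩
    -- Letters that are not generators are sent to `1`; they occur in no relator.
    have h2 : ∀ r ∈ FreeGroup.mk '' natRelators P, FreeGroup.lift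
        (Function.extend (genCode P) (RecPres.gen P) 1) r = 1 := by
      rintro _ ⟨_, ⟨r, hr, rfl⟩, rfl⟩
      rw [lift_wordMap]
      simp only [(genCode_injective P).extend_apply]
      unfold RecPres.gen
      rw [lift_of]
      exact PresentedGroup.one_of_mem ⟨_, hr, rfl⟩
    refine wordProblem_iff_of_hom (PresentedGroup.toGroup h1)
      (fun x => PresentedGroup.toGroup.of h1) (PresentedGroup.toGroup h2) fun x => ?_
    rw [PresentedGroup.toGroup.of, (genCode_injective P).extend_apply]

/-- The inclusion of the generators of a free product into `ℕ ⊕ ℕ`. -/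
def sumCode (p : RecPres × RecPres) : RecPres.X p.1 ⊕ RecPres.X p.2 → ℕ ⊕ ℕ :=
  Sum.map (genCode p.1) (genCode p.2)

/-- The relators of a free product, as words over `ℕ ⊕ ℕ`. -/
def sumRelators (p : RecPres × RecPres) : Set (Word (ℕ ⊕ ℕ)) :=
  wordMap Sum.inl '' natRelators p.1 ∪ wordMap Sum.inr '' natRelators p.2

theorem wordMap_wordMap {X Y Z : Type} (ε : X → Y) (δ : Y → Z) (w : Word X) :
    wordMap δ (wordMap ε w) = wordMap (fun x => δ (ε x)) w := by
  simp [wordMap]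

theorem isCoding_coprodGen : IsCoding (α := RecPres × RecPres)
    (fun p => RecPres.coprodGen p.1 p.2) sumCode sumRelators where
  encode_eq p x := by
    rcases x with x | x <;> simp [sumCode, genCode]
  re_range := by
    have h1 : REPred fun x : ((RecPres × RecPres) × (ℕ ⊕ ℕ)) × ℕ =>
        (∃ y, genCode x.1.1.1 y = x.2) ∧ decide (Sum.inl x.2 = x.1.2) = true := by
      refine re_and (re_comp (f := fun x : ((RecPres × RecPres) × (ℕ ⊕ ℕ)) × ℕ =>
        (x.1.1.1, x.2)) re_exists_genCode (Primrec.to_comp (by fun_prop)))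
        (re_of_bool (Primrec.to_comp ?_))
      have : Primrec fun x : ((RecPres × RecPres) × (ℕ ⊕ ℕ)) × ℕ => (Sum.inl x.2 : ℕ ⊕ ℕ) :=
        Primrec.sumInl.comp (by fun_prop)
      fun_prop
    have h2 : REPred fun x : ((RecPres × RecPres) × (ℕ ⊕ ℕ)) × ℕ =>
        (∃ y, genCode x.1.1.2 y = x.2) ∧ decide (Sum.inr x.2 = x.1.2) = true := by
      refine re_and (re_comp (f := fun x : ((RecPres × RecPres) × (ℕ ⊕ ℕ)) × ℕ =>
        (x.1.1.2, x.2)) re_exists_genCode (Primrec.to_comp (by fun_prop)))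
        (re_of_bool (Primrec.to_comp ?_))
      have : Primrec fun x : ((RecPres × RecPres) × (ℕ ⊕ ℕ)) × ℕ => (Sum.inr x.2 : ℕ ⊕ ℕ) :=
        Primrec.sumInr.comp (by fun_prop)
      fun_prop
    refine (re_or (re_exists h1) (re_exists h2)).of_eq fun p => ?_
    simp only [decide_eq_true_eq]
    constructor
    · rintro (⟨_, ⟨x, rfl⟩, h⟩ | ⟨_, ⟨x, rfl⟩, h⟩)
      · exact ⟨.inl x, h⟩
      · exact ⟨.inr x, h⟩
    · rintro ⟨x | x, h⟩
      · exact .inl ⟨_, ⟨x, rfl⟩, h⟩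
      · exact .inr ⟨_, ⟨x, rfl⟩, h⟩
  re_rel := by
    have hl : Primrec fun x : ℕ => (Sum.inl x : ℕ ⊕ ℕ) := Primrec.sumInl
    have hr : Primrec fun x : ℕ => (Sum.inr x : ℕ ⊕ ℕ) := Primrec.sumInr
    have ml : Primrec fun x : ((RecPres × RecPres) × Word (ℕ ⊕ ℕ)) × Word ℕ =>
        (wordMap Sum.inl x.2 : Word (ℕ ⊕ ℕ)) := by
      have : Primrec fun y : (((RecPres × RecPres) × Word (ℕ ⊕ ℕ)) × Word ℕ) × ℕ × Bool =>
          ((Sum.inl y.2.1 : ℕ ⊕ ℕ), y.2.2) := (hl.comp (by fun_prop)).pair (by fun_prop)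
      unfold wordMap
      fun_prop
    have mr : Primrec fun x : ((RecPres × RecPres) × Word (ℕ ⊕ ℕ)) × Word ℕ =>
        (wordMap Sum.inr x.2 : Word (ℕ ⊕ ℕ)) := by
      have : Primrec fun y : (((RecPres × RecPres) × Word (ℕ ⊕ ℕ)) × Word ℕ) × ℕ × Bool =>
          ((Sum.inr y.2.1 : ℕ ⊕ ℕ), y.2.2) := (hr.comp (by fun_prop)).pair (by fun_prop)
      unfold wordMap
      fun_prop
    have h1 : REPred fun x : ((RecPres × RecPres) × Word (ℕ ⊕ ℕ)) × Word ℕ =>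
        x.2 ∈ natRelators x.1.1.1 ∧ decide (wordMap Sum.inl x.2 = x.1.2) = true :=
      re_and (re_comp (f := fun x : ((RecPres × RecPres) × Word (ℕ ⊕ ℕ)) × Word ℕ =>
        (x.1.1.1, x.2)) re_natRelators (Primrec.to_comp (by fun_prop)))
        (re_of_bool (Primrec.to_comp (by fun_prop)))
    have h2 : REPred fun x : ((RecPres × RecPres) × Word (ℕ ⊕ ℕ)) × Word ℕ =>
        x.2 ∈ natRelators x.1.1.2 ∧ decide (wordMap Sum.inr x.2 = x.1.2) = true :=
      re_and (re_comp (f := fun x : ((RecPres × RecPres) × Word (ℕ ⊕ ℕ)) × Word ℕ =>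
        (x.1.1.2, x.2)) re_natRelators (Primrec.to_comp (by fun_prop)))
        (re_of_bool (Primrec.to_comp (by fun_prop)))
    refine (re_or (re_exists h1) (re_exists h2)).of_eq fun p => ?_
    simp only [decide_eq_true_eq]
    rfl
  wordProblem_iff p := by
    have hinj : Function.Injective (sumCode p) :=
      (genCode_injective p.1).sumMap (genCode_injective p.2)
    have hl : ∀ r ∈ FreeGroup.mk '' RecPres.relators p.1, FreeGroup.lift
        (fun x => (PresentedGroup.of (Sum.inl (genCode p.1 x)) :
          PresentedGroup (FreeGroup.mk '' sumRelators p))) r = 1 := by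
      rintro _ ⟨r, hr, rfl⟩
      rw [← lift_wordMap (fun x => Sum.inl (genCode p.1 x)) fun y =>
        (PresentedGroup.of y : PresentedGroup (FreeGroup.mk '' sumRelators p)), lift_of]
      exact PresentedGroup.one_of_mem
        ⟨_, .inl ⟨_, ⟨r, hr, rfl⟩, wordMap_wordMap _ _ _⟩, rfl⟩
    have hr : ∀ r ∈ FreeGroup.mk '' RecPres.relators p.2, FreeGroup.lift
        (fun x => (PresentedGroup.of (Sum.inr (genCode p.2 x)) :
          PresentedGroup (FreeGroup.mk '' sumRelators p))) r = 1 := by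
      rintro _ ⟨r, hr, rfl⟩
      rw [← lift_wordMap (fun x => Sum.inr (genCode p.2 x)) fun y =>
        (PresentedGroup.of y : PresentedGroup (FreeGroup.mk '' sumRelators p)), lift_of]
      exact PresentedGroup.one_of_mem
        ⟨_, .inr ⟨_, ⟨r, hr, rfl⟩, wordMap_wordMap _ _ _⟩, rfl⟩
    have h2 : ∀ r ∈ FreeGroup.mk '' sumRelators p, FreeGroup.lift
        (Function.extend (sumCode p) (RecPres.coprodGen p.1 p.2) 1) r = 1 := by
      have el : ∀ x, Function.extend (sumCode p) (RecPres.coprodGen p.1 p.2) 1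
          (Sum.inl (genCode p.1 x)) = Coprod.inl (RecPres.gen p.1 x) :=
        fun x => hinj.extend_apply _ _ (.inl x)
      have er : ∀ x, Function.extend (sumCode p) (RecPres.coprodGen p.1 p.2) 1
          (Sum.inr (genCode p.2 x)) = Coprod.inr (RecPres.gen p.2 x) :=
        fun x => hinj.extend_apply _ _ (.inr x)
      rintro _ ⟨_, ⟨_, ⟨r, hr, rfl⟩, rfl⟩ | ⟨_, ⟨r, hr, rfl⟩, rfl⟩, rfl⟩
      · rw [wordMap_wordMap, lift_wordMap]
        simp only [el]
        have h3 : FreeGroup.lift (RecPres.gen p.1) (FreeGroup.mk r) = 1 := by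
          unfold RecPres.gen
          rw [lift_of]
          exact PresentedGroup.one_of_mem ⟨_, hr, rfl⟩
        have := congrArg (Coprod.inl (N := RecPres.group p.2)) h3
        rw [map_one, ← MonoidHom.comp_apply] at this
        rw [← this]
        congr 1
        ext x
        simp
      · rw [wordMap_wordMap, lift_wordMap]
        simp only [er]
        have h3 : FreeGroup.lift (RecPres.gen p.2) (FreeGroup.mk r) = 1 := by
          unfold RecPres.gen
          rw [lift_of]
          exact PresentedGroup.one_of_mem ⟨_, hr, rfl⟩
        have := congrArg (Coprod.inr (M := RecPres.group p.1)) h3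
        rw [map_one, ← MonoidHom.comp_apply] at this
        rw [← this]
        congr 1
        ext x
        simp
    refine wordProblem_iff_of_hom
      (Coprod.lift (PresentedGroup.toGroup hl) (PresentedGroup.toGroup hr)) (fun x => ?_)
      (PresentedGroup.toGroup h2) fun x => ?_
    · rcases x with x | x
      · exact PresentedGroup.toGroup.of hl
      · exact PresentedGroup.toGroup.of hr
    · rw [PresentedGroup.toGroup.of, hinj.extend_apply]

/-! ### Characterization of `*`-universal groups -/

theorem isUniversalCeer_gen {P : RecPres} :
    IsUniversalCeer (WordProblem (RecPres.gen P)) ↔ Reduces RInf (WordProblem (RecPres.gen P)) :=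
  isUniversalCeer_iff (isCoding_gen.isCeer P)

theorem isUniversalCeer_coprodGen {P Q : RecPres} :
    IsUniversalCeer (WordProblem (RecPres.coprodGen P Q)) ↔
      Reduces RInf (WordProblem (RecPres.coprodGen P Q)) :=
  isUniversalCeer_iff (isCoding_coprodGen.isCeer (P, Q))

theorem isCeer_eq : IsCeer fun x y : ℕ => x = y :=
  ⟨⟨fun _ => rfl, fun h => h.symm, fun h h' => h.trans h'⟩,
    (re_of_bool (T := fun p : ℕ × ℕ => decide (p.1 = p.2))
      (Primrec.to_comp (by fun_prop))).of_eq fun p => by simp⟩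

/-- For nontrivial `P` the free square is one of the required products, and it reduces to each of
the others by `reduces_coprod`. This removes the quantifier over all presentations. -/
theorem isStarUniversal_iff {P : RecPres} : IsStarUniversal P ↔
    Reduces RInf (WordProblem (RecPres.coprodGen P P)) ∧
      ¬ Reduces RInf (WordProblem (RecPres.gen P)) := by
  rw [IsStarUniversal, isUniversalCeer_gen, and_comm]
  refine and_congr_left fun _ => ⟨fun h => ?_, fun h Q hQ => ?_⟩
  -- If `P` were trivial, its free product with a group of order two would be finite, and equality
  -- on `ℕ` does not reduce to a word problem with finitely many classes.
  · rcases subsingleton_or_nontrivial (RecPres.group P) with hP | hP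
    · obtain ⟨Q, hQ, hfin⟩ := exists_finite_nontrivial
      exfalso
      have hsurj : Function.Surjective
          (Coprod.inr : RecPres.group Q →* Coprod (RecPres.group P) (RecPres.group Q)) := by
        intro a
        induction a using Coprod.induction_on' with
        | one => exact ⟨1, map_one _⟩
        | inl_mul x a ih => rwa [Subsingleton.elim x 1, map_one, one_mul]
        | inr_mul x a ih =>
          obtain ⟨y, rfl⟩ := ih
          exact ⟨x * y, map_mul _ _ _⟩
      have : Finite (Coprod (RecPres.group P) (RecPres.group Q)) := Finite.of_surjective _ hsurj
      obtain ⟨f, -, hf⟩ := (h Q hQ).2 _ isCeer_eq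
      exact not_injective_infinite_finite (fun n => FreeGroup.lift (RecPres.coprodGen P Q)
        (FreeGroup.mk (f n))) fun x y hxy => (hf x y).2 hxy
    · exact isUniversalCeer_coprodGen.1 (h P hP)
  · rw [isUniversalCeer_coprodGen]
    obtain ⟨g, hg⟩ := exists_ne (1 : RecPres.group Q)
    obtain ⟨x, rfl⟩ := PresentedGroup.mk_surjective _ g
    obtain ⟨w, rfl⟩ : ∃ w, FreeGroup.mk w = x := Quot.exists_rep x
    refine h.trans (reduces_coprod (RecPres.gen P) (RecPres.gen Q) (w := w) ?_)
    unfold RecPres.gen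
    rwa [lift_of]

theorem isDSigma03_isStarUniversal : IsDSigma03 fun P : RecPres => IsStarUniversal P :=
  ⟨_, _, (isCoding_coprodGen.isSigma03).comp (f := fun P : RecPres => (P, P))
    (Computable.id.pair Computable.id), isCoding_gen.isSigma03, fun _ => isStarUniversal_iff⟩

/-! ### Hardness -/

theorem primrec_listS {α : Type} [Primcodable α] {f : α → ℕ} {b : α → Bool} {l : α → List ℕ}
    (hf : Primrec f) (hb : Primrec b) (hl : Primrec l) :
    Primrec fun a => listS (f a) (b a) (l a) := by
  have h1 : Primrec fun a => (l a).head? := Primrec.list_head?.comp hl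
  have h2 : Primrec fun a => (l a).tail.head? := Primrec.list_head?.comp (Primrec.list_tail.comp hl)
  have h3 : Primrec fun x : (α × ℕ) × ℕ => some (l x.1.1).tail :=
    Primrec.option_some.comp (Primrec.list_tail.comp (by fun_prop))
  have h4 : Primrec fun x : (α × ℕ) × ℕ => some x.2 := Primrec.option_some.comp Primrec.snd
  have h5 : Primrec fun x : (α × ℕ) × ℕ => (l x.1.1).tail.head? := h2.comp (by fun_prop)
  have h : Primrec fun a => (l a).head?.bind fun i => (parS (f a) i).bind fun j =>
      if (l a).tail.head? = some j then some (l a).tail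
      else if kept (f a) i = b a then none else some [] := by fun_prop
  refine h.of_eq fun a => ?_
  cases l a <;> rfl

theorem re_rowNxt : REPred fun p : ℕ × List ℕ × List ℕ => rowNxt p.1 p.2.1 = some p.2.2 := by
  have h1 : REPred fun p : ℕ × List ℕ × List ℕ =>
      ∃ s, decide (listS s (decide (p.1 = 1)) p.2.1 = some p.2.2) = true := by
    refine re_of_stage (Primrec.to_comp ?_)
    have h1 : Primrec fun x : (ℕ × List ℕ × List ℕ) × ℕ =>
        listS x.2 (decide (x.1.1 = 1)) x.1.2.1 :=
      primrec_listS (by fun_prop) (by fun_prop) (by fun_prop)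
    have h2 : Primrec fun x : (ℕ × List ℕ × List ℕ) × ℕ => some x.1.2.2 :=
      Primrec.option_some.comp (by fun_prop)
    fun_prop
  have h2 : REPred fun p : ℕ × List ℕ × List ℕ =>
      ∃ s, decide (((p.2.1.head?.bind (parS s)).map fun j => [j]) = some p.2.2) = true := by
    refine re_of_stage (Primrec.to_comp ?_)
    have h2 : Primrec fun x : (ℕ × List ℕ × List ℕ) × ℕ => some x.1.2.2 :=
      Primrec.option_some.comp (by fun_prop)
    have h3 : Primrec fun x : (ℕ × List ℕ × List ℕ) × ℕ => x.1.2.1.head? :=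
      Primrec.list_head?.comp (by fun_prop)
    have h4 : Primrec fun x : ((ℕ × List ℕ × List ℕ) × ℕ) × ℕ => parS x.1.2 x.2 :=
      primrec_parS_comp (by fun_prop) (by fun_prop)
    fun_prop
  have hc : REPred fun p : ℕ × List ℕ × List ℕ => decide (p.1 < 2) = true :=
    re_of_bool (Primrec.to_comp (by fun_prop))
  have hc' : REPred fun p : ℕ × List ℕ × List ℕ => decide (2 ≤ p.1) = true :=
    re_of_bool (Primrec.to_comp (by fun_prop))
  refine (re_or (re_and hc h1) (re_and hc' h2)).of_eq fun ⟨c, l, m⟩ => ?_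
  simp only [decide_eq_true_eq]
  by_cases h : c < 2
  · rw [rowNxt, if_pos h, listNxt_eq_some]
    simp [h, not_le.2 h]
  · rw [rowNxt, if_neg h]
    simp only [h, false_and, false_or, not_lt.1 h, true_and]
    cases l with
    | nil => simp
    | cons i l =>
      simp only [List.head?_cons, Option.bind_some, Option.map_eq_some_iff, par_eq_some]
      exact ⟨fun ⟨s, a, h, e⟩ => ⟨a, ⟨s, h⟩, e⟩, fun ⟨a, ⟨s, h⟩, e⟩ => ⟨s, a, h, e⟩⟩

theorem re_nodeRel {G : ℕ → ℕ → ℕ → ℕ → Prop}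
    (hG : REPred fun p : ℕ × ℕ × ℕ × ℕ => G p.1 p.2.1 p.2.2.1 p.2.2.2) :
    REPred fun p : ℕ × Word ℕ => p.2 ∈ nodeRel (G p.1) := by
  have hf : ∀ {α : Type} [Primcodable α] {f g : α → Word ℕ}, Primrec f → Primrec g →
      REPred fun a => f a = g a := fun hf hg =>
    (re_of_bool (Primrec.to_comp (primrec_decide_eq hf hg))).of_eq fun _ => by simp
  have h1 : REPred fun p : ℕ × Word ℕ => ∃ x : Node, p.2 = [(encode x, true)] ∧ x.2.2 = [] := by
    refine re_exists (p := fun y : (ℕ × Word ℕ) × Node =>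
      y.1.2 = [(encode y.2, true)] ∧ y.2.2.2 = []) (re_and (hf ?_ ?_) ?_)
    · fun_prop
    · fun_prop
    · exact (re_of_bool (T := fun y : (ℕ × Word ℕ) × Node => decide (y.2.2.2 = []))
        (Primrec.to_comp (by fun_prop))).of_eq fun _ => by simp
  have h2 : REPred fun p : ℕ × Word ℕ =>
      ∃ x : Node, p.2 = [(encode x, true), (encode x, true)] :=
    re_exists (p := fun y : (ℕ × Word ℕ) × Node =>
      y.1.2 = [(encode y.2, true), (encode y.2, true)]) (hf (by fun_prop) (by fun_prop))
  have h3 : REPred fun p : ℕ × Word ℕ => ∃ x y : Node,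
      p.2 = [(encode x, true), (encode y, true), (encode x, false), (encode y, false)] :=
    re_exists (p := fun z : (ℕ × Word ℕ) × Node => ∃ y : Node, z.1.2 =
      [(encode z.2, true), (encode y, true), (encode z.2, false), (encode y, false)])
      (re_exists (p := fun z : ((ℕ × Word ℕ) × Node) × Node => z.1.1.2 =
        [(encode z.1.2, true), (encode z.2, true), (encode z.1.2, false), (encode z.2, false)])
        (hf (by fun_prop) (by fun_prop)))
  have h4 : REPred fun p : ℕ × Word ℕ => ∃ x y : Node,
      p.2 = [(encode x, true), (encode y, false)] ∧ (nodeForest (G p.1)).nxt x = some y := by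
    refine re_exists (p := fun z : (ℕ × Word ℕ) × Node => ∃ y : Node, z.1.2 =
      [(encode z.2, true), (encode y, false)] ∧ (nodeForest (G z.1.1)).nxt z.2 = some y)
      (re_exists (p := fun z : ((ℕ × Word ℕ) × Node) × Node => z.1.1.2 =
        [(encode z.1.2, true), (encode z.2, false)] ∧
          (nodeForest (G z.1.1.1)).nxt z.1.2 = some z.2) (re_and (hf ?_ ?_) ?_))
    · fun_prop
    · fun_prop
    · have e1 : REPred fun z : ((ℕ × Word ℕ) × Node) × Node =>
          G z.1.1.1 z.1.2.1 z.1.2.2.1 (encode z.1.2.2.2) :=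
        re_comp (f := fun z : ((ℕ × Word ℕ) × Node) × Node =>
          (z.1.1.1, z.1.2.1, z.1.2.2.1, encode z.1.2.2.2)) hG (Primrec.to_comp (by fun_prop))
      have e2 : REPred fun z : ((ℕ × Word ℕ) × Node) × Node =>
          rowNxt z.1.2.2.1 z.1.2.2.2 = some z.2.2.2 :=
        re_comp (f := fun z : ((ℕ × Word ℕ) × Node) × Node =>
          (z.1.2.2.1, z.1.2.2.2, z.2.2.2)) re_rowNxt (Primrec.to_comp (by fun_prop))
      have e3 : REPred fun z : ((ℕ × Word ℕ) × Node) × Node =>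
          decide ((z.2.1, z.2.2.1) = (z.1.2.1, z.1.2.2.1)) = true :=
        re_of_bool (Primrec.to_comp (by fun_prop))
      refine (re_and e1 (re_and e2 e3)).of_eq fun ⟨⟨⟨n, w⟩, k, c, l⟩, k', c', l'⟩ => ?_
      rw [nodeForest_eq_some]
      simp only [decide_eq_true_eq, Prod.mk.injEq]
      refine and_congr_right fun _ => ⟨?_, ?_⟩
      · rintro ⟨h, rfl, rfl⟩
        exact ⟨l', h, rfl, rfl, rfl⟩
      · rintro ⟨m, h, rfl, rfl, rfl⟩
        exact ⟨h, rfl, rfl⟩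
  exact re_or h1 (re_or h2 (re_or h3 h4))

/-- A full row of colour 2 decides the word problem condition. Without one, the free square is
universal exactly when the rows `0` and `1` are full for some `k`; both negative cases are refuted
through `DiagCeer`, which reduces to `RInf`. -/
theorem isStarUniversal_node_iff {G : ℕ → ℕ → ℕ → Prop}
    (hG : ∀ k c m n, m ≤ n → G k c n → G k c m) (h2 : ∀ k c m, G k c m ↔ G k (min c 2) m)
    (h01 : ∀ k m, G k 0 m ↔ G k 1 m) {S : Set (Word ℕ)} (hS : S = nodeRel G) :
    (Reduces RInf (WordProblem
        (pairGen fun x => (PresentedGroup.of x : PresentedGroup (FreeGroup.mk '' S)))) ∧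
      ¬ Reduces RInf (WordProblem
        fun x => (PresentedGroup.of x : PresentedGroup (FreeGroup.mk '' S)))) ↔
      (∃ k, ∀ m, G k 0 m) ∧ ¬ ∃ k, ∀ m, G k 2 m := by
  subst hS
  have hd : Reduces DiagCeer RInf := reduces_rInf isCeer_diagCeer
  have hU : Reduces RInf (WordProblem
      fun x => (PresentedGroup.of x : PresentedGroup (FreeGroup.mk '' nodeRel G))) ↔
      ∃ k, ∀ m, G k 2 m := by
    constructor
    · intro h
      by_contra hne
      push Not at hne
      refine not_reduces_val hG (fun k c hc => ?_) (hd.trans h)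
      obtain ⟨m, hm⟩ := hne k
      exact ⟨m, by rwa [h2, min_eq_right (not_lt.1 hc)]⟩
    · rintro ⟨k, hk⟩
      exact reduces_val (k := k) (c := 2) (by norm_num) hk
  rw [hU]
  refine and_congr_left fun ht => ⟨fun h => ?_, fun ⟨k, hk⟩ => ?_⟩
  · by_contra hne
    push Not at hne ht
    refine not_reduces_square hG (fun k c => ?_) (hd.trans h)
    obtain ⟨m, hm⟩ := hne k
    obtain ⟨m', hm'⟩ := ht k
    match c with
    | 0 => exact ⟨m, hm⟩
    | 1 => exact ⟨m, by rwa [← h01]⟩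
    | c + 2 => exact ⟨m', by rwa [h2, min_eq_right (Nat.le_add_left 2 c)]⟩
  · exact reduces_square hk fun m => (h01 k m).1 (hk m)

theorem manyOneReducible_isStarUniversal {q : ℕ → Prop} (hq : IsDSigma03 q) :
    ManyOneReducible q fun P : RecPres => IsStarUniversal P := by
  obtain ⟨s, t, ⟨R, hR, hs⟩, ⟨R', hR', ht⟩, hq⟩ := hq
  -- Bounding `y` by `m` makes the condition c.e. and downward closed in `m`, while its truth for
  -- all `m` is the Π⁰₂ condition on `k`.
  let G : ℕ → ℕ → ℕ → ℕ → Prop := fun n k c m =>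
    ∀ y ≤ m, ∃ z, c < 2 ∧ R (n, k, y, z) ∨ 2 ≤ c ∧ R' (n, k, y, z)
  have hG : REPred fun p : ℕ × ℕ × ℕ × ℕ => G p.1 p.2.1 p.2.2.1 p.2.2.2 := by
    have h1 : REPred fun x : ((ℕ × ℕ × ℕ) × ℕ) × ℕ =>
        (x.1.1.2.2 < 2 ∧ R (x.1.1.1, x.1.1.2.1, x.1.2, x.2) ∨
          2 ≤ x.1.1.2.2 ∧ R' (x.1.1.1, x.1.1.2.1, x.1.2, x.2)) := by
      refine re_or (re_and ?_ ?_) (re_and ?_ ?_)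
      · exact (re_of_bool (T := fun x : ((ℕ × ℕ × ℕ) × ℕ) × ℕ => decide (x.1.1.2.2 < 2))
          (Primrec.to_comp (by fun_prop))).of_eq fun _ => by simp
      · exact re_comp (f := fun x : ((ℕ × ℕ × ℕ) × ℕ) × ℕ =>
          (x.1.1.1, x.1.1.2.1, x.1.2, x.2)) hR.to_re (Primrec.to_comp (by fun_prop))
      · exact (re_of_bool (T := fun x : ((ℕ × ℕ × ℕ) × ℕ) × ℕ => decide (2 ≤ x.1.1.2.2))
          (Primrec.to_comp (by fun_prop))).of_eq fun _ => by simp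
      · exact re_comp (f := fun x : ((ℕ × ℕ × ℕ) × ℕ) × ℕ =>
          (x.1.1.1, x.1.1.2.1, x.1.2, x.2)) hR'.to_re (Primrec.to_comp (by fun_prop))
    exact re_comp (f := fun p : ℕ × ℕ × ℕ × ℕ => ((p.1, p.2.1, p.2.2.1), p.2.2.2))
      (re_forall_le (re_exists h1)) (Primrec.to_comp (by fun_prop))
  obtain ⟨c, hc, hcG⟩ := exists_code_family (re_nodeRel hG)
  refine ⟨fun n => (none, c n), (Computable.const none).pair hc, fun n => ?_⟩
  have hS : RecPres.relators (none, c n) = nodeRel (G n) := Set.ext fun r => hcG n r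
  refine Iff.trans ?_ isStarUniversal_iff.symm
  refine Iff.trans ?_ (isStarUniversal_node_iff (G := G n) ?_ ?_ ?_ hS).symm
  · rw [hq, hs, ht]
    have e0 : ∀ k, (∀ m, G n k 0 m) ↔ ∀ y, ∃ z, R (n, k, y, z) := fun k => by
      simp only [G, Nat.ofNat_pos, true_and, nonpos_iff_eq_zero, OfNat.ofNat_ne_zero, false_and,
        or_false]
      exact ⟨fun h y => h y y le_rfl, fun h _ y _ => h y⟩
    have e2 : ∀ k, (∀ m, G n k 2 m) ↔ ∀ y, ∃ z, R' (n, k, y, z) := fun k => by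
      simp only [G, lt_irrefl, false_and, false_or, le_refl, true_and]
      exact ⟨fun h y => h y y le_rfl, fun h _ y _ => h y⟩
    simp only [e0, e2]
  · exact fun k c m m' hm h y hy => h y (hy.trans hm)
  · intro k c m
    have h1 : min c 2 < 2 ↔ c < 2 := by omega
    have h2 : 2 ≤ min c 2 ↔ 2 ≤ c := by omega
    simp only [G, h1, h2]
  · intro k m
    simp [G]

end CeerGroups

/-- The set of recursive presentations of `*`-universal groups is `d-Σ⁰₃`-complete. -/
theorem mainTheorem4 :
    CeerGroups.IsDSigma03Complete (fun P : CeerGroups.RecPres => CeerGroups.IsStarUniversal P) :=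
  ⟨CeerGroups.isDSigma03_isStarUniversal, fun _ => CeerGroups.manyOneReducible_isStarUniversal⟩
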